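/- Let $\Omega\subset\mathbb R^d$ ($d\ge 1$) be a bounded domain with $C^\infty$ boundary, $T>0$, $M\in C([0,T]\times[0,T])$ real-valued, and for $t\in(0,T)$ let $O(t)\subset\Omega$ be open sets such that $O=\{(t,x): t\in(0,T),\ x\in O(t)\}$ is measurable. Put $V=H^2(\Omega)\cap H^1_0(\Omega)$ with the $H^2$ norm; all functions are real-valued, $H^{-1}(\Omega)$ and $V'$ are the duals of $H^1_0(\Omega)$ and $V$ (with the dual norms), and $L^2(\Omega)\subset H^{-1}(\Omega)\subset V'$ with $L^2(\Omega)$ as pivot space. For $(y_0,y_1)\in H^1_0(\Omega)\times L^2(\Omega)$ and $u\in L^2(O)$ consider the weak solution $y\in C([0,T];H^1_0(\Omega))\cap C^1([0,T];L^2(\Omega))$ of $$y_{tt}-\Delta y+\int_0^t M(t,s)y(s)\,ds=\chi_{O(t)}u\ \text{ in }(0,T)\times\Omega,\qquad y=0\ \text{ on }(0,T)\times\partial\Omega,\qquad y(0)=y_0,\ y_t(0)=y_1. \tag{1}$$ System (1) is called memory-type null controllable at time $T$ if for every $(y_0,y_1)\in V\times H^1_0(\Omega)$ there is $u\in L^2(O)$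 such that the corresponding solution satisfies $y(T)=0$, $y_t(T)=0$ and $\int_0^T M(T,s)y(s)\,ds=0$ in $\Omega$. For $(p_0,p_1,q_0)\in L^2(\Omega)\times H^{-1}(\Omega)\times L^2(\Omega)$ consider the solution $p\in C([0,T];L^2(\Omega))\cap C^1([0,T];H^{-1}(\Omega))$, in the sense of transposition, of $$p_{tt}-\Delta p+\int_t^T M(s,t)p(s)\,ds+M(T,t)q_0=0\ \text{ in }(0,T)\times\Omega,\qquad p=0\ \text{ on }(0,T)\times\partial\Omega,\qquad p(T)=p_0,\ p_t(T)=p_1. \tag{2}$$ **Proposition 3.1.** System (1) is memory-type null controllable at time $T$ if and only if there is a constant $C>0$ such that $$|p(0)|^2_{H^{-1}(\Omega)}+|p_t(0)|^2_{V'}\le C\,|p|^2_{L^2(O)}=C\int_0^T\!\!\int_{O(t)}|p(t,x)|^2\,dx\,dt$$ for all $(p_0,p_1,q_0)\in L^2(\Omega)\times H^{-1}(\Omega)\times L^2(\Omega)$, where $p$ is the solution of (2). -/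

import Mathlib

open MeasureTheory Set Topology TopologicalSpace
open scoped ContDiff Distributions InnerProductSpace

noncomputable section

namespace MemoryWave

/-- `Ω` has `C^∞` boundary: near every boundary point it is the sublevel set `{φ < 0}` of a smooth
function `φ` whose differential does not vanish at that point. -/
def HasSmoothBoundary {d : ℕ} (Ω : Set (EuclideanSpace ℝ (Fin d))) : Prop :=
  ∀ x ∈ frontier Ω, ∃ U : Set (EuclideanSpace ℝ (Fin d)), IsOpen U ∧ x ∈ U ∧
    ∃ φ : EuclideanSpace ℝ (Fin d) → ℝ,
      ContDiff ℝ ∞ φ ∧ fderiv ℝ φ x ≠ 0 ∧ ∀ z ∈ U, z ∈ Ω ↔ φ z < 0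

/-- The real Hilbert space `L²(Ω)`. -/
abbrev L2 {d : ℕ} (Ω : Opens (EuclideanSpace ℝ (Fin d))) : Type :=
  Lp ℝ 2 (volume.restrict (Ω : Set (EuclideanSpace ℝ (Fin d))))

/-- The `i`-th partial derivative of a test function. -/
def testPartial {d : ℕ} {Ω : Opens (EuclideanSpace ℝ (Fin d))} (i : Fin d) (φ : 𝓓(Ω, ℝ))
    (x : EuclideanSpace ℝ (Fin d)) : ℝ :=
  fderiv ℝ φ x (EuclideanSpace.single i 1)

/-- `w ∈ L²(Ω)` is the weak partial derivative `∂ᵢ u` of `u ∈ L²(Ω)`. -/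
def HasWeakPartial {d : ℕ} {Ω : Opens (EuclideanSpace ℝ (Fin d))} (i : Fin d) (u w : L2 Ω) : Prop :=
  ∀ φ : 𝓓(Ω, ℝ), ∫ x in (Ω : Set (EuclideanSpace ℝ (Fin d))), u x * testPartial i φ x =
    -∫ x in (Ω : Set (EuclideanSpace ℝ (Fin d))), w x * φ x

/-- Pairs `(u, (gᵢ)ᵢ)` in `L²(Ω) × L²(Ω)^d` with norm `(‖u‖² + ∑ᵢ ‖gᵢ‖²)^{1/2}`: the space in which
`H¹(Ω)` sits isometrically as the set of pairs `(u, ∇u)`. -/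
abbrev Jet1 {d : ℕ} (Ω : Opens (EuclideanSpace ℝ (Fin d))) : Type :=
  WithLp 2 (L2 Ω × PiLp 2 (fun _ : Fin d => L2 Ω))

/-- `H¹₀(Ω)`: the closure of the test functions in `H¹(Ω)`; the element `u` of `H¹₀(Ω)` is stored
as the pair `(u, ∇u)`, so that the norm inherited from `Jet1 Ω` is the `H¹` norm. -/
def H10 {d : ℕ} (Ω : Opens (EuclideanSpace ℝ (Fin d))) : Submodule ℝ (Jet1 Ω) :=
  (Submodule.span ℝ {w : Jet1 Ω | ∃ φ : 𝓓(Ω, ℝ),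
    (w.fst : EuclideanSpace ℝ (Fin d) → ℝ)
        =ᵐ[volume.restrict (Ω : Set (EuclideanSpace ℝ (Fin d)))] φ ∧
      ∀ i : Fin d, (w.snd i : EuclideanSpace ℝ (Fin d) → ℝ)
        =ᵐ[volume.restrict (Ω : Set (EuclideanSpace ℝ (Fin d)))] testPartial i φ}).topologicalClosure

/-- The inclusion `H¹₀(Ω) → L²(Ω)`. -/
def toL2 {d : ℕ} {Ω : Opens (EuclideanSpace ℝ (Fin d))} : H10 Ω →L[ℝ] L2 Ω :=
  (WithLp.fstL 2 ℝ (L2 Ω) (PiLp 2 (fun _ : Fin d => L2 Ω))).comp (H10 Ω).subtypeL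

/-- The gradient `H¹₀(Ω) → L²(Ω)^d`. -/
def grad {d : ℕ} {Ω : Opens (EuclideanSpace ℝ (Fin d))} :
    H10 Ω →L[ℝ] PiLp 2 (fun _ : Fin d => L2 Ω) :=
  (WithLp.sndL 2 ℝ (L2 Ω) (PiLp 2 (fun _ : Fin d => L2 Ω))).comp (H10 Ω).subtypeL

/-- `H⁻¹(Ω)`, the dual of `H¹₀(Ω)`, with the dual norm. -/
abbrev Hneg1 {d : ℕ} (Ω : Opens (EuclideanSpace ℝ (Fin d))) : Type :=
  StrongDual ℝ (H10 Ω)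

/-- The embedding `L²(Ω) → H⁻¹(Ω)` (pivot space `L²(Ω)`): `f` acts by `v ↦ ∫_Ω f v`. -/
def toHneg1 {d : ℕ} {Ω : Opens (EuclideanSpace ℝ (Fin d))} (f : L2 Ω) : Hneg1 Ω :=
  (innerSL ℝ f).comp toL2

theorem integrable_mul_testFunction {d : ℕ} {Ω : Opens (EuclideanSpace ℝ (Fin d))} (u : L2 Ω)
    {f : EuclideanSpace ℝ (Fin d) → ℝ} (hf : Continuous f) (hc : HasCompactSupport f) :
    Integrable (fun x => u x * f x) (volume.restrict (Ω : Set (EuclideanSpace ℝ (Fin d)))) :=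
  MemLp.integrable_mul (p := 2) (q := 2) (Lp.memLp u)
    ((hf.memLp_of_hasCompactSupport hc).restrict _)

theorem integrable_mul_coe {d : ℕ} {Ω : Opens (EuclideanSpace ℝ (Fin d))} (u : L2 Ω)
    (φ : 𝓓(Ω, ℝ)) :
    Integrable (fun x => u x * φ x) (volume.restrict (Ω : Set (EuclideanSpace ℝ (Fin d)))) :=
  integrable_mul_testFunction u φ.continuous φ.hasCompactSupport

theorem integrable_mul_testPartial {d : ℕ} {Ω : Opens (EuclideanSpace ℝ (Fin d))} (u : L2 Ω)
    (i : Fin d) (φ : 𝓓(Ω, ℝ)) :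
    Integrable (fun x => u x * testPartial i φ x)
      (volume.restrict (Ω : Set (EuclideanSpace ℝ (Fin d)))) := by
  refine integrable_mul_testFunction u ?_ ?_
  · exact (φ.contDiff.continuous_fderiv (by simp)).clm_apply continuous_const
  · exact φ.hasCompactSupport.fderiv_apply (𝕜 := ℝ) _

theorem HasWeakPartial.add {d : ℕ} {Ω : Opens (EuclideanSpace ℝ (Fin d))} {i : Fin d}
    {u w u' w' : L2 Ω} (h : HasWeakPartial i u w) (h' : HasWeakPartial i u' w') :
    HasWeakPartial i (u + u') (w + w') := by
  intro φ
  have e1 : ∫ x in (Ω : Set (EuclideanSpace ℝ (Fin d))), (u + u') x * testPartial i φ x =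
      ∫ x in (Ω : Set (EuclideanSpace ℝ (Fin d))),
        (u x * testPartial i φ x + u' x * testPartial i φ x) := by
    refine integral_congr_ae ?_
    filter_upwards [Lp.coeFn_add u u'] with x hx
    rw [hx, Pi.add_apply, add_mul]
  have e2 : ∫ x in (Ω : Set (EuclideanSpace ℝ (Fin d))), (w + w') x * φ x =
      ∫ x in (Ω : Set (EuclideanSpace ℝ (Fin d))), (w x * φ x + w' x * φ x) := by
    refine integral_congr_ae ?_
    filter_upwards [Lp.coeFn_add w w'] with x hx
    rw [hx, Pi.add_apply, add_mul]
  rw [e1, e2, integral_add (integrable_mul_testPartial u i φ) (integrable_mul_testPartial u' i φ),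
    integral_add (integrable_mul_coe w φ) (integrable_mul_coe w' φ), h φ, h' φ]
  ring

theorem HasWeakPartial.smul {d : ℕ} {Ω : Opens (EuclideanSpace ℝ (Fin d))} {i : Fin d}
    {u w : L2 Ω} (c : ℝ) (h : HasWeakPartial i u w) : HasWeakPartial i (c • u) (c • w) := by
  intro φ
  have e1 : ∫ x in (Ω : Set (EuclideanSpace ℝ (Fin d))), (c • u) x * testPartial i φ x =
      ∫ x in (Ω : Set (EuclideanSpace ℝ (Fin d))), c * (u x * testPartial i φ x) := by
    refine integral_congr_ae ?_
    filter_upwards [Lp.coeFn_smul c u] with x hx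
    rw [hx, Pi.smul_apply, smul_eq_mul, mul_assoc]
  have e2 : ∫ x in (Ω : Set (EuclideanSpace ℝ (Fin d))), (c • w) x * φ x =
      ∫ x in (Ω : Set (EuclideanSpace ℝ (Fin d))), c * (w x * φ x) := by
    refine integral_congr_ae ?_
    filter_upwards [Lp.coeFn_smul c w] with x hx
    rw [hx, Pi.smul_apply, smul_eq_mul, mul_assoc]
  rw [e1, e2, integral_const_mul, integral_const_mul, h φ]
  ring

theorem HasWeakPartial.zero {d : ℕ} {Ω : Opens (EuclideanSpace ℝ (Fin d))} {i : Fin d} :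
    HasWeakPartial i (0 : L2 Ω) (0 : L2 Ω) := by
  simpa using HasWeakPartial.smul (Ω := Ω) (i := i) (u := 0) (w := 0) (0 : ℝ)
    (fun φ => by
      have e : ∀ f : EuclideanSpace ℝ (Fin d) → ℝ,
          ∫ x in (Ω : Set (EuclideanSpace ℝ (Fin d))), (0 : L2 Ω) x * f x = 0 := by
        intro f
        refine integral_eq_zero_of_ae ?_
        filter_upwards [Lp.coeFn_zero ℝ 2
          (volume.restrict (Ω : Set (EuclideanSpace ℝ (Fin d))))] with x hx
        rw [hx]; simp
      rw [e, e, neg_zero])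

/-- `V = H²(Ω) ∩ H¹₀(Ω)`: the element `u` of `V` is stored as the pair `(u, (∂ⱼ∂ᵢ u)ᵢⱼ)` in
`H¹₀(Ω) × L²(Ω)^{d×d}`, so that the inherited norm is the `H²` norm
`(‖u‖² + ∑ᵢ ‖∂ᵢ u‖² + ∑ᵢⱼ ‖∂ⱼ∂ᵢ u‖²)^{1/2}`. -/
def V {d : ℕ} (Ω : Opens (EuclideanSpace ℝ (Fin d))) :
    Submodule ℝ (WithLp 2 (H10 Ω × PiLp 2 (fun _ : Fin d × Fin d => L2 Ω))) where
  carrier := {w | ∀ i j : Fin d, HasWeakPartial j (grad w.fst i) (w.snd (i, j))}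
  add_mem' := fun {a b} ha hb i j => by
    simpa using (ha i j).add (hb i j)
  zero_mem' := fun i j => by
    simpa using HasWeakPartial.zero (Ω := Ω) (i := j)
  smul_mem' := fun c a ha i j => by
    simpa using (ha i j).smul c

/-- The inclusion `V → H¹₀(Ω)`. -/
def VtoH10 {d : ℕ} {Ω : Opens (EuclideanSpace ℝ (Fin d))} : V Ω →L[ℝ] H10 Ω :=
  (WithLp.fstL 2 ℝ (H10 Ω) (PiLp 2 (fun _ : Fin d × Fin d => L2 Ω))).comp (V Ω).subtypeL

/-- `V'`, the dual of `V`, with the dual norm. -/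
abbrev Vdual {d : ℕ} (Ω : Opens (EuclideanSpace ℝ (Fin d))) : Type :=
  StrongDual ℝ (V Ω)

/-- The embedding `H⁻¹(Ω) → V'`: restriction of functionals from `H¹₀(Ω)` to `V`. -/
def toVdual {d : ℕ} {Ω : Opens (EuclideanSpace ℝ (Fin d))} (f : Hneg1 Ω) : Vdual Ω :=
  f.comp VtoH10

/-- `v ∈ H¹₀(Ω)` and `Δ v = g ∈ L²(Ω)` in the sense of distributions (for `v ∈ H¹₀(Ω)`, testing
against `𝓓(Ω)` and against its closure `H¹₀(Ω)` is the same). On a bounded domain with smooth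
boundary the `v` admitting such a `g` are the elements of `V`, by elliptic regularity. -/
def HasDirichletLaplacian {d : ℕ} {Ω : Opens (EuclideanSpace ℝ (Fin d))}
    (v : H10 Ω) (g : L2 Ω) : Prop :=
  ∀ w : H10 Ω, ⟪grad v, grad w⟫_ℝ = -⟪g, toL2 w⟫_ℝ

/-- The space-time control region `{(t, x) | 0 < t < T, x ∈ O(t)}`. -/
def controlRegion {d : ℕ} (T : ℝ) (O : ℝ → Set (EuclideanSpace ℝ (Fin d))) :
    Set (ℝ × EuclideanSpace ℝ (Fin d)) :=
  {z | z.1 ∈ Ioo 0 T ∧ z.2 ∈ O z.1}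

/-- `y ∈ C([0,T]; H¹₀(Ω)) ∩ C¹([0,T]; L²(Ω))`, with time derivative `y'`, is the weak solution of
`y_tt - Δ y + ∫₀ᵗ M(t,s) y(s) ds = χ_{O(t)} u` in `(0,T) × Ω`, `y = 0` on `(0,T) × ∂Ω`,
`y(0) = y₀`, `y_t(0) = y₁`. The equation is tested against `v ∈ H¹₀(Ω)` and integrated in time. -/
structure IsMemoryWaveSolution {d : ℕ} (Ω : Opens (EuclideanSpace ℝ (Fin d))) (T : ℝ)
    (M : ℝ → ℝ → ℝ) (O : ℝ → Set (EuclideanSpace ℝ (Fin d))) (y₀ : H10 Ω) (y₁ : L2 Ω)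
    (u : ℝ × EuclideanSpace ℝ (Fin d) → ℝ) (y : ℝ → H10 Ω) (y' : ℝ → L2 Ω) : Prop where
  continuousOn : ContinuousOn y (Icc 0 T)
  continuousOn_deriv : ContinuousOn y' (Icc 0 T)
  hasDeriv : ∀ t ∈ Icc 0 T, HasDerivWithinAt (fun s => toL2 (y s)) (y' t) (Icc 0 T) t
  init : y 0 = y₀
  init_deriv : y' 0 = y₁
  weak_eq : ∀ v : H10 Ω, ∀ t ∈ Icc 0 T,
    ⟪y' t, toL2 v⟫_ℝ - ⟪y₁, toL2 v⟫_ℝ +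
      ∫ s in 0..t, (⟪grad (y s), grad v⟫_ℝ + ⟪∫ r in 0..s, M s r • toL2 (y r), toL2 v⟫_ℝ) =
    ∫ s in 0..t, ∫ x in O s, u (s, x) * toL2 v x

/-- Memory-type null controllability at time `T`: for all `(y₀, y₁) ∈ V × H¹₀(Ω)` there is a control
`u ∈ L²(O)` whose solution satisfies `y(T) = 0`, `y_t(T) = 0` and `∫₀ᵀ M(T,s) y(s) ds = 0`. -/
def MemoryNullControllable {d : ℕ} (Ω : Opens (EuclideanSpace ℝ (Fin d))) (T : ℝ)
    (M : ℝ → ℝ → ℝ) (O : ℝ → Set (EuclideanSpace ℝ (Fin d))) : Prop :=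
  ∀ (y₀ : V Ω) (y₁ : H10 Ω), ∃ u : ℝ × EuclideanSpace ℝ (Fin d) → ℝ,
    MemLp u 2 (volume.restrict (controlRegion T O)) ∧
    ∃ (y : ℝ → H10 Ω) (y' : ℝ → L2 Ω),
      IsMemoryWaveSolution Ω T M O (VtoH10 y₀) (toL2 y₁) u y y' ∧
      y T = 0 ∧ y' T = 0 ∧ ∫ s in 0..T, M T s • toL2 (y s) = 0

/-- `p ∈ C([0,T]; L²(Ω)) ∩ C¹([0,T]; H⁻¹(Ω))`, with time derivative `p'`, is the solution (in the
sense of transposition) of `p_tt - Δ p + ∫ₜᵀ M(s,t) p(s) ds + M(T,t) q₀ = 0` in `(0,T) × Ω`, `p = 0`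
on `(0,T) × ∂Ω`, `p(T) = p₀`, `p_t(T) = p₁`. The equation is tested against the functions
`v ∈ H¹₀(Ω)` with `Δ v ∈ L²(Ω)`, that is `v ∈ V`, and integrated over `(t, T)`; since `p(t)` is only
in `L²(Ω)`, the boundary condition is contained in this class of test functions. -/
structure IsAdjointSolution {d : ℕ} (Ω : Opens (EuclideanSpace ℝ (Fin d))) (T : ℝ)
    (M : ℝ → ℝ → ℝ) (p₀ : L2 Ω) (p₁ : Hneg1 Ω) (q₀ : L2 Ω)
    (p : ℝ → L2 Ω) (p' : ℝ → Hneg1 Ω) : Prop where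
  continuousOn : ContinuousOn p (Icc 0 T)
  continuousOn_deriv : ContinuousOn p' (Icc 0 T)
  hasDeriv : ∀ t ∈ Icc 0 T, HasDerivWithinAt (fun s => toHneg1 (p s)) (p' t) (Icc 0 T) t
  final : p T = p₀
  final_deriv : p' T = p₁
  weak_eq : ∀ (v : H10 Ω) (g : L2 Ω), HasDirichletLaplacian v g → ∀ t ∈ Icc 0 T,
    p₁ v - p' t v +
      ∫ s in t..T, (-⟪p s, g⟫_ℝ + ⟪∫ r in s..T, M r s • p r, toL2 v⟫_ℝ
        + M T s * ⟪q₀, toL2 v⟫_ℝ) = 0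

/-- The square of the norm of `p` in `L²(O)`: the integral of `|p(t,x)|²` over the control region. -/
def sqNormL2O {d : ℕ} {Ω : Opens (EuclideanSpace ℝ (Fin d))} (T : ℝ)
    (O : ℝ → Set (EuclideanSpace ℝ (Fin d))) (p : ℝ → L2 Ω) : ℝ :=
  ∫ t in 0..T, ∫ x in O t, (p t x) ^ 2

/-- The observability inequality
`|p(0)|²_{H⁻¹(Ω)} + |p_t(0)|²_{V'} ≤ C |p|²_{L²(O)}` for all solutions of the adjoint equation with
final data `(p₀, p₁, q₀) ∈ L²(Ω) × H⁻¹(Ω) × L²(Ω)`. -/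
def AdjointObservable {d : ℕ} (Ω : Opens (EuclideanSpace ℝ (Fin d))) (T : ℝ)
    (M : ℝ → ℝ → ℝ) (O : ℝ → Set (EuclideanSpace ℝ (Fin d))) : Prop :=
  ∃ C : ℝ, 0 < C ∧ ∀ (p₀ : L2 Ω) (p₁ : Hneg1 Ω) (q₀ : L2 Ω) (p : ℝ → L2 Ω) (p' : ℝ → Hneg1 Ω),
    IsAdjointSolution Ω T M p₀ p₁ q₀ p p' →
      ‖toHneg1 (p 0)‖ ^ 2 + ‖toVdual (p' 0)‖ ^ 2 ≤ C * sqNormL2O T O p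

end MemoryWave

end

noncomputable section

namespace MemoryWave

/-! Everything rests on one duality identity. If `y` solves the controlled equation with control `u`
and `p` solves the adjoint equation, then ⟪y_t(T), p₀⟫ − p₁(y(T)) − ⟪∫₀ᵀ M(T,s) y(s) ds, q₀⟫ = ⟪y₁,
p(0)⟫ − p_t(0)(y₀) + ∫∫_O u p. The left side contains exactly the three quantities to be steered to
zero, each paired with its own free final datum. Hence a control succeeds as soon as the right side
vanishes for all adjoint solutions; for this it is enough that the adjoint equation be solvable for
a dense set of data (`IsTransposedSolution.exists_of_mem`, `eq_zero_of_duality`).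

If the system is controllable, the identity bounds ⟪y₁, p(0)⟫ − p_t(0)(y₀) by the norm of a control
times the `L²(O)` norm of `p`, with a constant depending on (y₀, y₁); Banach–Steinhaus on V × H¹₀
makes the bound uniform (`exists_uniform_bound`). Conversely, observability makes this expression a
bounded functional of the trace of `p` on `O`, and Hahn–Banach with Riesz in `L²(O)` produces the
control (`exists_inner_eq_of_abs_le`, `exists_control`). Uniqueness plays no role: the identity
holds for every solution of either equation, and adjoint solutions enter as a linear space, not as
functions of their data.

The analytic work is the identity itself (`wave_duality`), since neither solution is regular enough
to be a test function for the other. With ι : H¹₀ → L² the inclusion, K(f, g) = (−ι†g, ιf) is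
bounded and skew-adjoint with dense range on the energy space, and K⁻¹ generates a strongly
continuous orthogonal group (`exists_orthogonalGroup`). Both (y, y_t) and (−π, p), with π the Riesz
representative of p_t, are weak solutions of Y' = K⁻¹Y + forcing. Conjugation by the group makes
them absolutely continuous curves, whose inner product can be integrated by parts
(`OrthogonalGroup.inner_eq_of_weak`). The group belongs to 1 − Δ, because the inner product is the
full H¹ one; the surplus identity and the memory term are part of the forcing. Existence is then a
Volterra equation (`exists_eq_add_of_volterra`). Lastly, controls are functions on space-time while
solutions are curves in L²(Ω); the identification of L²(time; L²(Ω)) with L² of the product links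
the two (`exists_isSection_of_memLp`, `exists_memLp_isSection`). -/

theorem integral_integral_triangle {T : ℝ} (hT : 0 ≤ T) {f : ℝ → ℝ → ℝ}
    (hf : Integrable (Function.uncurry f)
      ((volume.restrict (Ioc 0 T)).prod (volume.restrict (Ioc 0 T)))) :
    ∫ s in 0..T, ∫ r in s..T, f s r = ∫ r in 0..T, ∫ s in 0..r, f s r := by
  have hmeas : MeasurableSet {z : ℝ × ℝ | z.1 < z.2} :=
    measurableSet_lt measurable_fst measurable_snd
  have key := integral_integral_swap
    (f := fun s r => {z : ℝ × ℝ | z.1 < z.2}.indicator (Function.uncurry f) (s, r))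
    (hf.indicator hmeas)
  rw [intervalIntegral.integral_of_le hT, intervalIntegral.integral_of_le hT]
  refine Eq.trans ?_ (key.trans ?_)
  · refine setIntegral_congr_fun measurableSet_Ioc fun s hs => ?_
    have e : (fun r => {z : ℝ × ℝ | z.1 < z.2}.indicator (Function.uncurry f) (s, r))
        = (Ioi s).indicator (f s) := by
      ext r
      by_cases h : s < r <;> simp [indicator, h]
    simp only [e]
    rw [setIntegral_indicator measurableSet_Ioi, intervalIntegral.integral_of_le hs.2]
    congr 2
    ext r
    simp only [mem_Ioc, mem_inter_iff, mem_Ioi]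
    constructor
    · rintro ⟨h1, h2⟩; exact ⟨⟨hs.1.trans h1, h2⟩, h1⟩
    · rintro ⟨⟨_, h2⟩, h1⟩; exact ⟨h1, h2⟩
  · refine setIntegral_congr_fun measurableSet_Ioc fun r hr => ?_
    have e : (fun s => {z : ℝ × ℝ | z.1 < z.2}.indicator (Function.uncurry f) (s, r))
        = (Iio r).indicator (fun s => f s r) := by
      ext s
      by_cases h : s < r <;> simp [indicator, h]
    simp only [e]
    rw [setIntegral_indicator measurableSet_Iio, intervalIntegral.integral_of_le hr.1.le,
      integral_Ioc_eq_integral_Ioo]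
    congr 2
    ext s
    simp only [mem_Ioc, mem_inter_iff, mem_Iio, mem_Ioo]
    constructor
    · rintro ⟨⟨h1, _⟩, h3⟩; exact ⟨h1, h3⟩
    · rintro ⟨h1, h2⟩; exact ⟨⟨h1, h2.le.trans hr.2⟩, h2⟩

/-! ### Integration by parts for absolutely continuous curves in a Hilbert space -/

section Hilbert

variable {X : Type*} [NormedAddCommGroup X] [InnerProductSpace ℝ X]

theorem intervalIntegrable_inner_of_continuousOn {T : ℝ} (hT : 0 ≤ T) {f g : ℝ → X}
    (hf : IntervalIntegrable f volume 0 T) (hg : ContinuousOn g (Icc 0 T)) :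
    IntervalIntegrable (fun s => ⟪f s, g s⟫_ℝ) volume 0 T := by
  rw [intervalIntegrable_iff_integrableOn_Icc_of_le hT] at hf ⊢
  obtain ⟨C, hC⟩ := isCompact_Icc.exists_bound_of_continuousOn hg
  have hgm : AEStronglyMeasurable g (volume.restrict (Icc 0 T)) :=
    hg.aestronglyMeasurable measurableSet_Icc
  refine (hf.norm.const_mul C).mono' (hf.1.inner hgm) ?_
  filter_upwards [ae_restrict_mem measurableSet_Icc] with s hs
  calc ‖⟪f s, g s⟫_ℝ‖ ≤ ‖f s‖ * ‖g s‖ := norm_inner_le_norm _ _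
    _ ≤ ‖f s‖ * C := by gcongr; exact hC s hs
    _ = C * ‖f s‖ := mul_comm _ _

variable [CompleteSpace X]

theorem intervalIntegral_inner_left {a b : ℝ} {f : ℝ → X} (hf : IntervalIntegrable f volume a b)
    (x : X) : ∫ s in a..b, ⟪f s, x⟫_ℝ = ⟪∫ s in a..b, f s, x⟫_ℝ := by
  simp_rw [real_inner_comm x]
  exact (innerSL ℝ x).intervalIntegral_comp_comm hf

theorem intervalIntegral_inner_right {a b : ℝ} {f : ℝ → X} (hf : IntervalIntegrable f volume a b)
    (x : X) : ∫ s in a..b, ⟪x, f s⟫_ℝ = ⟪x, ∫ s in a..b, f s⟫_ℝ :=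
  (innerSL ℝ x).intervalIntegral_comp_comm hf

/-- Integration by parts for inner products of absolutely continuous curves. -/
theorem inner_eq_add_integral {T : ℝ} (hT : 0 ≤ T) {α β a b : ℝ → X}
    (hα : IntervalIntegrable α volume 0 T) (hβ : IntervalIntegrable β volume 0 T)
    (ha : ∀ t ∈ Icc 0 T, a t = a 0 + ∫ s in 0..t, α s)
    (hb : ∀ t ∈ Icc 0 T, b t = b 0 + ∫ s in 0..t, β s) :
    ⟪a T, b T⟫_ℝ = ⟪a 0, b 0⟫_ℝ + ∫ s in 0..T, (⟪α s, b s⟫_ℝ + ⟪a s, β s⟫_ℝ) := by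
  have hsub : ∀ t ∈ Icc 0 T, uIcc 0 t ⊆ uIcc 0 T := fun t ht =>
    uIcc_subset_uIcc left_mem_uIcc (by rw [uIcc_of_le hT]; exact ht)
  have hsub' : ∀ t ∈ Icc 0 T, uIcc t T ⊆ uIcc 0 T := fun t ht =>
    uIcc_subset_uIcc (by rw [uIcc_of_le hT]; exact ht) right_mem_uIcc
  have hcont : ∀ {c γ : ℝ → X}, IntervalIntegrable γ volume 0 T →
      (∀ t ∈ Icc 0 T, c t = c 0 + ∫ s in 0..t, γ s) → ContinuousOn c (Icc 0 T) := by
    intro c γ hγ hc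
    refine ContinuousOn.congr (continuousOn_const.add ?_) hc
    have := intervalIntegral.continuousOn_primitive_interval
      (μ := volume) (f := γ) (a := 0) (b := T) (by
        rw [intervalIntegrable_iff'] at hγ; exact hγ)
    rwa [uIcc_of_le hT] at this
  have hmem : T ∈ Icc 0 T := ⟨hT, le_rfl⟩
  have hp : Integrable (Function.uncurry fun s r => ⟪α s, β r⟫_ℝ)
      ((volume.restrict (Ioc 0 T)).prod (volume.restrict (Ioc 0 T))) := by
    rw [intervalIntegrable_iff_integrableOn_Ioc_of_le hT] at hα hβ
    exact Integrable.op_fst_snd (op := fun x y : X => ⟪x, y⟫_ℝ) continuous_inner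
      ⟨1, fun x y => by simpa using norm_inner_le_norm (𝕜 := ℝ) x y⟩ hα hβ
  have hsw := integral_integral_triangle hT hp
  -- Writing b(s) = b(T) − ∫ₛᵀ β here and a(s) = a(0) + ∫₀ˢ α in `e2` puts both double integrals on
  -- the triangle s < r, where they cancel by Fubini. No pointwise differentiability is used.
  have e1 : ∫ s in 0..T, ⟪α s, b s⟫_ℝ =
      ⟪a T - a 0, b T⟫_ℝ - ∫ s in 0..T, ∫ r in s..T, ⟪α s, β r⟫_ℝ := by
    have hT' : a T - a 0 = ∫ s in 0..T, α s := by rw [ha T hmem]; abel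
    rw [hT', ← intervalIntegral_inner_left hα, eq_sub_iff_add_eq,
      ← intervalIntegral.integral_add]
    · refine intervalIntegral.integral_congr fun s hs => ?_
      rw [uIcc_of_le hT] at hs
      rw [intervalIntegral_inner_right (hβ.mono_set (hsub' s hs)), ← inner_add_right, hb s hs,
        hb T hmem, add_assoc, intervalIntegral.integral_add_adjacent_intervals
          (hβ.mono_set (hsub s hs)) (hβ.mono_set (hsub' s hs))]
    · exact intervalIntegrable_inner_of_continuousOn hT hα (hcont hβ hb)
    · have : IntervalIntegrable (fun s => ⟪α s, b T - b s⟫_ℝ) volume 0 T :=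
        intervalIntegrable_inner_of_continuousOn hT hα (continuousOn_const.sub (hcont hβ hb))
      refine this.congr fun s hs => ?_
      rw [uIoc_of_le hT] at hs
      have hs' : s ∈ Icc 0 T := ⟨hs.1.le, hs.2⟩
      rw [intervalIntegral_inner_right (hβ.mono_set (hsub' s hs')), hb s hs', hb T hmem,
        ← intervalIntegral.integral_add_adjacent_intervals
          (hβ.mono_set (hsub s hs')) (hβ.mono_set (hsub' s hs'))]
      congr 1; abel
  have e2 : ∫ s in 0..T, ⟪a s, β s⟫_ℝ =
      ⟪a 0, b T - b 0⟫_ℝ + ∫ r in 0..T, ∫ s in 0..r, ⟪α s, β r⟫_ℝ := by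
    have hT' : b T - b 0 = ∫ s in 0..T, β s := by rw [hb T hmem]; abel
    have hai := (intervalIntegrable_inner_of_continuousOn hT hβ (hcont hα ha))
    have ha0 : IntervalIntegrable (fun s => ⟪a 0, β s⟫_ℝ) volume 0 T := by
      simpa only [real_inner_comm] using
        intervalIntegrable_inner_of_continuousOn hT hβ (continuousOn_const (c := a 0))
    simp_rw [real_inner_comm (a _)] at hai
    rw [hT', ← intervalIntegral_inner_right hβ, ← sub_eq_iff_eq_add',
      ← intervalIntegral.integral_sub hai ha0]
    refine intervalIntegral.integral_congr fun s hs => ?_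
    rw [uIcc_of_le hT] at hs
    rw [intervalIntegral_inner_left (hα.mono_set (hsub s hs)), ← inner_sub_left, ha s hs]
    congr 1; abel
  rw [intervalIntegral.integral_add, e1, e2, hsw]
  · rw [inner_sub_left, inner_sub_right]; ring
  · exact intervalIntegrable_inner_of_continuousOn hT hα (hcont hβ hb)
  · simpa only [real_inner_comm] using
      intervalIntegrable_inner_of_continuousOn hT hβ (hcont hα ha)

end Hilbert

/-! ### The orthogonal group generated by the inverse of a skew-adjoint operator -/

section Group

variable {X : Type*} [NormedAddCommGroup X] [InnerProductSpace ℝ X]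

theorem tendsto_zero_of_dense {A : ℕ → X →L[ℝ] X} (hA : ∀ n x, ‖A n x‖ ≤ ‖x‖) {s : Set X}
    (hs : Dense s) (h : ∀ x ∈ s, Filter.Tendsto (fun n => A n x) Filter.atTop (𝓝 0)) (x : X) :
    Filter.Tendsto (fun n => A n x) Filter.atTop (𝓝 0) := by
  rw [Metric.tendsto_atTop]
  intro ε hε
  obtain ⟨z, hz, hxz⟩ := hs.exists_dist_lt x (half_pos hε)
  obtain ⟨n₀, hn₀⟩ := Metric.tendsto_atTop.1 (h z hz) (ε / 2) (half_pos hε)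
  refine ⟨n₀, fun n hn => ?_⟩
  have h1 := hn₀ n hn
  rw [dist_zero_right] at h1 ⊢
  calc ‖A n x‖ = ‖A n (x - z) + A n z‖ := by rw [← map_add, sub_add_cancel]
    _ ≤ ‖x - z‖ + ‖A n z‖ := (norm_add_le _ _).trans (by gcongr; exact hA _ _)
    _ < ε := by rw [dist_eq_norm] at hxz; linarith

theorem cauchySeq_of_dense {A : ℕ → X →L[ℝ] X} (hA : ∀ n x, ‖A n x‖ ≤ ‖x‖) {s : Set X}
    (hs : Dense s) (h : ∀ x ∈ s, CauchySeq (fun n => A n x)) (x : X) :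
    CauchySeq (fun n => A n x) := by
  rw [Metric.cauchySeq_iff]
  intro ε hε
  obtain ⟨z, hz, hxz⟩ := hs.exists_dist_lt x (show 0 < ε / 3 by positivity)
  obtain ⟨n₀, hn₀⟩ := Metric.cauchySeq_iff.1 (h z hz) (ε / 3) (by positivity)
  refine ⟨n₀, fun m hm n hn => ?_⟩
  have h1 := hn₀ m hm n hn
  rw [dist_eq_norm] at h1 hxz ⊢
  calc ‖A m x - A n x‖ = ‖A m (x - z) + (A m z - A n z) - A n (x - z)‖ := by
        congr 1; simp only [map_sub]; abel
    _ ≤ ‖A m (x - z)‖ + ‖A m z - A n z‖ + ‖A n (x - z)‖ :=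
        (norm_sub_le _ _).trans (by gcongr; exact norm_add_le _ _)
    _ ≤ ‖x - z‖ + ‖A m z - A n z‖ + ‖x - z‖ := by gcongr <;> exact hA _ _
    _ < ε := by linarith

/-- A strongly continuous orthogonal group whose generator is the inverse of `K`. -/
structure OrthogonalGroup (K : X →L[ℝ] X) where
  U : ℝ → X →L[ℝ] X
  norm_map : ∀ t x, ‖U t x‖ = ‖x‖
  continuous_apply : ∀ x, Continuous fun t => U t x
  inner_left : ∀ t x y, ⟪U t x, y⟫_ℝ = ⟪x, U (-t) y⟫_ℝ
  comm : ∀ t x, U t (K x) = K (U t x)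
  apply_range : ∀ t x, U t (K x) = K x + ∫ s in 0..t, U s x

variable [CompleteSpace X]

theorem exp_add_of_commute_real {A B : X →L[ℝ] X} (h : Commute A B) :
    NormedSpace.exp (A + B) = NormedSpace.exp A * NormedSpace.exp B :=
  let := NormedAlgebra.restrictScalars ℚ ℝ (X →L[ℝ] X)
  NormedSpace.exp_add_of_commute h

theorem norm_exp_skewAdjoint {Z : X →L[ℝ] X} (hZ : Z ∈ skewAdjoint (X →L[ℝ] X)) (t : ℝ) (x : X) :
    ‖NormedSpace.exp (t • Z) x‖ = ‖x‖ := by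
  have h : star (NormedSpace.exp (t • Z)) * NormedSpace.exp (t • Z) = 1 := by
    have hc : Commute (-(t • Z)) (t • Z) := (Commute.refl (t • Z)).neg_left
    rw [NormedSpace.star_exp, star_smul, skewAdjoint.mem_iff.1 hZ, smul_neg, star_trivial,
      ← exp_add_of_commute_real hc, neg_add_cancel, NormedSpace.exp_zero]
  have h2 : ‖NormedSpace.exp (t • Z) x‖ ^ 2 = ‖x‖ ^ 2 := by
    rw [← real_inner_self_eq_norm_sq, ← ContinuousLinearMap.adjoint_inner_right,
      ← ContinuousLinearMap.star_eq_adjoint, ← mul_apply_eq_comp, h, one_apply_eq_self,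
      real_inner_self_eq_norm_sq]
  exact (sq_eq_sq₀ (norm_nonneg _) (norm_nonneg _)).1 h2

theorem continuous_exp_smul_apply (Z : X →L[ℝ] X) (x : X) :
    Continuous fun t : ℝ => NormedSpace.exp (t • Z) x :=
  ((differentiable_exp_smul_const ℝ Z).continuous).clm_apply continuous_const

theorem exp_smul_apply_eq (Z : X →L[ℝ] X) (t : ℝ) (x : X) :
    NormedSpace.exp (t • Z) x = x + ∫ s in 0..t, NormedSpace.exp (s • Z) (Z x) := by
  have hd : ∀ s : ℝ, HasDerivAt (fun s : ℝ => NormedSpace.exp (s • Z) x)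
      (NormedSpace.exp (s • Z) (Z x)) s := by
    intro s
    have := (hasDerivAt_exp_smul_const (𝕂 := ℝ) Z s).clm_apply (hasDerivAt_const s x)
    simpa using this
  rw [intervalIntegral.integral_eq_sub_of_hasDerivAt (fun s _ => hd s)
    ((continuous_exp_smul_apply Z (Z x)).intervalIntegrable _ _)]
  simp

theorem norm_exp_smul_sub_le {Z : X →L[ℝ] X} (hZ : Z ∈ skewAdjoint (X →L[ℝ] X)) (t : ℝ) (x : X) :
    ‖NormedSpace.exp (t • Z) x - x‖ ≤ ‖Z x‖ * |t| := by
  rw [exp_smul_apply_eq, add_sub_cancel_left]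
  simpa using intervalIntegral.norm_integral_le_of_norm_le_const (a := 0) (b := t)
    (fun s _ => (norm_exp_skewAdjoint hZ s (Z x)).le)

/-- The resolvent `(δ - K²)⁻¹` of a skew-adjoint operator. -/
theorem exists_resolvent_sq {K : X →L[ℝ] X} (hK : star K = -K) {δ : ℝ} (hδ : 0 < δ) :
    ∃ G : X →L[ℝ] X, (δ • 1 - K * K) * G = 1 ∧ G * (δ • 1 - K * K) = 1 ∧ star G = G ∧
      ∀ x, ‖δ • G x‖ ≤ ‖x‖ := by
  set D : X →L[ℝ] X := δ • 1 - K * K with hD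
  -- Since −K² = K*K, the operator is coercive with constant δ. This gives both its invertibility
  -- and the contraction bound for δG.
  have hin : ∀ x, ⟪D x, x⟫_ℝ = δ * ‖x‖ ^ 2 + ‖K x‖ ^ 2 := by
    intro x
    have : ⟪K (K x), x⟫_ℝ = -‖K x‖ ^ 2 := by
      rw [← ContinuousLinearMap.adjoint_inner_right, ← ContinuousLinearMap.star_eq_adjoint, hK]
      simp [inner_neg_right]
    simp [hD, inner_sub_left, inner_smul_left, this]
  have hle : ∀ x, δ * ‖x‖ ^ 2 ≤ ‖x‖ * ‖D x‖ := by
    intro x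
    have h1 := real_inner_le_norm (D x) x
    rw [hin] at h1
    nlinarith [sq_nonneg ‖K x‖]
  have hu : IsUnit D := by
    refine ContinuousLinearMap.isUnit_of_forall_le_norm_inner_map D (c := ⟨δ, hδ.le⟩) hδ fun x => ?_
    rw [hin, Real.norm_of_nonneg (by positivity)]
    change ‖x‖ ^ 2 * δ ≤ _
    nlinarith [sq_nonneg ‖K x‖]
  obtain ⟨u, hu⟩ := hu
  have h1 : D * ↑u⁻¹ = 1 := by rw [← hu]; exact u.mul_inv
  have h2 : ↑u⁻¹ * D = 1 := by rw [← hu]; exact u.inv_mul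
  have hDs : star D = D := by
    rw [hD, star_sub, star_mul, hK, star_smul]; simp
  refine ⟨↑u⁻¹, h1, h2, ?_, fun x => ?_⟩
  · have h3 : star (↑u⁻¹ : X →L[ℝ] X) * D = 1 := by
      have := congrArg star h1
      rwa [star_mul, hDs, star_one] at this
    calc star (↑u⁻¹ : X →L[ℝ] X) = star (↑u⁻¹ : X →L[ℝ] X) * (D * ↑u⁻¹) := by rw [h1, mul_one]
      _ = ↑u⁻¹ := by rw [← mul_assoc, h3, one_mul]
  · have h3 : D ((↑u⁻¹ : X →L[ℝ] X) x) = x := by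
      have := congrArg (fun f : X →L[ℝ] X => f x) h1
      simpa using this
    have h4 := hle ((↑u⁻¹ : X →L[ℝ] X) x)
    rw [h3] at h4
    rw [norm_smul, Real.norm_of_nonneg hδ.le]
    rcases (norm_nonneg ((↑u⁻¹ : X →L[ℝ] X) x)).eq_or_lt with h0 | h0
    · rw [← h0]; simp
    · have : ‖(↑u⁻¹ : X →L[ℝ] X) x‖ * (δ * ‖(↑u⁻¹ : X →L[ℝ] X) x‖) ≤
          ‖(↑u⁻¹ : X →L[ℝ] X) x‖ * ‖x‖ := by nlinarith
      exact le_of_mul_le_mul_left this h0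

/-- Bounded skew-adjoint approximations of the inverse of a skew-adjoint operator. -/
theorem exists_yosida {K : X →L[ℝ] X} (hK : star K = -K) (hd : DenseRange K) :
    ∃ W : ℕ → X →L[ℝ] X, (∀ n, W n ∈ skewAdjoint (X →L[ℝ] X)) ∧ (∀ n, Commute (W n) K) ∧
      (∀ m n, Commute (W m) (W n)) ∧
      (∀ x, Filter.Tendsto (fun n => W n (K x)) Filter.atTop (𝓝 x)) ∧
      ∀ n x, ‖W n (K x)‖ ≤ 2 * ‖x‖ := by
  have hδ : ∀ n : ℕ, (0 : ℝ) < 1 / ((n : ℝ) + 1) := fun n => by positivity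
  choose G h1 h2 h3 h4 using fun n => exists_resolvent_sq hK (hδ n)
  set δ : ℕ → ℝ := fun n => 1 / ((n : ℝ) + 1) with hδdef
  have hDinv : ∀ {D G A : X →L[ℝ] X}, D * G = 1 → G * D = 1 → Commute A D → Commute A G := by
    intro D G A e1 e2 hc
    calc A * G = (G * D) * A * G := by rw [e2, one_mul]
      _ = G * (D * A) * G := by simp only [mul_assoc]
      _ = G * (A * D) * G := by rw [hc.eq]
      _ = G * A * (D * G) := by simp only [mul_assoc]
      _ = G * A := by rw [e1, mul_one]
  have hKD : ∀ n, Commute K (δ n • 1 - K * K) := fun n =>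
    ((Commute.one_right K).smul_right _).sub_right ((Commute.refl K).mul_right (Commute.refl K))
  have hKG : ∀ n, Commute K (G n) := fun n => hDinv (h1 n) (h2 n) (hKD n)
  have hGG : ∀ m n, Commute (G m) (G n) := fun m n => hDinv (h1 n) (h2 n)
    (((Commute.one_right _).smul_right _).sub_right ((hKG m).symm.mul_right (hKG m).symm))
  have hE : ∀ n x, -(G n (K (K x))) = x - δ n • G n x := by
    intro n x
    have := congrArg (fun f : X →L[ℝ] X => f x) (h2 n)
    simp only [mul_apply_eq_comp, sub_apply,
      smul_apply, one_apply_eq_self, map_sub, map_smul] at this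
    rw [eq_sub_iff_add_eq, neg_add_eq_sub]
    exact this
  -- The approximants are −(δₙ − K²)⁻¹K with δₙ → 0, formally tending to K⁻¹. By `hE` they satisfy
  -- WₙKx = x − δₙGₙx, so convergence amounts to δₙGₙ → 0 strongly; this holds at rate δₙ on the
  -- dense range of K² and extends because the δₙGₙ are contractions.
  refine ⟨fun n => -(G n * K), fun n => ?_, fun n => ?_, fun m n => ?_, fun x => ?_, fun n x => ?_⟩
  · rw [skewAdjoint.mem_iff, star_neg, star_mul, hK, h3, neg_mul, (hKG n).eq]
  · exact ((hKG n).symm.mul_left (Commute.refl K)).neg_left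
  · refine Commute.neg_left (Commute.neg_right ?_)
    exact ((hGG m n).mul_right (hKG m).symm).mul_left ((hKG n).mul_right (Commute.refl K))
  · have hz := tendsto_zero_of_dense (A := fun n => δ n • G n) (fun n x => h4 n x)
      (s := range (K ∘ K)) (hd.comp hd K.continuous) (by
        rintro _ ⟨z, rfl⟩
        have hb : ∀ n, ‖(δ n • G n) ((K ∘ K) z)‖ ≤ δ n * (2 * ‖z‖) := by
          intro n
          have e : (δ n • G n) ((K ∘ K) z) = δ n • -(z - δ n • G n z) := by
            rw [← hE]; simp
          rw [e, norm_smul, Real.norm_of_nonneg (hδ n).le, norm_neg]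
          have := h4 n z
          have hle : ‖z - δ n • G n z‖ ≤ 2 * ‖z‖ := (norm_sub_le _ _).trans (by linarith)
          exact mul_le_mul_of_nonneg_left hle (hδ n).le
        refine squeeze_zero_norm hb ?_
        simpa [hδdef] using (tendsto_one_div_add_atTop_nhds_zero_nat (𝕜 := ℝ)).mul_const (2 * ‖z‖)) x
    have : Filter.Tendsto (fun n => x - (δ n • G n) x) Filter.atTop (𝓝 (x - 0)) :=
      tendsto_const_nhds.sub hz
    rw [sub_zero] at this
    refine this.congr fun n => ?_
    have := hE n x
    simpa using this.symm
  · have e := hE n x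
    have : (-(G n * K)) (K x) = x - δ n • G n x := by rw [← e]; simp
    rw [this]
    exact (norm_sub_le _ _).trans (by linarith [h4 n x])

/-- Hille–Yosida for the unbounded operator K⁻¹: the orthogonal exponentials exp(tWₙ) of the bounded
approximants converge strongly, first on the range of K and then everywhere by isometry. Each
property of the group is a limit of the same property of the exponentials. -/
theorem exists_orthogonalGroup {K : X →L[ℝ] X} (hK : ∀ x y, ⟪K x, y⟫_ℝ = -⟪x, K y⟫_ℝ)
    (hd : DenseRange K) : Nonempty (OrthogonalGroup K) := by
  have hKs : star K = -K := by
    refine ContinuousLinearMap.ext fun x => ext_inner_right ℝ fun y => ?_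
    rw [ContinuousLinearMap.star_eq_adjoint, ContinuousLinearMap.adjoint_inner_left]
    simp [hK]
  obtain ⟨W, hW, hWK, hWW, hlim, hbd⟩ := exists_yosida hKs hd
  set V : ℕ → ℝ → X →L[ℝ] X := fun n t => NormedSpace.exp (t • W n) with hV
  have hVn : ∀ n t x, ‖V n t x‖ = ‖x‖ := fun n t x => norm_exp_skewAdjoint (hW n) t x
  have hVK : ∀ n t x, V n t (K x) = K (V n t x) := fun n t x => by
    have : Commute (V n t) K := ((hWK n).smul_left t).exp_left
    exact congrArg (fun f : X →L[ℝ] X => f x) this.eq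
  have hcau : ∀ t x, CauchySeq fun n => V n t x := by
    intro t
    refine cauchySeq_of_dense (A := fun n => V n t) (fun n x => (hVn n t x).le) hd ?_
    rintro _ ⟨x, rfl⟩
    -- Because the approximants commute, exp(tWₘ) = exp(tWₙ) exp(t(Wₘ − Wₙ)); the first factor is an
    -- isometry, and the second is estimated by its generator.
    have hest : ∀ m n, ‖V m t (K x) - V n t (K x)‖ ≤ ‖W m (K x) - W n (K x)‖ * |t| := by
      intro m n
      have e : V m t = V n t * NormedSpace.exp (t • (W m - W n)) := by
        simp only [hV]
        rw [← exp_add_of_commute_real, ← smul_add, add_sub_cancel]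
        exact (((hWW n m).sub_right (Commute.refl _)).smul_left t).smul_right t
      rw [e]
      simp only [mul_apply_eq_comp]
      rw [← map_sub, hVn]
      exact norm_exp_smul_sub_le (sub_mem (hW m) (hW n)) t (K x)
    have hc := (hlim x).cauchySeq
    rw [Metric.cauchySeq_iff] at hc ⊢
    intro ε hε
    obtain ⟨n₀, hn₀⟩ := hc (ε / (|t| + 1)) (by positivity)
    refine ⟨n₀, fun m hm n hn => ?_⟩
    have := hn₀ m hm n hn
    rw [dist_eq_norm, lt_div_iff₀ (by positivity)] at this
    rw [dist_eq_norm]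
    refine (hest m n).trans_lt (lt_of_le_of_lt ?_ this)
    gcongr; linarith
  choose u hu using fun t x => cauchySeq_tendsto_of_complete (hcau t x)
  let U : ℝ → X →L[ℝ] X := fun t => LinearMap.mkContinuous
    { toFun := u t
      map_add' := fun x y => tendsto_nhds_unique (hu t (x + y)) (by
        simpa only [map_add] using (hu t x).add (hu t y))
      map_smul' := fun c x => tendsto_nhds_unique (hu t (c • x)) (by
        simpa only [map_smul, RingHom.id_apply] using (hu t x).const_smul c) } 1 (fun x => by
        rw [one_mul]
        exact le_of_tendsto (hu t x).norm (Filter.Eventually.of_forall fun n => (hVn n t x).le))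
  have hU : ∀ t x, Filter.Tendsto (fun n => V n t x) Filter.atTop (𝓝 (U t x)) := hu
  have hUn : ∀ t x, ‖U t x‖ = ‖x‖ := fun t x =>
    tendsto_nhds_unique (hU t x).norm (by simp only [hVn]; exact tendsto_const_nhds)
  have hUK : ∀ t x, U t (K x) = K (U t x) := fun t x =>
    tendsto_nhds_unique (hU t (K x)) (by
      simp only [hVK]; exact (K.continuous.tendsto _).comp (hU t x))
  have hlip : ∀ s t x, ‖U t (K x) - U s (K x)‖ ≤ ‖x‖ * |t - s| := by
    intro s t x
    refine le_of_tendsto_of_tendsto ((hU t (K x)).sub (hU s (K x))).norm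
      ((hlim x).norm.mul_const |t - s|) (Filter.Eventually.of_forall fun n => ?_)
    have e : V n t = V n s * NormedSpace.exp ((t - s) • W n) := by
      simp only [hV]
      rw [← exp_add_of_commute_real, ← add_smul, add_sub_cancel]
      exact ((Commute.refl (W n)).smul_left _).smul_right _
    simp only [e, mul_apply_eq_comp]
    rw [← map_sub, hVn]
    exact norm_exp_smul_sub_le (hW n) _ (K x)
  have hUc : ∀ x, Continuous fun t => U t x := by
    intro x
    rw [Metric.continuous_iff]
    intro s ε hε
    obtain ⟨z, hz⟩ := hd.exists_dist_lt x (show 0 < ε / 3 by positivity)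
    refine ⟨ε / 3 / (‖z‖ + 1), by positivity, fun t ht => ?_⟩
    rw [Real.dist_eq, lt_div_iff₀ (by positivity)] at ht
    rw [dist_eq_norm] at hz ⊢
    calc ‖U t x - U s x‖ = ‖U t (x - K z) + (U t (K z) - U s (K z)) - U s (x - K z)‖ := by
          congr 1; simp only [map_sub]; abel
      _ ≤ ‖x - K z‖ + ‖z‖ * |t - s| + ‖x - K z‖ := by
          refine (norm_sub_le _ _).trans ?_
          rw [hUn]
          gcongr
          refine (norm_add_le _ _).trans ?_
          rw [hUn]
          gcongr
          exact hlip s t z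
      _ < ε := by nlinarith [abs_nonneg (t - s)]
  have hUi : ∀ t x y, ⟪U t x, y⟫_ℝ = ⟪x, U (-t) y⟫_ℝ := by
    intro t x y
    refine tendsto_nhds_unique ((hU t x).inner tendsto_const_nhds) ?_
    have : ∀ n, ⟪V n t x, y⟫_ℝ = ⟪x, V n (-t) y⟫_ℝ := by
      intro n
      have e : star (V n t) = V n (-t) := by
        simp only [hV]
        rw [NormedSpace.star_exp, star_smul, skewAdjoint.mem_iff.1 (hW n)]
        simp
      rw [← e, ContinuousLinearMap.star_eq_adjoint, ContinuousLinearMap.adjoint_inner_right]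
    simp only [this]
    exact tendsto_const_nhds.inner (hU (-t) y)
  refine ⟨⟨U, hUn, hUc, hUi, hUK, fun t x => ?_⟩⟩
  refine tendsto_nhds_unique (hU t (K x)) ?_
  have e : ∀ n, V n t (K x) = K x + ∫ s in 0..t, V n s (W n (K x)) := fun n =>
    exp_smul_apply_eq (W n) t (K x)
  simp only [e]
  refine tendsto_const_nhds.add ?_
  refine intervalIntegral.tendsto_integral_filter_of_dominated_convergence (fun _ => 2 * ‖x‖)
    (Filter.Eventually.of_forall fun n =>
      (continuous_exp_smul_apply (W n) _).aestronglyMeasurable)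
    (Filter.Eventually.of_forall fun n => Filter.Eventually.of_forall fun s _ => ?_)
    intervalIntegrable_const (Filter.Eventually.of_forall fun s _ => ?_)
  · rw [hVn]; exact hbd n x
  -- The operator and its argument both vary with n; isometry removes the operator from the norm of
  -- the first summand.
  · have h1 : Filter.Tendsto (fun n => V n s (W n (K x) - x) + V n s x) Filter.atTop
        (𝓝 (0 + U s x)) := by
      refine Filter.Tendsto.add ?_ (hU s x)
      rw [tendsto_zero_iff_norm_tendsto_zero]
      simp only [hVn]
      rw [← tendsto_zero_iff_norm_tendsto_zero]
      simpa using (hlim x).sub_const x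
    rw [zero_add] at h1
    refine h1.congr fun n => ?_
    rw [← map_add, sub_add_cancel]

end Group

/-! ### Weak and mild solutions, and the pairing of two weak solutions -/

namespace OrthogonalGroup

variable {X : Type*} [NormedAddCommGroup X] [InnerProductSpace ℝ X] {K : X →L[ℝ] X}
  (S : OrthogonalGroup K)

theorem inner_map_map (t : ℝ) (x y : X) : ⟪S.U t x, S.U t y⟫_ℝ = ⟪x, y⟫_ℝ :=
  LinearIsometry.inner_map_map ⟨(S.U t).toLinearMap, S.norm_map t⟩ x y

theorem neg_apply (t : ℝ) (x : X) : S.U (-t) (S.U t x) = x :=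
  ext_inner_left ℝ fun y => by rw [← S.inner_left, S.inner_map_map]

theorem zero_apply (hd : DenseRange K) (x : X) : S.U 0 x = x := by
  have : (fun x => S.U 0 x) = fun x => x := by
    refine DenseRange.equalizer hd (S.U 0).continuous continuous_id ?_
    ext x
    simp [S.apply_range]
  exact congrFun this x

theorem apply_range_neg (t : ℝ) (x : X) :
    S.U (-t) (K x) = K x + ∫ s in 0..t, -S.U (-s) x := by
  rw [S.apply_range, intervalIntegral.integral_neg,
    intervalIntegral.integral_comp_neg (fun s => S.U s x), neg_zero,
    intervalIntegral.integral_symm (-t) 0]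

/-- Strong continuity plus isometry gives joint continuity, which is what moving curves such as
U(−t)Y(t) require. -/
theorem continuous_uncurry : Continuous fun z : ℝ × X => S.U z.1 z.2 := by
  rw [continuous_iff_continuousAt]
  rintro ⟨t, x⟩
  have h1 : Filter.Tendsto (fun z : ℝ × X => S.U z.1 (z.2 - x)) (𝓝 (t, x)) (𝓝 0) := by
    rw [tendsto_zero_iff_norm_tendsto_zero]
    simp only [S.norm_map]
    rw [← tendsto_zero_iff_norm_tendsto_zero]
    have : Continuous fun z : ℝ × X => z.2 - x := by fun_prop
    simpa using this.tendsto (t, x)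
  have h2 : Filter.Tendsto (fun z : ℝ × X => S.U z.1 x) (𝓝 (t, x)) (𝓝 (S.U t x)) :=
    ((S.continuous_apply x).comp continuous_fst).tendsto (t, x)
  have h3 := h1.add h2
  rw [zero_add] at h3
  refine h3.congr fun z => ?_
  rw [← map_add, sub_add_cancel]

theorem continuousOn_neg_apply {s : Set ℝ} {f : ℝ → X} (hf : ContinuousOn f s) :
    ContinuousOn (fun t => S.U (-t) (f t)) s :=
  S.continuous_uncurry.comp_continuousOn (continuousOn_id.neg.prodMk hf)

theorem intervalIntegrable_neg_apply {a b : ℝ} {G : ℝ → X}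
    (hG : IntervalIntegrable G volume a b) :
    IntervalIntegrable (fun s => S.U (-s) (G s)) volume a b := by
  have h : ∀ {μ : Measure ℝ}, Integrable G μ → Integrable (fun s => S.U (-s) (G s)) μ := by
    intro μ h
    refine h.norm.mono' ?_ (Filter.Eventually.of_forall fun s => (S.norm_map _ _).le)
    exact S.continuous_uncurry.comp_aestronglyMeasurable
      ((continuous_neg.aestronglyMeasurable (μ := μ)).prodMk h.1)
  exact ⟨h hG.1, h hG.2⟩

variable [CompleteSpace X]

/-- A weak solution need not be differentiable, but applying K regularises it: KY is absolutely
continuous with derivative Y + KG. Pairing KY with the orbit U(s)Kx, also absolutely continuous,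
gives Duhamel's formula tested against K²x, and such vectors are dense. -/
theorem mild_of_weak (hK : ∀ x y, ⟪K x, y⟫_ℝ = -⟪x, K y⟫_ℝ) (hd : DenseRange K) {T : ℝ}
    {Y G : ℝ → X} (hY : ContinuousOn Y (Icc 0 T)) (hG : IntervalIntegrable G volume 0 T)
    (hw : ∀ x, ∀ t ∈ Icc 0 T,
      ⟪Y t, K x⟫_ℝ = ⟪Y 0, K x⟫_ℝ + ∫ s in 0..t, (⟪G s, K x⟫_ℝ - ⟪Y s, x⟫_ℝ))
    {t : ℝ} (ht : t ∈ Icc 0 T) :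
    S.U (-t) (Y t) = Y 0 + ∫ s in 0..t, S.U (-s) (G s) := by
  have hsub : ∀ t ∈ Icc 0 T, Icc 0 t ⊆ Icc 0 T := fun t ht => Icc_subset_Icc_right ht.2
  have hGt : ∀ t ∈ Icc 0 T, IntervalIntegrable G volume 0 t := fun t ht =>
    hG.mono_set (by rw [uIcc_of_le ht.1, uIcc_of_le (ht.1.trans ht.2)]; exact hsub t ht)
  have hYt : ∀ t ∈ Icc 0 T, IntervalIntegrable Y volume 0 t := fun t ht =>
    ContinuousOn.intervalIntegrable (by rw [uIcc_of_le ht.1]; exact hY.mono (hsub t ht))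
  have hKGt : ∀ t ∈ Icc 0 T, IntervalIntegrable (fun s => K (G s)) volume 0 t := fun t ht =>
    ⟨K.integrable_comp (hGt t ht).1, K.integrable_comp (hGt t ht).2⟩
  have hKY : ∀ t ∈ Icc 0 T, K (Y t) = K (Y 0) + ∫ s in 0..t, (Y s + K (G s)) := by
    intro t ht
    refine ext_inner_right ℝ fun x => ?_
    have h := hw x t ht
    rw [inner_add_left, ← intervalIntegral_inner_left ((hYt t ht).add (hKGt t ht)), hK, hK, h,
      neg_add, ← intervalIntegral.integral_neg]
    congr 2
    ext s
    rw [inner_add_left, hK]; ring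
  refine eq_of_sub_eq_zero (ext_inner_right ℝ fun y => ?_)
  rw [inner_zero_left]
  refine congrFun (DenseRange.equalizer (f := K ∘ K) (hd.comp hd K.continuous)
    (g := fun y => ⟪S.U (-t) (Y t) - (Y 0 + ∫ s in 0..t, S.U (-s) (G s)), y⟫_ℝ) (h := fun _ => 0)
    (by fun_prop) continuous_const ?_) y
  funext x
  have hU : ∀ r ∈ Icc 0 t, S.U r (K x) = S.U 0 (K x) + ∫ s in 0..r, S.U s x := by
    intro r _
    rw [S.zero_apply hd, S.apply_range]
  have key := inner_eq_add_integral ht.1 (a := fun r => K (Y r)) ((hYt t ht).add (hKGt t ht))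
    ((S.continuous_apply x).intervalIntegrable 0 t) (fun r hr => hKY r (hsub t ht hr)) hU
  rw [S.zero_apply hd] at key
  -- The two terms containing Y cancel by skewness of K and its commutation with the group; only the
  -- forcing survives.
  have e : ∀ s, ⟪Y s + K (G s), S.U s (K x)⟫_ℝ + ⟪K (Y s), S.U s x⟫_ℝ =
      -⟪S.U (-s) (G s), K (K x)⟫_ℝ := by
    intro s
    rw [S.inner_left, neg_neg, inner_add_left, hK (Y s), ← S.comm, hK (G s), ← S.comm]; ring
  simp only [e] at key
  rw [intervalIntegral.integral_neg, intervalIntegral_inner_left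
    (S.intervalIntegrable_neg_apply (hGt t ht)), hK, hK, ← S.comm] at key
  simp only [Function.comp_apply, inner_sub_left, inner_add_left]
  rw [S.inner_left, neg_neg]
  linarith

/-- By isometry ⟪Y(r), Kx⟫ = ⟪U(−r)Y(r), U(−r)Kx⟫, a product of two absolutely continuous curves. -/
theorem weak_of_mild {T : ℝ}
    {Y G : ℝ → X} (hG : IntervalIntegrable G volume 0 T)
    (hm : ∀ t ∈ Icc 0 T, S.U (-t) (Y t) = Y 0 + ∫ s in 0..t, S.U (-s) (G s))
    (hd : DenseRange K) (x : X) {t : ℝ} (ht : t ∈ Icc 0 T) :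
    ⟪Y t, K x⟫_ℝ = ⟪Y 0, K x⟫_ℝ + ∫ s in 0..t, (⟪G s, K x⟫_ℝ - ⟪Y s, x⟫_ℝ) := by
  have hGt : IntervalIntegrable G volume 0 t :=
    hG.mono_set (by
      rw [uIcc_of_le ht.1, uIcc_of_le (ht.1.trans ht.2)]; exact Icc_subset_Icc_right ht.2)
  have hU : ∀ r ∈ Icc 0 t, S.U (-r) (K x) = S.U (-0) (K x) + ∫ s in 0..r, -S.U (-s) x := by
    intro r _
    rw [neg_zero, S.zero_apply hd, S.apply_range_neg]
  have key := inner_eq_add_integral ht.1 (a := fun r => S.U (-r) (Y r))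
    (b := fun r => S.U (-r) (K x)) (S.intervalIntegrable_neg_apply hGt)
    (β := fun s => -S.U (-s) x)
    (((S.continuous_apply x).comp continuous_neg).neg.intervalIntegrable 0 t)
    (fun r hr => by
      rw [hm r ⟨hr.1, hr.2.trans ht.2⟩, neg_zero, S.zero_apply hd]) hU
  simp only [S.inner_map_map, inner_neg_right] at key
  rw [key]
  simp only [sub_eq_add_neg]

/-- The pairing of two mild solutions of a skew-adjoint evolution equation. -/
theorem inner_eq_of_weak (hK : ∀ x y, ⟪K x, y⟫_ℝ = -⟪x, K y⟫_ℝ) (hd : DenseRange K) {T : ℝ}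
    (hT : 0 ≤ T) {Y G Q F : ℝ → X} (hY : ContinuousOn Y (Icc 0 T))
    (hG : IntervalIntegrable G volume 0 T)
    (hYw : ∀ x, ∀ t ∈ Icc 0 T,
      ⟪Y t, K x⟫_ℝ = ⟪Y 0, K x⟫_ℝ + ∫ s in 0..t, (⟪G s, K x⟫_ℝ - ⟪Y s, x⟫_ℝ))
    (hQ : ContinuousOn Q (Icc 0 T)) (hF : IntervalIntegrable F volume 0 T)
    (hQw : ∀ x, ∀ t ∈ Icc 0 T,
      ⟪Q t, K x⟫_ℝ = ⟪Q 0, K x⟫_ℝ + ∫ s in 0..t, (⟪F s, K x⟫_ℝ - ⟪Q s, x⟫_ℝ)) :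
    ⟪Y T, Q T⟫_ℝ = ⟪Y 0, Q 0⟫_ℝ + ∫ s in 0..T, (⟪G s, Q s⟫_ℝ + ⟪Y s, F s⟫_ℝ) := by
  obtain ⟨S⟩ := exists_orthogonalGroup hK hd
  have key := inner_eq_add_integral hT (a := fun r => S.U (-r) (Y r))
    (b := fun r => S.U (-r) (Q r)) (S.intervalIntegrable_neg_apply hG)
    (S.intervalIntegrable_neg_apply hF)
    (fun r hr => by rw [S.mild_of_weak hK hd hY hG hYw hr, neg_zero, S.zero_apply hd])
    (fun r hr => by rw [S.mild_of_weak hK hd hQ hF hQw hr, neg_zero, S.zero_apply hd])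
  simpa only [S.inner_map_map] using key

end OrthogonalGroup

/-! ### Volterra equations in spaces of continuous curves -/

section Volterra

/-- Clamping both variables to [0, T] extends the integrand continuously to the plane without
changing the integrals concerned, so continuity of parametric integrals applies. -/
theorem continuousOn_integral_kernel {E : Type*} [NormedAddCommGroup E] [NormedSpace ℝ E] {T : ℝ}
    (hT : 0 ≤ T) {N : ℝ → ℝ → ℝ} (hN : ContinuousOn (Function.uncurry N) (Icc 0 T ×ˢ Icc 0 T))
    {g : ℝ → E} (hg : ContinuousOn g (Icc 0 T)) {a : ℝ} (ha : a ∈ Icc 0 T) :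
    ContinuousOn (fun s => ∫ r in a..s, N s r • g r) (Icc 0 T) := by
  set c : ℝ → ℝ := fun t => (projIcc 0 T hT t : ℝ) with hc
  have hcc : Continuous c := continuous_subtype_val.comp continuous_projIcc
  have hcm : ∀ t, c t ∈ Icc 0 T := fun t => (projIcc 0 T hT t).2
  have hce : ∀ t ∈ Icc 0 T, c t = t := fun t ht => by simp [hc, projIcc_of_mem hT ht]
  have h1 : Continuous (Function.uncurry fun s r => N (c s) (c r) • g (c r)) := by
    refine Continuous.smul ?_ ?_
    · exact hN.comp_continuous (f := fun z : ℝ × ℝ => (c z.1, c z.2)) (by fun_prop)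
        fun z => ⟨hcm _, hcm _⟩
    · exact hg.comp_continuous (f := fun z : ℝ × ℝ => c z.2) (by fun_prop) fun z => hcm _
  have h2 := intervalIntegral.continuous_parametric_intervalIntegral_of_continuous (μ := volume)
    (a₀ := a) h1 continuous_id
  refine h2.continuousOn.congr fun s hs => intervalIntegral.integral_congr fun r hr => ?_
  have hr' : r ∈ Icc 0 T := (uIcc_subset_Icc ha hs) hr
  simp only [hce s hs, hce r hr']

theorem continuousOn_integral_kernel_right {E : Type*} [NormedAddCommGroup E]
    [NormedSpace ℝ E] {T : ℝ} (hT : 0 ≤ T) {M : ℝ → ℝ → ℝ}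
    (hM : ContinuousOn (Function.uncurry M) (Icc 0 T ×ˢ Icc 0 T)) {p : ℝ → E}
    (hp : ContinuousOn p (Icc 0 T)) :
    ContinuousOn (fun s => ∫ r in s..T, M r s • p r) (Icc 0 T) := by
  have h : ContinuousOn (Function.uncurry fun s r => M r s) (Icc 0 T ×ˢ Icc 0 T) :=
    hM.comp (f := fun z : ℝ × ℝ => (z.2, z.1)) (by fun_prop) fun z hz => ⟨hz.2, hz.1⟩
  refine (continuousOn_integral_kernel hT h hp ⟨hT, le_rfl⟩).neg.congr fun s _ => ?_
  rw [Pi.neg_apply, intervalIntegral.integral_symm]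

/-- 1 − kⁿ is invertible by the Neumann series and factors as 1 − k times a commuting geometric sum,
so 1 − k is invertible too. -/
theorem exists_eq_add_of_norm_pow_lt_one {Z : Type*} [NormedAddCommGroup Z] [NormedSpace ℝ Z]
    [CompleteSpace Z] {k : Z →L[ℝ] Z} {n : ℕ} (hlt : ‖k ^ n‖ < 1) (F : Z) : ∃ Y, Y = F + k Y := by
  have hu : IsUnit (1 - k ^ n) := isUnit_one_sub_of_norm_lt_one hlt
  rw [← mul_neg_geom_sum] at hu
  have hcomm : Commute (1 - k) (∑ i ∈ Finset.range n, k ^ i) := by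
    refine Commute.sum_right _ _ _ fun i _ => ?_
    exact ((Commute.one_left _).sub_left ((Commute.refl k).pow_right i))
  obtain ⟨u, hu⟩ := (hcomm.isUnit_mul_iff.1 hu).1
  refine ⟨(↑u⁻¹ : Z →L[ℝ] Z) F, ?_⟩
  have h1 : (1 - k) * ↑u⁻¹ = 1 := by rw [← hu]; exact u.mul_inv
  have h2 := congrArg (fun f : Z →L[ℝ] Z => f F) h1
  simp only [mul_apply_eq_comp, one_apply_eq_self] at h2
  rw [sub_apply, one_apply_eq_self, sub_eq_iff_eq_add] at h2
  exact h2

/-- The growth hypothesis iterates to ‖(kⁿY)(t)‖ ≤ Cⁿtⁿ‖Y‖/n!, so some power of k is a contraction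
whatever the length of the interval. -/
theorem exists_eq_add_of_volterra {E : Type*} [NormedAddCommGroup E] [NormedSpace ℝ E]
    [CompleteSpace E] {T : ℝ} (k : C(Icc 0 T, E) →L[ℝ] C(Icc 0 T, E)) {C : ℝ} (hC : 0 ≤ C)
    (hk : ∀ (Y : C(Icc 0 T, E)) (n : ℕ) (c : ℝ), 0 ≤ c → (∀ s, ‖Y s‖ ≤ c * (s : ℝ) ^ n) →
      ∀ t, ‖k Y t‖ ≤ C * c * ((t : ℝ) ^ (n + 1) / (n + 1))) (F : C(Icc 0 T, E)) :
    ∃ Y : C(Icc 0 T, E), Y = F + k Y := by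
  have hpow : ∀ (n : ℕ) (Y : C(Icc 0 T, E)) (t : Icc 0 T),
      ‖(k ^ n) Y t‖ ≤ C ^ n * ‖Y‖ / n.factorial * (t : ℝ) ^ n := by
    intro n Y
    induction n with
    | zero => intro t; simpa using Y.norm_coe_le_norm t
    | succ n ih =>
      intro t
      rw [pow_succ', mul_apply_eq_comp]
      refine (hk _ n _ (by positivity) ih t).trans (le_of_eq ?_)
      rw [Nat.factorial_succ]
      push_cast
      field_simp
      ring
  have hnorm : ∀ n : ℕ, ‖k ^ n‖ ≤ (C * T) ^ n / n.factorial ∨ T < 0 := by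
    intro n
    rcases lt_or_ge T 0 with h | hT
    · exact Or.inr h
    left
    refine ContinuousLinearMap.opNorm_le_bound _ (by positivity) fun Y => ?_
    rw [ContinuousMap.norm_le _ (by positivity)]
    intro t
    refine (hpow n Y t).trans ?_
    have : (t : ℝ) ^ n ≤ T ^ n := pow_le_pow_left₀ t.2.1 t.2.2 n
    calc C ^ n * ‖Y‖ / n.factorial * (t : ℝ) ^ n ≤ C ^ n * ‖Y‖ / n.factorial * T ^ n := by gcongr
      _ = (C * T) ^ n / n.factorial * ‖Y‖ := by rw [mul_pow]; ring
  rcases lt_or_ge T 0 with h | hT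
  · refine ⟨0, ?_⟩
    ext t
    exact absurd (t.2.1.trans t.2.2) (not_le.2 h)
  have hlim := FloorSemiring.tendsto_pow_div_factorial_atTop (C * T)
  obtain ⟨n, hn⟩ := (hlim.eventually (gt_mem_nhds one_pos)).exists
  have hlt : ‖k ^ n‖ < 1 := ((hnorm n).resolve_right (not_lt.2 hT)).trans_lt hn
  exact exists_eq_add_of_norm_pow_lt_one hlt F

end Volterra

/-! ### Solvability of skew-adjoint evolution equations with memory -/

section Evolution

variable {X : Type*} [NormedAddCommGroup X] [InnerProductSpace ℝ X] [CompleteSpace X]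
  {K : X →L[ℝ] X}

/-- Mild solutions of a skew-adjoint evolution equation with a memory term. -/
theorem OrthogonalGroup.exists_mild (S : OrthogonalGroup K) (hd : DenseRange K) {T : ℝ}
    (hT : 0 ≤ T) (L : X →L[ℝ] X) {N : ℝ → ℝ → ℝ}
    (hN : ContinuousOn (Function.uncurry N) (Icc 0 T ×ˢ Icc 0 T)) (Y₀ : X) {g : ℝ → X}
    (hg : IntervalIntegrable g volume 0 T) :
    ∃ Y : ℝ → X, ContinuousOn Y (Icc 0 T) ∧ Y 0 = Y₀ ∧ ∀ t ∈ Icc 0 T, S.U (-t) (Y t) =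
      Y 0 + ∫ s in 0..t, S.U (-s) (g s + (L (Y s) - ∫ r in 0..s, N s r • L (Y r))) := by
  obtain ⟨m, hm⟩ := (isCompact_Icc.prod isCompact_Icc).exists_bound_of_continuousOn hN
  have hm0 : 0 ≤ m := (norm_nonneg _).trans (hm (0, 0) ⟨⟨le_rfl, hT⟩, ⟨le_rfl, hT⟩⟩)
  set B : C(Icc 0 T, X) → ℝ → X := fun Y s => L (IccExtend hT Y s) -
    ∫ r in 0..s, N s r • L (IccExtend hT Y r) with hB
  have hYL : ∀ Y : C(Icc 0 T, X), Continuous fun s => L (IccExtend hT Y s) := fun Y =>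
    L.continuous.comp (Y.continuous.Icc_extend')
  have hBc : ∀ Y, ContinuousOn (B Y) (Icc 0 T) := fun Y =>
    (hYL Y).continuousOn.sub
      (continuousOn_integral_kernel hT hN (hYL Y).continuousOn ⟨le_rfl, hT⟩)
  have hBi : ∀ Y, ∀ t ∈ Icc 0 T, IntervalIntegrable (fun s => S.U (-s) (B Y s)) volume 0 t :=
    fun Y t ht => ContinuousOn.intervalIntegrable (by
      rw [uIcc_of_le ht.1]
      exact S.continuousOn_neg_apply ((hBc Y).mono (Icc_subset_Icc_right ht.2)))
  have hint : ∀ (Y : C(Icc 0 T, X)), ∀ s ∈ Icc 0 T,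
      IntervalIntegrable (fun r => N s r • L (IccExtend hT Y r)) volume 0 s := by
    intro Y s hs
    refine ContinuousOn.intervalIntegrable ?_
    rw [uIcc_of_le hs.1]
    refine ContinuousOn.smul ?_ (hYL Y).continuousOn
    exact hN.comp (f := fun r => (s, r)) (by fun_prop)
      fun r hr => ⟨hs, hr.1, hr.2.trans hs.2⟩
  have hprim : ∀ {f : ℝ → X}, IntervalIntegrable f volume 0 T →
      ContinuousOn (fun t => ∫ s in 0..t, f s) (Icc 0 T) := by
    intro f hf
    have := intervalIntegral.continuousOn_primitive_interval
      (μ := volume) (f := f) (a := 0) (b := T) (by rwa [intervalIntegrable_iff'] at hf)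
    rwa [uIcc_of_le hT] at this
  have hTm : T ∈ Icc 0 T := ⟨hT, le_rfl⟩
  have hUc : ∀ {f : ℝ → X}, ContinuousOn f (Icc 0 T) →
      Continuous fun t : Icc 0 T => S.U t (f t) := by
    intro f hf
    exact S.continuous_uncurry.comp
      (continuous_subtype_val.prodMk (continuousOn_iff_continuous_domRestrict.1 hf))
  -- The Duhamel integral of the state-dependent part of the forcing. The mild equation reads Y = F
  -- + k₀Y, with the initial datum and the merely integrable g absorbed into F.
  let k₀ : C(Icc 0 T, X) →ₗ[ℝ] C(Icc 0 T, X) :=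
    { toFun := fun Y => ⟨fun t => S.U t (∫ s in 0..(t : ℝ), S.U (-s) (B Y s)),
        hUc (hprim (hBi Y T hTm))⟩
      map_add' := fun Y Z => by
        ext t
        simp only [ContinuousMap.coe_mk, ContinuousMap.add_apply]
        rw [← map_add, ← intervalIntegral.integral_add (hBi Y t t.2) (hBi Z t t.2)]
        congr 1
        refine intervalIntegral.integral_congr fun s hs => ?_
        rw [uIcc_of_le t.2.1] at hs
        have hs' : s ∈ Icc 0 T := ⟨hs.1, hs.2.trans t.2.2⟩
        rw [← map_add]
        congr 1
        simp only [hB]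
        rw [sub_add_sub_comm, ← intervalIntegral.integral_add (hint Y s hs') (hint Z s hs')]
        simp only [IccExtend, Function.comp_apply, ContinuousMap.add_apply, map_add, smul_add]
      map_smul' := fun a Y => by
        ext t
        simp only [ContinuousMap.coe_mk, ContinuousMap.smul_apply, RingHom.id_apply]
        rw [← map_smul, ← intervalIntegral.integral_smul]
        congr 1
        refine intervalIntegral.integral_congr fun s _ => ?_
        rw [← map_smul]
        congr 1
        simp only [hB]
        rw [smul_sub, ← intervalIntegral.integral_smul]
        simp only [IccExtend, Function.comp_apply, ContinuousMap.smul_apply, map_smul,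
          smul_comm a] }
  -- The 1 accounts for the instantaneous term LY(s), and T·m for the memory integral, with |N| ≤ m
  -- over an interval of length at most T.
  set C : ℝ := ‖L‖ * (1 + T * m) with hC
  have hC0 : 0 ≤ C := by positivity
  have hk : ∀ (Y : C(Icc 0 T, X)) (n : ℕ) (c : ℝ), 0 ≤ c → (∀ s, ‖Y s‖ ≤ c * (s : ℝ) ^ n) →
      ∀ t, ‖k₀ Y t‖ ≤ C * c * ((t : ℝ) ^ (n + 1) / (n + 1)) := by
    intro Y n c hc hY t
    have hYe : ∀ s ∈ Icc 0 T, ‖IccExtend hT Y s‖ ≤ c * s ^ n := by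
      intro s hs
      rw [IccExtend_of_mem hT Y hs]
      exact hY ⟨s, hs⟩
    have hBn : ∀ s ∈ Icc 0 T, ‖B Y s‖ ≤ C * c * s ^ n := by
      intro s hs
      have h1 : ‖L (IccExtend hT Y s)‖ ≤ ‖L‖ * (c * s ^ n) :=
        (L.le_opNorm _).trans (by gcongr; exact hYe s hs)
      have h2 : ‖∫ r in 0..s, N s r • L (IccExtend hT Y r)‖ ≤
          m * (‖L‖ * (c * s ^ n)) * |s - 0| := by
        refine intervalIntegral.norm_integral_le_of_norm_le_const fun r hr => ?_
        rw [uIoc_of_le hs.1] at hr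
        have hr' : r ∈ Icc 0 T := ⟨hr.1.le, hr.2.trans hs.2⟩
        rw [norm_smul]
        have h3 : ‖L (IccExtend hT Y r)‖ ≤ ‖L‖ * (c * s ^ n) := by
          refine (L.le_opNorm _).trans ?_
          gcongr
          refine (hYe r hr').trans ?_
          have := pow_le_pow_left₀ hr.1.le hr.2 n
          gcongr
        exact mul_le_mul (hm (s, r) ⟨hs, hr'⟩) h3 (norm_nonneg _) hm0
      rw [sub_zero, abs_of_nonneg hs.1] at h2
      have h4 : m * (‖L‖ * (c * s ^ n)) * s ≤ m * (‖L‖ * (c * s ^ n)) * T := by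
        have := hs.1
        gcongr
        exact hs.2
      calc ‖B Y s‖ ≤ ‖L‖ * (c * s ^ n) + m * (‖L‖ * (c * s ^ n)) * T :=
            (norm_sub_le _ _).trans (add_le_add h1 (h2.trans h4))
        _ = C * c * s ^ n := by rw [hC]; ring
    change ‖S.U t (∫ s in 0..(t : ℝ), S.U (-s) (B Y s))‖ ≤ _
    rw [S.norm_map]
    have h5 := intervalIntegral.norm_integral_le_of_norm_le (μ := volume) t.2.1
      (f := fun s => S.U (-s) (B Y s)) (g := fun s => C * c * s ^ n)
      (Filter.Eventually.of_forall fun s hs => by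
        rw [S.norm_map]
        exact hBn s ⟨hs.1.le, hs.2.trans t.2.2⟩)
      (Continuous.intervalIntegrable (by fun_prop) _ _)
    refine h5.trans (le_of_eq ?_)
    rw [intervalIntegral.integral_const_mul, integral_pow]
    simp
  let k : C(Icc 0 T, X) →L[ℝ] C(Icc 0 T, X) := k₀.mkContinuous (C * T) (fun Y => by
    rw [ContinuousMap.norm_le _ (by positivity)]
    intro t
    refine (hk Y 0 ‖Y‖ (norm_nonneg _) (fun s => by simpa using Y.norm_coe_le_norm s) t).trans ?_
    have := t.2.2
    calc C * ‖Y‖ * ((t : ℝ) ^ (0 + 1) / ((0 : ℕ) + 1)) = C * t * ‖Y‖ := by simp; ring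
      _ ≤ C * T * ‖Y‖ := by gcongr)
  have hgi := S.intervalIntegrable_neg_apply hg
  let F : C(Icc 0 T, X) := ⟨fun t => S.U t (Y₀ + ∫ s in 0..(t : ℝ), S.U (-s) (g s)),
    hUc (f := fun t => Y₀ + ∫ s in 0..(t : ℝ), S.U (-s) (g s))
      (continuousOn_const.add (hprim hgi))⟩
  obtain ⟨Y, hY⟩ := exists_eq_add_of_volterra k hC0 hk F
  have hmild : ∀ t (ht : t ∈ Icc 0 T), IccExtend hT Y t =
      S.U t (Y₀ + ∫ s in 0..t, S.U (-s) (g s)) + S.U t (∫ s in 0..t, S.U (-s) (B Y s)) := by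
    intro t ht
    rw [IccExtend_of_mem hT Y ht]
    exact congrArg (fun f : C(Icc 0 T, X) => f ⟨t, ht⟩) hY
  have h0 : IccExtend hT Y 0 = Y₀ := by
    rw [hmild 0 ⟨le_rfl, hT⟩]
    simp [S.zero_apply hd]
  refine ⟨IccExtend hT Y, Y.continuous.Icc_extend'.continuousOn, h0, fun t ht => ?_⟩
  rw [h0, hmild t ht, ← map_add, S.neg_apply, add_assoc, ← intervalIntegral.integral_add
    (hgi.mono_set (by
      rw [uIcc_of_le ht.1, uIcc_of_le hT]; exact Icc_subset_Icc_right ht.2)) (hBi Y t ht)]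
  simp only [hB, map_add]

theorem exists_weak_solution (hK : ∀ x y, ⟪K x, y⟫_ℝ = -⟪x, K y⟫_ℝ) (hd : DenseRange K) {T : ℝ}
    (hT : 0 ≤ T) (L : X →L[ℝ] X) {N : ℝ → ℝ → ℝ}
    (hN : ContinuousOn (Function.uncurry N) (Icc 0 T ×ˢ Icc 0 T)) (Y₀ : X) {g : ℝ → X}
    (hg : IntervalIntegrable g volume 0 T) :
    ∃ Y : ℝ → X, ContinuousOn Y (Icc 0 T) ∧ Y 0 = Y₀ ∧ ∀ x, ∀ t ∈ Icc 0 T,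
      ⟪Y t, K x⟫_ℝ = ⟪Y 0, K x⟫_ℝ + ∫ s in 0..t,
        (⟪g s + (L (Y s) - ∫ r in 0..s, N s r • L (Y r)), K x⟫_ℝ - ⟪Y s, x⟫_ℝ) := by
  obtain ⟨S⟩ := exists_orthogonalGroup hK hd
  obtain ⟨Y, hY, h0, hm⟩ := S.exists_mild hd hT L hN Y₀ hg
  refine ⟨Y, hY, h0, fun x t ht => S.weak_of_mild (hg.add ?_) hm hd x ht⟩
  refine ContinuousOn.intervalIntegrable ?_
  rw [uIcc_of_le hT]
  have hLY : ContinuousOn (fun s => L (Y s)) (Icc 0 T) := L.continuous.comp_continuousOn hY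
  exact hLY.sub (continuousOn_integral_kernel hT hN hLY ⟨le_rfl, hT⟩)

end Evolution

/-! ### The abstract wave equation on the energy space and its duality -/

section Wave

variable {W H : Type*} [NormedAddCommGroup W] [InnerProductSpace ℝ W]
  [NormedAddCommGroup H] [InnerProductSpace ℝ H]

theorem inner_withLp_prod (x y : WithLp 2 (W × H)) :
    ⟪x, y⟫_ℝ = ⟪x.fst, y.fst⟫_ℝ + ⟪x.snd, y.snd⟫_ℝ := WithLp.prod_inner_apply x y

/-- The inclusion of the second component into the energy space. -/
def energyInr (W H : Type*) [NormedAddCommGroup W] [InnerProductSpace ℝ W]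
    [NormedAddCommGroup H] [InnerProductSpace ℝ H] : H →L[ℝ] WithLp 2 (W × H) :=
  (WithLp.prodContinuousLinearEquiv 2 ℝ W H).symm.toContinuousLinearMap.comp
    (ContinuousLinearMap.inr ℝ W H)

theorem energyInr_fst (h : H) : (energyInr W H h).fst = 0 := rfl

theorem energyInr_snd (h : H) : (energyInr W H h).snd = h := rfl

/-- The continuous linear map `ι` is injective and has dense range. -/
structure IsDenseEmbedding (ι : W →L[ℝ] H) : Prop where
  injective : Function.Injective ι
  denseRange : DenseRange ι

variable [CompleteSpace W] [CompleteSpace H]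

/-- The inverse `(f, g) ↦ (-ι† g, ι f)` of the wave operator on the energy space. -/
def waveInv (ι : W →L[ℝ] H) : WithLp 2 (W × H) →L[ℝ] WithLp 2 (W × H) :=
  (WithLp.prodContinuousLinearEquiv 2 ℝ W H).symm.toContinuousLinearMap.comp
    (((-(ContinuousLinearMap.adjoint ι)).comp (WithLp.sndL 2 ℝ W H)).prod
      (ι.comp (WithLp.fstL 2 ℝ W H)))

theorem waveInv_fst (ι : W →L[ℝ] H) (x : WithLp 2 (W × H)) :
    (waveInv ι x).fst = -(ContinuousLinearMap.adjoint ι x.snd) := rfl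

theorem waveInv_snd (ι : W →L[ℝ] H) (x : WithLp 2 (W × H)) :
    (waveInv ι x).snd = ι x.fst := rfl

theorem inner_waveInv (ι : W →L[ℝ] H) (z x : WithLp 2 (W × H)) :
    ⟪z, waveInv ι x⟫_ℝ = -⟪ι z.fst, x.snd⟫_ℝ + ⟪z.snd, ι x.fst⟫_ℝ := by
  rw [inner_withLp_prod, waveInv_fst, waveInv_snd, inner_neg_right,
    ContinuousLinearMap.adjoint_inner_right]

theorem waveInv_skew (ι : W →L[ℝ] H) (x y : WithLp 2 (W × H)) :
    ⟪waveInv ι x, y⟫_ℝ = -⟪x, waveInv ι y⟫_ℝ := by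
  rw [real_inner_comm, inner_waveInv, inner_waveInv, real_inner_comm x.snd, real_inner_comm y.snd]
  ring

/-- For a skew operator the orthogonal complement of the range lies in the kernel. The kernel is
trivial because ι is injective and, its range being dense, so is ι†. -/
theorem denseRange_waveInv {ι : W →L[ℝ] H} (hι : IsDenseEmbedding ι) :
    DenseRange (waveInv ι) := by
  have h : (LinearMap.range (waveInv ι).toLinearMap)ᗮ = ⊥ := by
    rw [Submodule.eq_bot_iff]
    intro z hz
    have h1 : waveInv ι z = 0 := by
      refine ext_inner_left ℝ fun x => ?_
      have := hz (waveInv ι x) ⟨x, rfl⟩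
      rw [waveInv_skew, neg_eq_zero] at this
      rw [this, inner_zero_right]
    have h2 : ι z.fst = 0 := by rw [← waveInv_snd, h1]; rfl
    have h3 : ContinuousLinearMap.adjoint ι z.snd = 0 := by
      rw [← neg_eq_zero, ← waveInv_fst, h1]; rfl
    have h4 : z.fst = 0 := hι.injective (by rw [h2, map_zero])
    have h5 : z.snd = 0 := by
      refine ext_inner_left ℝ fun k => ?_
      rw [inner_zero_right]
      refine congrFun (DenseRange.equalizer hι.denseRange (g := fun k => ⟪k, z.snd⟫_ℝ) (h := fun _ => 0)
        (by fun_prop) continuous_const ?_) k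
      funext v
      simp only [Function.comp_apply]
      rw [← ContinuousLinearMap.adjoint_inner_right, h3, inner_zero_right]
    exact (WithLp.ofLp_injective 2) (Prod.ext h4 h5)
  have := (Submodule.topologicalClosure_eq_top_iff).2 h
  exact Submodule.dense_iff_topologicalClosure_eq_top.2 this

/-- Finite energy solutions of an abstract wave equation with memory. -/
theorem exists_wave_solution {ι : W →L[ℝ] H} (hι : IsDenseEmbedding ι)
    {T : ℝ} (hT : 0 ≤ T) {N : ℝ → ℝ → ℝ}
    (hN : ContinuousOn (Function.uncurry N) (Icc 0 T ×ˢ Icc 0 T)) (y₀ : W) (y₁ : H) {f : ℝ → H}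
    (hf : IntervalIntegrable f volume 0 T) :
    ∃ (y : ℝ → W) (z : ℝ → H), ContinuousOn y (Icc 0 T) ∧ ContinuousOn z (Icc 0 T) ∧
      y 0 = y₀ ∧ z 0 = y₁ ∧ (∀ t ∈ Icc 0 T, ι (y t) = ι (y 0) + ∫ s in 0..t, z s) ∧
      ∀ v, ∀ t ∈ Icc 0 T, ⟪z t, ι v⟫_ℝ - ⟪y₁, ι v⟫_ℝ +
        ∫ s in 0..t, (⟪y s, v⟫_ℝ - ⟪ι (y s), ι v⟫_ℝ + ⟪∫ r in 0..s, N s r • ι (y r), ι v⟫_ℝ) =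
        ∫ s in 0..t, ⟪f s, ι v⟫_ℝ := by
  have hsub : ∀ t ∈ Icc 0 T, uIcc 0 t ⊆ Icc 0 T := fun t ht => by
    rw [uIcc_of_le ht.1]; exact Icc_subset_Icc_right ht.2
  set j := energyInr W H
  have hg : IntervalIntegrable (fun s => j (f s)) volume 0 T :=
    ⟨j.integrable_comp hf.1, j.integrable_comp hf.2⟩
  -- L sends (y, z) to (0, ιy). It returns the zeroth-order term contained in the inner product of
  -- W, and the memory term is built from the same L.
  obtain ⟨Y, hY, h0, hw⟩ := exists_weak_solution (waveInv_skew ι) (denseRange_waveInv hι) hT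
    (j.comp (ι.comp (WithLp.fstL 2 ℝ W H))) hN (WithLp.toLp 2 (y₀, y₁)) hg
  have hy : ContinuousOn (fun t => (Y t).fst) (Icc 0 T) :=
    (WithLp.fstL 2 ℝ W H).continuous.comp_continuousOn hY
  have hz : ContinuousOn (fun t => (Y t).snd) (Icc 0 T) :=
    (WithLp.sndL 2 ℝ W H).continuous.comp_continuousOn hY
  have hιy : ContinuousOn (fun t => ι (Y t).fst) (Icc 0 T) := ι.continuous.comp_continuousOn hy
  have hmem : ContinuousOn (fun s => ∫ r in 0..s, N s r • ι (Y r).fst) (Icc 0 T) :=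
    continuousOn_integral_kernel hT hN hιy ⟨le_rfl, hT⟩
  have hNi : ∀ s ∈ Icc 0 T, IntervalIntegrable (fun r => N s r • ι (Y r).fst) volume 0 s :=
    fun s hs => by
      refine ContinuousOn.intervalIntegrable (ContinuousOn.smul ?_ (hιy.mono (hsub s hs)))
      exact hN.comp (f := fun r => (s, r)) (by fun_prop) fun r hr => ⟨hs, hsub s hs hr⟩
  have hw' : ∀ x, ∀ t ∈ Icc 0 T, ⟪Y t, waveInv ι x⟫_ℝ = ⟪Y 0, waveInv ι x⟫_ℝ + ∫ s in 0..t,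
      (⟪f s + (ι (Y s).fst - ∫ r in 0..s, N s r • ι (Y r).fst), ι x.fst⟫_ℝ - ⟪Y s, x⟫_ℝ) := by
    intro x t ht
    rw [hw x t ht]
    congr 1
    refine intervalIntegral.integral_congr fun s hs => ?_
    have hs' := hsub s (hsub t ht hs)
    have e : ∫ r in 0..s, N s r • (j.comp (ι.comp (WithLp.fstL 2 ℝ W H))) (Y r) =
        j (∫ r in 0..s, N s r • ι (Y r).fst) := by
      rw [← j.intervalIntegral_comp_comm (hNi s (hsub t ht hs))]
      simp
    have e2 : (j.comp (ι.comp (WithLp.fstL 2 ℝ W H))) (Y s) = j (ι (Y s).fst) := rfl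
    rw [e, e2, ← map_sub, ← map_add, inner_waveInv, energyInr_fst, energyInr_snd, map_zero,
      inner_zero_left, neg_zero, zero_add]
  have hy0 : (Y 0).fst = y₀ := by rw [h0]; rfl
  have hz0 : (Y 0).snd = y₁ := by rw [h0]; rfl
  -- Test vectors (0, k) yield the relation between position and velocity; test vectors (v, 0) yield
  -- the wave equation.
  refine ⟨fun t => (Y t).fst, fun t => (Y t).snd, hy, hz, hy0, hz0, fun t ht => ?_,
    fun v t ht => ?_⟩
  · refine ext_inner_right ℝ fun k => ?_
    have h := hw' (WithLp.toLp 2 (0, k)) t ht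
    simp only [inner_waveInv] at h
    simp only [inner_withLp_prod, WithLp.toLp_fst, WithLp.toLp_snd, map_zero,
      inner_zero_right, add_zero, zero_add, zero_sub, intervalIntegral.integral_neg] at h
    rw [inner_add_left, ← intervalIntegral_inner_left
      (ContinuousOn.intervalIntegrable (hz.mono (hsub t ht)))]
    linarith
  · have h := hw' (WithLp.toLp 2 (v, 0)) t ht
    simp only [inner_waveInv] at h
    simp only [inner_withLp_prod, WithLp.toLp_fst, WithLp.toLp_snd,
      inner_zero_right, add_zero, zero_add, neg_zero] at h
    rw [h, hz0, add_sub_cancel_left, ← intervalIntegral.integral_add]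
    · congr 1
      ext s
      rw [inner_add_left, inner_sub_left]
      ring
    · have hfi : IntervalIntegrable (fun s => ⟪f s, ι v⟫_ℝ) volume 0 T :=
        intervalIntegrable_inner_of_continuousOn hT hf continuousOn_const
      have hfi' : IntervalIntegrable (fun s => ⟪f s, ι v⟫_ℝ) volume 0 t :=
        hfi.mono_set (by rw [uIcc_of_le hT]; exact hsub t ht)
      have hc : IntervalIntegrable (fun s => ⟪ι (Y s).fst - ∫ r in 0..s, N s r • ι (Y r).fst,
          ι v⟫_ℝ - ⟪(Y s).fst, v⟫_ℝ) volume 0 t := by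
        refine ContinuousOn.intervalIntegrable (ContinuousOn.mono ?_ (hsub t ht))
        exact ((hιy.sub hmem).inner continuousOn_const).sub (hy.inner continuousOn_const)
      refine (hfi'.add hc).congr fun s _ => ?_
      rw [inner_add_left]
      ring
    · refine ContinuousOn.intervalIntegrable (ContinuousOn.mono ?_ (hsub t ht))
      exact ((hy.inner continuousOn_const).sub (hιy.inner continuousOn_const)).add
        (hmem.inner continuousOn_const)

/-- The forward and backward memory operators are adjoint in L²(0, T; H), by Fubini on the triangle.
-/
theorem integral_memory_swap {T : ℝ} (hT : 0 ≤ T) {M : ℝ → ℝ → ℝ}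
    (hM : ContinuousOn (Function.uncurry M) (Icc 0 T ×ˢ Icc 0 T)) {a p : ℝ → H}
    (ha : ContinuousOn a (Icc 0 T)) (hp : ContinuousOn p (Icc 0 T)) :
    ∫ s in 0..T, ⟪a s, ∫ r in s..T, M r s • p r⟫_ℝ =
      ∫ s in 0..T, ⟪∫ r in 0..s, M s r • a r, p s⟫_ℝ := by
  have hc : ContinuousOn (Function.uncurry fun s r => M r s * ⟪a s, p r⟫_ℝ)
      (Icc 0 T ×ˢ Icc 0 T) := by
    refine ContinuousOn.mul (hM.comp (f := fun z : ℝ × ℝ => (z.2, z.1)) (by fun_prop)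
      fun z hz => ⟨hz.2, hz.1⟩) (ContinuousOn.inner ?_ ?_)
    · exact ha.comp continuousOn_fst fun z hz => hz.1
    · exact hp.comp continuousOn_snd fun z hz => hz.2
  have hi : Integrable (Function.uncurry fun s r => M r s * ⟪a s, p r⟫_ℝ)
      ((volume.restrict (Ioc 0 T)).prod (volume.restrict (Ioc 0 T))) := by
    rw [Measure.prod_restrict]
    exact (hc.integrableOn_compact (isCompact_Icc.prod isCompact_Icc)).mono_set
      (prod_mono Ioc_subset_Icc_self Ioc_subset_Icc_self)
  have key := integral_integral_triangle hT hi
  have hIcc : ∀ {b c}, b ∈ Icc 0 T → c ∈ Icc 0 T → uIcc b c ⊆ Icc 0 T := fun hb hc =>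
    uIcc_subset_Icc hb hc
  refine Eq.trans ?_ (key.trans ?_)
  · refine intervalIntegral.integral_congr fun s hs => ?_
    rw [uIcc_of_le hT] at hs
    have hsub := hIcc hs ⟨hT, le_rfl⟩
    rw [← intervalIntegral_inner_right]
    · simp only [inner_smul_right]
    · refine ContinuousOn.intervalIntegrable (ContinuousOn.smul ?_ (hp.mono hsub))
      exact hM.comp (f := fun r => (r, s)) (by fun_prop) fun r hr => ⟨hsub hr, hs⟩
  · refine intervalIntegral.integral_congr fun s hs => ?_
    rw [uIcc_of_le hT] at hs
    have hsub := hIcc ⟨le_rfl, hT⟩ hs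
    rw [← intervalIntegral_inner_left]
    · simp only [real_inner_smul_left]
    · refine ContinuousOn.intervalIntegrable (ContinuousOn.smul ?_ (ha.mono hsub))
      exact hM.comp (f := fun r => (s, r)) (by fun_prop) fun r hr => ⟨hs, hsub hr⟩

/-- The duality between a wave equation with memory and its adjoint equation. -/
theorem wave_duality {ι : W →L[ℝ] H} (hι : IsDenseEmbedding ι)
    {T : ℝ} (hT : 0 ≤ T) {M : ℝ → ℝ → ℝ}
    (hM : ContinuousOn (Function.uncurry M) (Icc 0 T ×ˢ Icc 0 T)) {f z p : ℝ → H} {y π : ℝ → W}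
    (hf : IntervalIntegrable f volume 0 T) (hy : ContinuousOn y (Icc 0 T))
    (hz : ContinuousOn z (Icc 0 T)) (hyz : ∀ t ∈ Icc 0 T, ι (y t) = ι (y 0) + ∫ s in 0..t, z s)
    (hyw : ∀ v, ∀ t ∈ Icc 0 T, ⟪z t, ι v⟫_ℝ - ⟪z 0, ι v⟫_ℝ +
        ∫ s in 0..t, (⟪y s, v⟫_ℝ - ⟪ι (y s), ι v⟫_ℝ + ⟪∫ r in 0..s, M s r • ι (y r), ι v⟫_ℝ) =
        ∫ s in 0..t, ⟪f s, ι v⟫_ℝ)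
    {q₀ : H} (hp : ContinuousOn p (Icc 0 T)) (hπ : ContinuousOn π (Icc 0 T))
    (hpπ : ∀ v, ∀ t ∈ Icc 0 T, ⟪p t, ι v⟫_ℝ = ⟪p 0, ι v⟫_ℝ + ∫ s in 0..t, ⟪π s, v⟫_ℝ)
    (hpw : ∀ k, ∀ t ∈ Icc 0 T, ⟪π T, ContinuousLinearMap.adjoint ι k⟫_ℝ -
      ⟪π t, ContinuousLinearMap.adjoint ι k⟫_ℝ +
      ∫ s in t..T, (-⟪p s, ι (ContinuousLinearMap.adjoint ι k) - k⟫_ℝ +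
        ⟪∫ r in s..T, M r s • p r, ι (ContinuousLinearMap.adjoint ι k)⟫_ℝ +
        M T s * ⟪q₀, ι (ContinuousLinearMap.adjoint ι k)⟫_ℝ) = 0) :
    ⟪z T, p T⟫_ℝ - ⟪π T, y T⟫_ℝ - ⟪∫ s in 0..T, M T s • ι (y s), q₀⟫_ℝ =
      ⟪z 0, p 0⟫_ℝ - ⟪π 0, y 0⟫_ℝ + ∫ s in 0..T, ⟪f s, p s⟫_ℝ := by
  have hsub : ∀ t ∈ Icc 0 T, uIcc 0 t ⊆ Icc 0 T := fun t ht => by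
    rw [uIcc_of_le ht.1]; exact Icc_subset_Icc_right ht.2
  have h0m : (0 : ℝ) ∈ Icc 0 T := ⟨le_rfl, hT⟩
  have hTm : T ∈ Icc 0 T := ⟨hT, le_rfl⟩
  set A := ContinuousLinearMap.adjoint ι with hA
  have hιy : ContinuousOn (fun t => ι (y t)) (Icc 0 T) := ι.continuous.comp_continuousOn hy
  set m : ℝ → H := fun s => ∫ r in 0..s, M s r • ι (y r) with hm
  have hmc : ContinuousOn m (Icc 0 T) := continuousOn_integral_kernel hT hM hιy h0m
  set n : ℝ → H := fun s => ∫ r in s..T, M r s • p r with hn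
  have hnc : ContinuousOn n (Icc 0 T) := continuousOn_integral_kernel_right hT hM hp
  have hMT : ContinuousOn (fun s => M T s) (Icc 0 T) :=
    hM.comp (f := fun s => (T, s)) (by fun_prop) fun s hs => ⟨hTm, hs⟩
  -- All zeroth-order terms of the adjoint equation: p compensates the identity in 1 − Δ, n is the
  -- backward memory, and the last term carries q₀.
  set h : ℝ → H := fun s => p s - n s - M T s • q₀ with hh
  have hhc : ContinuousOn h (Icc 0 T) := (hp.sub hnc).sub (hMT.smul continuousOn_const)
  set j := energyInr W H
  set G : ℝ → H := fun s => f s + (ι (y s) - m s) with hG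
  have hc : IntervalIntegrable (fun s => ι (y s) - m s) volume 0 T :=
    ContinuousOn.intervalIntegrable ((hιy.sub hmc).mono (hsub T hTm))
  have hGi : IntervalIntegrable G volume 0 T := hf.add hc
  have hπw : ∀ k, ∀ t ∈ Icc 0 T, ⟪π t, A k⟫_ℝ = ⟪π 0, A k⟫_ℝ +
      ∫ s in 0..t, (⟪h s, ι (A k)⟫_ℝ - ⟪p s, k⟫_ℝ) := by
    intro k t ht
    have e : ∀ s, -⟪p s, ι (A k) - k⟫_ℝ + ⟪n s, ι (A k)⟫_ℝ + M T s * ⟪q₀, ι (A k)⟫_ℝ =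
        -(⟪h s, ι (A k)⟫_ℝ - ⟪p s, k⟫_ℝ) := by
      intro s
      simp only [hh]
      rw [inner_sub_left, inner_sub_left, real_inner_smul_left, inner_sub_right]
      ring
    have h1 := hpw k t ht
    have h2 := hpw k 0 h0m
    simp only [hn] at e
    simp only [e, intervalIntegral.integral_neg] at h1 h2
    have hic : ContinuousOn (fun s => ⟪h s, ι (A k)⟫_ℝ - ⟪p s, k⟫_ℝ) (Icc 0 T) :=
      (hhc.inner continuousOn_const).sub (hp.inner continuousOn_const)
    have h3 := intervalIntegral.integral_add_adjacent_intervals (μ := volume)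
      (hic.mono (hsub t ht)).intervalIntegrable
      (hic.mono (uIcc_subset_Icc ht hTm)).intervalIntegrable
    linarith
  -- The pair (p, p') lives in H × W', one level below the energy space. Replacing p' by its Riesz
  -- representative π and exchanging the components gives (−π, p) in W × H, which is driven by the
  -- same generator as (y, z).
  have key := OrthogonalGroup.inner_eq_of_weak (waveInv_skew ι) (denseRange_waveInv hι) hT
    (Y := fun t => WithLp.toLp 2 (y t, z t)) (G := fun s => j (G s))
    (Q := fun t => WithLp.toLp 2 (-π t, p t)) (F := fun s => WithLp.toLp 2 (-A (h s), 0))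
    ((WithLp.prod_continuous_toLp 2 W H).comp_continuousOn (hy.prodMk hz))
    ⟨j.integrable_comp hGi.1, j.integrable_comp hGi.2⟩
    ?_ ((WithLp.prod_continuous_toLp 2 W H).comp_continuousOn (hπ.neg.prodMk hp)) ?_ ?_
  · simp only [inner_withLp_prod, WithLp.toLp_fst, WithLp.toLp_snd, inner_neg_right,
      inner_zero_right, add_zero, j, energyInr_fst, energyInr_snd, inner_zero_left, neg_zero,
      zero_add] at key
    have hsw := integral_memory_swap hT hM hιy hp
    -- The zeroth-order compensations cancel here, and the two memory terms cancel after integration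
    -- by `hsw`. What remains besides the control is the term in M(T, s), which becomes the third
    -- terminal pairing.
    have e : ∀ s, ⟪G s, p s⟫_ℝ + -⟪y s, A (h s)⟫_ℝ = ⟪f s, p s⟫_ℝ +
        (⟪ι (y s), n s⟫_ℝ - ⟪m s, p s⟫_ℝ + ⟪M T s • ι (y s), q₀⟫_ℝ) := by
      intro s
      rw [hA, ContinuousLinearMap.adjoint_inner_right]
      simp only [hG, hh]
      simp only [inner_add_left, inner_sub_left, inner_sub_right, real_inner_smul_left,
        real_inner_smul_right]
      ring
    have hi1 : IntervalIntegrable (fun s => ⟪ι (y s), n s⟫_ℝ) volume 0 T :=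
      ContinuousOn.intervalIntegrable ((hιy.inner hnc).mono (hsub T hTm))
    have hi2 : IntervalIntegrable (fun s => ⟪m s, p s⟫_ℝ) volume 0 T :=
      ContinuousOn.intervalIntegrable ((hmc.inner hp).mono (hsub T hTm))
    have hi3 : IntervalIntegrable (fun s => M T s • ι (y s)) volume 0 T :=
      ContinuousOn.intervalIntegrable ((hMT.smul hιy).mono (hsub T hTm))
    have hi3' : IntervalIntegrable (fun s => ⟪M T s • ι (y s), q₀⟫_ℝ) volume 0 T :=
      intervalIntegrable_inner_of_continuousOn hT hi3 continuousOn_const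
    have hi4 : IntervalIntegrable (fun s => ⟪f s, p s⟫_ℝ) volume 0 T :=
      intervalIntegrable_inner_of_continuousOn hT hf hp
    simp only [e] at key
    rw [intervalIntegral.integral_add hi4 ((hi1.sub hi2).add hi3'),
      intervalIntegral.integral_add (hi1.sub hi2) hi3', intervalIntegral.integral_sub hi1 hi2, hsw,
      intervalIntegral_inner_left hi3, real_inner_comm (π T), real_inner_comm (π 0)] at key
    linarith
  · intro x t ht
    simp only [inner_waveInv, WithLp.toLp_fst, WithLp.toLp_snd, j, energyInr_fst, energyInr_snd,
      map_zero, inner_zero_left, neg_zero, zero_add]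
    have h1 := hyw x.fst t ht
    have h2 := congrArg (fun k => ⟪k, x.snd⟫_ℝ) (hyz t ht)
    have hzi : IntervalIntegrable z volume 0 t :=
      ContinuousOn.intervalIntegrable (hz.mono (hsub t ht))
    simp only [inner_add_left, ← intervalIntegral_inner_left hzi] at h2
    have hfi : IntervalIntegrable (fun s => ⟪f s, ι x.fst⟫_ℝ) volume 0 t :=
      (intervalIntegrable_inner_of_continuousOn hT hf continuousOn_const).mono_set (by
        rw [uIcc_of_le hT]; exact hsub t ht)
    have hzi' : IntervalIntegrable (fun s => ⟪z s, x.snd⟫_ℝ) volume 0 t :=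
      ContinuousOn.intervalIntegrable ((hz.inner continuousOn_const).mono (hsub t ht))
    have hci : IntervalIntegrable (fun s => ⟪y s, x.fst⟫_ℝ - ⟪ι (y s), ι x.fst⟫_ℝ +
        ⟪m s, ι x.fst⟫_ℝ) volume 0 t :=
      ContinuousOn.intervalIntegrable (ContinuousOn.mono
        (((hy.inner continuousOn_const).sub (hιy.inner continuousOn_const)).add
          (hmc.inner continuousOn_const)) (hsub t ht))
    have e : ∀ s, ⟪G s, ι x.fst⟫_ℝ - ⟪(WithLp.toLp 2 (y s, z s) : WithLp 2 (W × H)), x⟫_ℝ =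
        ⟪f s, ι x.fst⟫_ℝ - (⟪y s, x.fst⟫_ℝ - ⟪ι (y s), ι x.fst⟫_ℝ + ⟪m s, ι x.fst⟫_ℝ) -
          ⟪z s, x.snd⟫_ℝ := by
      intro s
      simp only [hG, inner_withLp_prod, WithLp.toLp_fst, WithLp.toLp_snd, inner_add_left,
        inner_sub_left]
      ring
    simp only [e]
    rw [intervalIntegral.integral_sub (hfi.sub hci) hzi', intervalIntegral.integral_sub hfi hci]
    linarith
  · refine ContinuousOn.intervalIntegrable (ContinuousOn.mono ?_ (hsub T hTm))
    exact (WithLp.prod_continuous_toLp 2 W H).comp_continuousOn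
      ((A.continuous.comp_continuousOn hhc).neg.prodMk continuousOn_const)
  · intro x t ht
    simp only [inner_waveInv, WithLp.toLp_fst, WithLp.toLp_snd, map_neg, inner_neg_left, neg_neg,
      inner_zero_left, add_zero]
    have h1 := hπw x.snd t ht
    have h2 := hpπ x.fst t ht
    have hi1 : IntervalIntegrable (fun s => ⟪h s, ι (A x.snd)⟫_ℝ - ⟪p s, x.snd⟫_ℝ) volume 0 t :=
      ContinuousOn.intervalIntegrable (ContinuousOn.mono
        ((hhc.inner continuousOn_const).sub (hp.inner continuousOn_const)) (hsub t ht))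
    have hi2 : IntervalIntegrable (fun s => ⟪π s, x.fst⟫_ℝ) volume 0 t :=
      ContinuousOn.intervalIntegrable ((hπ.inner continuousOn_const).mono (hsub t ht))
    have e : ∀ s, ⟪ι (A (h s)), x.snd⟫_ℝ -
        ⟪(WithLp.toLp 2 (-π s, p s) : WithLp 2 (W × H)), x⟫_ℝ =
        ⟪h s, ι (A x.snd)⟫_ℝ - ⟪p s, x.snd⟫_ℝ + ⟪π s, x.fst⟫_ℝ := by
      intro s
      simp only [inner_withLp_prod, WithLp.toLp_fst, WithLp.toLp_snd, inner_neg_left]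
      rw [← ContinuousLinearMap.adjoint_inner_right, ContinuousLinearMap.adjoint_inner_left]
      ring
    simp only [e]
    rw [intervalIntegral.integral_add hi1 hi2, ← ContinuousLinearMap.adjoint_inner_right,
      ← ContinuousLinearMap.adjoint_inner_right]
    linarith

end Wave

/-- By second countability every open set is a countable union of balls, and preimages of balls are
sublevel sets of distance functions. -/
theorem stronglyMeasurable_of_edist {α E : Type*} [MeasurableSpace α] [PseudoEMetricSpace E]
    [SecondCountableTopology E] {f : α → E} (h : ∀ g, Measurable fun s => edist (f s) g) :
    StronglyMeasurable f := by
  borelize E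
  refine Measurable.stronglyMeasurable (measurable_of_isOpen fun U hU => ?_)
  choose r hr hrU using fun x : U => EMetric.isOpen_iff.1 hU x x.2
  have hcov : ⋃ x : U, Metric.eball (x : E) (r x) = U := by
    refine Subset.antisymm (iUnion_subset hrU) fun x hx => ?_
    exact mem_iUnion.2 ⟨⟨x, hx⟩, Metric.mem_eball_self (hr _)⟩
  obtain ⟨t, ht, htU⟩ := isOpen_iUnion_countable (fun x : U => Metric.eball (x : E) (r x))
    fun x => Metric.isOpen_eball
  rw [hcov] at htU
  rw [← htU, preimage_iUnion₂]
  exact MeasurableSet.biUnion ht fun x _ => h x measurableSet_Iio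

/-! ### Identification of L²(μ; L²(ν)) with L²(μ ⊗ ν) -/

section Sections

variable {α β : Type*} [MeasurableSpace α] [MeasurableSpace β]

/-- `f s = u(s, ·)` for almost every `s`. -/
def IsSection (μ : Measure α) (ν : Measure β) (u : α × β → ℝ) (f : α → Lp ℝ 2 ν) : Prop :=
  ∀ᵐ s ∂μ, (f s : β → ℝ) =ᵐ[ν] fun x => u (s, x)

variable {μ : Measure α} {ν : Measure β}

theorem sq_enorm_Lp (g : Lp ℝ 2 ν) : ‖g‖ₑ ^ 2 = ∫⁻ x, ‖g x‖ₑ ^ 2 ∂ν := by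
  rw [Lp.enorm_def]
  simpa using eLpNorm_nnreal_pow_eq_lintegral (f := g) (μ := ν) (p := 2) two_ne_zero

theorem sq_eLpNorm_two {E : Type*} [NormedAddCommGroup E] (g : α → E) :
    eLpNorm g 2 μ ^ 2 = ∫⁻ x, ‖g x‖ₑ ^ 2 ∂μ := by
  simpa using eLpNorm_nnreal_pow_eq_lintegral (f := g) (μ := μ) (p := 2) two_ne_zero

namespace IsSection

theorem sub {u v : α × β → ℝ} {f g : α → Lp ℝ 2 ν} (hu : IsSection μ ν u f)
    (hv : IsSection μ ν v g) : IsSection μ ν (u - v) (f - g) := by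
  filter_upwards [hu, hv] with s h1 h2
  filter_upwards [h1, h2, Lp.coeFn_sub (f s) (g s)] with x h3 h4 h5
  rw [Pi.sub_apply, h5, Pi.sub_apply, h3, h4, Pi.sub_apply]

theorem add {u v : α × β → ℝ} {f g : α → Lp ℝ 2 ν} (hu : IsSection μ ν u f)
    (hv : IsSection μ ν v g) : IsSection μ ν (u + v) (f + g) := by
  filter_upwards [hu, hv] with s h1 h2
  filter_upwards [h1, h2, Lp.coeFn_add (f s) (g s)] with x h3 h4 h5
  rw [Pi.add_apply, h5, Pi.add_apply, h3, h4, Pi.add_apply]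

theorem congr_right {u : α × β → ℝ} {f g : α → Lp ℝ 2 ν} (hu : IsSection μ ν u f)
    (h : f =ᵐ[μ] g) : IsSection μ ν u g := by
  filter_upwards [hu, h] with s h1 h2
  rwa [← h2]

theorem congr_left [SFinite ν] {u v : α × β → ℝ} {f : α → Lp ℝ 2 ν} (hu : IsSection μ ν u f)
    (h : u =ᵐ[μ.prod ν] v) : IsSection μ ν v f := by
  filter_upwards [hu, Measure.ae_ae_of_ae_prod h] with s h1 h2
  exact h1.trans h2

theorem unique {u : α × β → ℝ} {f g : α → Lp ℝ 2 ν} (hf : IsSection μ ν u f)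
    (hg : IsSection μ ν u g) : f =ᵐ[μ] g := by
  filter_upwards [hf, hg] with s h1 h2
  exact Lp.ext (h1.trans h2.symm)

theorem eLpNorm_eq [SFinite ν] {u : α × β → ℝ} {f : α → Lp ℝ 2 ν} (h : IsSection μ ν u f)
    (hu : AEStronglyMeasurable u (μ.prod ν)) :
    eLpNorm f 2 μ = eLpNorm u 2 (μ.prod ν) := by
  have hsq : eLpNorm f 2 μ ^ 2 = eLpNorm u 2 (μ.prod ν) ^ 2 := by
    rw [sq_eLpNorm_two, sq_eLpNorm_two, lintegral_prod _ (hu.enorm.pow_const 2)]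
    refine lintegral_congr_ae ?_
    filter_upwards [h] with s hs
    rw [sq_enorm_Lp]
    refine lintegral_congr_ae ?_
    filter_upwards [hs] with x hx
    rw [hx]
  exact (ENNReal.pow_right_strictMono two_ne_zero).injective hsq

end IsSection

/-- The slices of a square-integrable function lie in L²(ν) almost everywhere, by Tonelli.
Measurability of s ↦ u(s, ·) is checked on distances to a fixed g, which are again parametric
integrals. -/
theorem exists_isSection_of_memLp [SFinite ν] [MeasurableSpace.CountablyGenerated β]
    {u : α × β → ℝ} (hu : MemLp u 2 (μ.prod ν)) :
    ∃ f : α → Lp ℝ 2 ν, MemLp f 2 μ ∧ IsSection μ ν u f := by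
  classical
  wlog hsm : StronglyMeasurable u generalizing u
  · obtain ⟨f, hf, hs⟩ := this (hu.ae_eq hu.1.ae_eq_mk) hu.1.stronglyMeasurable_mk
    exact ⟨f, hf, hs.congr_left hu.1.ae_eq_mk.symm⟩
  have hslice : ∀ s, AEStronglyMeasurable (fun x => u (s, x)) ν := fun s =>
    (hsm.comp_measurable measurable_prodMk_left).aestronglyMeasurable
  have hm : Measurable fun s => ∫⁻ x, ‖u (s, x)‖ₑ ^ 2 ∂ν :=
    (hsm.enorm.pow_const 2).lintegral_prod_right'
  have hiff : ∀ s, MemLp (fun x => u (s, x)) 2 ν ↔ ∫⁻ x, ‖u (s, x)‖ₑ ^ 2 ∂ν < ⊤ := by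
    intro s
    rw [← sq_eLpNorm_two, ENNReal.pow_lt_top_iff]
    simp [MemLp, hslice s]
  have hA : MeasurableSet {s | MemLp (fun x => u (s, x)) 2 ν} := by
    simp only [hiff]
    exact measurableSet_lt hm measurable_const
  set f : α → Lp ℝ 2 ν := fun s =>
    if h : MemLp (fun x => u (s, x)) 2 ν then h.toLp else 0 with hf
  have : Fact ((2 : ENNReal) ≠ ⊤) := ⟨by simp⟩
  have hfm : StronglyMeasurable f := by
    refine stronglyMeasurable_of_edist fun g => ?_
    have hgm := Lp.stronglyMeasurable g
    have he : (fun s => edist (f s) g) = fun s => if MemLp (fun x => u (s, x)) 2 ν then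
        (∫⁻ x, ‖u (s, x) - g x‖ₑ ^ 2 ∂ν) ^ (1 / 2 : ℝ) else edist 0 g := by
      ext s
      by_cases h : MemLp (fun x => u (s, x)) 2 ν
      · simp only [hf, h, dif_pos, if_pos]
        rw [edist_eq_enorm_sub]
        have e : ‖h.toLp - g‖ₑ ^ 2 = ∫⁻ x, ‖u (s, x) - g x‖ₑ ^ 2 ∂ν := by
          rw [sq_enorm_Lp]
          refine lintegral_congr_ae ?_
          filter_upwards [Lp.coeFn_sub h.toLp g, h.coeFn_toLp] with x h1 h2
          rw [h1, Pi.sub_apply, h2]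
        rw [← e, ← ENNReal.rpow_natCast, ← ENNReal.rpow_mul]
        norm_num
      · simp only [hf, h, dif_neg, if_neg, not_false_eq_true]
    rw [he]
    refine Measurable.ite hA ?_ measurable_const
    refine Measurable.pow_const ?_ _
    exact ((hsm.sub (hgm.comp_measurable measurable_snd)).enorm.pow_const 2).lintegral_prod_right'
  have hfin : ∀ᵐ s ∂μ, ∫⁻ x, ‖u (s, x)‖ₑ ^ 2 ∂ν < ⊤ := by
    refine ae_lt_top hm ?_
    have := sq_eLpNorm_two (μ := μ.prod ν) u
    rw [lintegral_prod _ (hsm.enorm.pow_const 2).aemeasurable] at this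
    rw [← this]
    exact (ENNReal.pow_lt_top hu.2).ne
  have hs : IsSection μ ν u f := by
    filter_upwards [hfin] with s hs
    rw [← hiff] at hs
    simp only [hf, hs, dif_pos]
    exact hs.coeFn_toLp
  exact ⟨f, ⟨hfm.aestronglyMeasurable, by rw [hs.eLpNorm_eq hu.1]; exact hu.2⟩, hs⟩

/-- Representatives f(s) chosen separately for each s need not be jointly measurable. Slicing is an
isometry from L²(μ ⊗ ν), so its range is closed; it contains the simple curves, hence all of L²(μ;
L²(ν)). -/
theorem exists_memLp_isSection [SFinite ν] [MeasurableSpace.CountablyGenerated β]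
    {f : α → Lp ℝ 2 ν} (hf : MemLp f 2 μ) :
    ∃ u : α × β → ℝ, MemLp u 2 (μ.prod ν) ∧ IsSection μ ν u f := by
  classical
  choose F hF hFs using fun u : Lp ℝ 2 (μ.prod ν) =>
    exists_isSection_of_memLp (μ := μ) (ν := ν) (Lp.memLp u)
  let Φ : Lp ℝ 2 (μ.prod ν) → Lp (Lp ℝ 2 ν) 2 μ := fun u => (hF u).toLp
  have hΦ : Isometry Φ := by
    intro u v
    simp only [Φ]
    rw [Lp.edist_toLp_toLp, Lp.edist_def]
    exact ((hFs u).sub (hFs v)).eLpNorm_eq ((Lp.aestronglyMeasurable u).sub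
      (Lp.aestronglyMeasurable v))
  have hrange : {g : Lp (Lp ℝ 2 ν) 2 μ | ∃ u : α × β → ℝ, MemLp u 2 (μ.prod ν) ∧
      IsSection μ ν u g} = range Φ := by
    ext g
    constructor
    · rintro ⟨u, hu, hs⟩
      refine ⟨hu.toLp, Lp.ext ?_⟩
      refine (hF _).coeFn_toLp.trans ?_
      exact ((hFs hu.toLp).congr_left hu.coeFn_toLp).unique hs
    · rintro ⟨u, rfl⟩
      exact ⟨u, Lp.memLp u, (hFs u).congr_right (hF u).coeFn_toLp.symm⟩
  suffices h : ∀ g : Lp (Lp ℝ 2 ν) 2 μ, ∃ u : α × β → ℝ, MemLp u 2 (μ.prod ν) ∧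
      IsSection μ ν u g by
    obtain ⟨u, hu, hs⟩ := h hf.toLp
    exact ⟨u, hu, hs.congr_right hf.coeFn_toLp⟩
  refine Lp.induction (by simp) _ ?_ ?_ ?_
  · intro c s hs hμs
    rw [Lp.simpleFunc.coe_indicatorConst]
    set g := indicatorConstLp 2 hs hμs.ne c
    have hsec : IsSection μ ν (fun z => s.indicator (fun _ => (1 : ℝ)) z.1 * c z.2) g := by
      filter_upwards [indicatorConstLp_coeFn (p := 2) (hs := hs) (hμs := hμs.ne) (c := c)]
        with r hr
      rw [hr]
      by_cases hrs : r ∈ s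
      · simp [hrs]
      · filter_upwards [Lp.coeFn_zero ℝ 2 ν] with x hx
        simp only [hrs, not_false_eq_true, indicator_of_notMem, zero_mul]
        exact hx
    have hum : StronglyMeasurable
        (fun z : α × β => s.indicator (fun _ => (1 : ℝ)) z.1 * c z.2) :=
      ((stronglyMeasurable_const.indicator hs).comp_measurable measurable_fst).mul
        ((Lp.stronglyMeasurable c).comp_measurable measurable_snd)
    refine ⟨_, ⟨hum.aestronglyMeasurable, ?_⟩, hsec⟩
    rw [← hsec.eLpNorm_eq hum.aestronglyMeasurable]
    exact (Lp.memLp g).2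
  · rintro f g hf hg - ⟨u, hu, hus⟩ ⟨v, hv, hvs⟩
    exact ⟨u + v, hu.add hv, (hus.add hvs).congr_right (Lp.coeFn_add _ _).symm⟩
  · rw [hrange]
    exact hΦ.isClosedEmbedding.isClosed_range

end Sections

/-! ### Sobolev spaces: weak derivatives, density, completeness -/

section Sobolev

variable {d : ℕ} {Ω : Opens (EuclideanSpace ℝ (Fin d))}

theorem inner_H10 (u v : H10 Ω) : ⟪u, v⟫_ℝ = ⟪toL2 u, toL2 v⟫_ℝ + ⟪grad u, grad v⟫_ℝ :=
  inner_withLp_prod (u : Jet1 Ω) (v : Jet1 Ω)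

instance : CompleteSpace (H10 Ω) :=
  (Submodule.isClosed_topologicalClosure _).completeSpace_coe

theorem continuous_testPartial (i : Fin d) (φ : 𝓓(Ω, ℝ)) : Continuous (testPartial i φ) :=
  (φ.contDiff.continuous_fderiv (by simp)).clm_apply continuous_const

theorem hasCompactSupport_testPartial (i : Fin d) (φ : 𝓓(Ω, ℝ)) :
    HasCompactSupport (testPartial i φ) :=
  φ.hasCompactSupport.fderiv_apply (𝕜 := ℝ) _

/-- A continuous compactly supported function as an element of `L²(Ω)`. -/
def compactToL2 (Ω : Opens (EuclideanSpace ℝ (Fin d))) {f : EuclideanSpace ℝ (Fin d) → ℝ}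
    (hf : Continuous f) (hc : HasCompactSupport f) : L2 Ω :=
  ((hf.memLp_of_hasCompactSupport hc).restrict _).toLp

theorem coeFn_compactToL2 {f : EuclideanSpace ℝ (Fin d) → ℝ}
    (hf : Continuous f) (hc : HasCompactSupport f) :
    (compactToL2 Ω hf hc : EuclideanSpace ℝ (Fin d) → ℝ)
      =ᵐ[volume.restrict (Ω : Set (EuclideanSpace ℝ (Fin d)))] f :=
  MemLp.coeFn_toLp _

theorem inner_L2 (u v : L2 Ω) :
    ⟪u, v⟫_ℝ = ∫ x in (Ω : Set (EuclideanSpace ℝ (Fin d))), u x * v x := by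
  rw [L2.inner_def]
  simp only [RCLike.inner_apply, conj_trivial]
  simp [mul_comm]

theorem inner_compactToL2 (u : L2 Ω) {f : EuclideanSpace ℝ (Fin d) → ℝ}
    (hf : Continuous f) (hc : HasCompactSupport f) :
    ⟪u, compactToL2 Ω hf hc⟫_ℝ = ∫ x in (Ω : Set (EuclideanSpace ℝ (Fin d))), u x * f x := by
  rw [inner_L2]
  refine integral_congr_ae ?_
  filter_upwards [coeFn_compactToL2 hf hc] with x hx
  rw [hx]

theorem hasWeakPartial_iff (i : Fin d) (u w : L2 Ω) : HasWeakPartial i u w ↔ ∀ φ : 𝓓(Ω, ℝ),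
    ⟪u, compactToL2 Ω (continuous_testPartial i φ) (hasCompactSupport_testPartial i φ)⟫_ℝ =
      -⟪w, compactToL2 Ω φ.continuous φ.hasCompactSupport⟫_ℝ := by
  simp only [inner_compactToL2, HasWeakPartial]

theorem isClosed_hasWeakPartial (i : Fin d) :
    IsClosed {z : L2 Ω × L2 Ω | HasWeakPartial i z.1 z.2} := by
  simp only [hasWeakPartial_iff, ofPred_forall]
  refine isClosed_iInter fun φ => isClosed_eq ?_ ?_ <;> fun_prop

theorem hasWeakPartial_testFunction (i : Fin d) (φ : 𝓓(Ω, ℝ)) {u w : L2 Ω}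
    (hu : (u : EuclideanSpace ℝ (Fin d) → ℝ)
      =ᵐ[volume.restrict (Ω : Set (EuclideanSpace ℝ (Fin d)))] φ)
    (hw : (w : EuclideanSpace ℝ (Fin d) → ℝ)
      =ᵐ[volume.restrict (Ω : Set (EuclideanSpace ℝ (Fin d)))] testPartial i φ) :
    HasWeakPartial i u w := by
  intro ψ
  have hψ : ∀ x ∉ (Ω : Set (EuclideanSpace ℝ (Fin d))), ψ x = 0 := fun x hx =>
    image_eq_zero_of_notMem_tsupport fun h => hx (ψ.tsupport_subset h)
  have hφ : ∀ x ∉ (Ω : Set (EuclideanSpace ℝ (Fin d))), φ x = 0 := fun x hx =>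
    image_eq_zero_of_notMem_tsupport fun h => hx (φ.tsupport_subset h)
  have e1 : ∫ x in (Ω : Set (EuclideanSpace ℝ (Fin d))), u x * testPartial i ψ x =
      ∫ x, φ x * testPartial i ψ x := by
    rw [← setIntegral_eq_integral_of_forall_compl_eq_zero (f := fun x => φ x * testPartial i ψ x)
      (fun x hx => by rw [hφ x hx, zero_mul])]
    refine integral_congr_ae ?_
    filter_upwards [hu] with x hx
    rw [hx]
  have e2 : ∫ x in (Ω : Set (EuclideanSpace ℝ (Fin d))), w x * ψ x =
      ∫ x, testPartial i φ x * ψ x := by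
    rw [← setIntegral_eq_integral_of_forall_compl_eq_zero (f := fun x => testPartial i φ x * ψ x)
      (fun x hx => by rw [hψ x hx, mul_zero])]
    refine integral_congr_ae ?_
    filter_upwards [hw] with x hx
    rw [hx]
  rw [e1, e2]
  have hi : ∀ {f g : EuclideanSpace ℝ (Fin d) → ℝ}, Continuous f → Continuous g →
      HasCompactSupport g → Integrable (fun x => f x * g x) := fun hf hg hc =>
    (hf.mul hg).integrable_of_hasCompactSupport hc.mul_left
  have hdφ : Differentiable ℝ φ := φ.contDiff.differentiable (by simp)
  have hdψ : Differentiable ℝ ψ := ψ.contDiff.differentiable (by simp)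
  exact integral_mul_fderiv_eq_neg_fderiv_mul_of_integrable
    (hi (continuous_testPartial i φ) ψ.continuous ψ.hasCompactSupport)
    (hi φ.continuous (continuous_testPartial i ψ) (hasCompactSupport_testPartial i ψ))
    (hi φ.continuous ψ.continuous ψ.hasCompactSupport) (fun x _ => hdφ x) (fun x _ => hdψ x)

/-- True for test functions by integration by parts, and preserved in the closure because the
weak-derivative relation is closed. -/
theorem hasWeakPartial_grad (u : H10 Ω) (i : Fin d) : HasWeakPartial i (toL2 u) (grad u i) := by
  let S : Submodule ℝ (Jet1 Ω) :=
    { carrier := {w | ∀ i, HasWeakPartial i w.fst (w.snd i)}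
      add_mem' := fun ha hb i => (ha i).add (hb i)
      zero_mem' := fun i => HasWeakPartial.zero
      smul_mem' := fun c a ha i => (ha i).smul c }
  have hS : IsClosed (S : Set (Jet1 Ω)) := by
    have : (S : Set (Jet1 Ω)) = ⋂ i, (fun w : Jet1 Ω => (w.fst, w.snd i)) ⁻¹'
        {z : L2 Ω × L2 Ω | HasWeakPartial i z.1 z.2} := by
      ext w
      simp only [mem_iInter, mem_preimage, mem_ofPred_eq]
      rfl
    rw [this]
    refine isClosed_iInter fun i => (isClosed_hasWeakPartial i).preimage ?_
    have h1 : Continuous fun w : Jet1 Ω => w.fst := (WithLp.fstL 2 ℝ _ _).continuous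
    have h2 : Continuous fun w : Jet1 Ω => w.snd := (WithLp.sndL 2 ℝ _ _).continuous
    fun_prop
  have hle : H10 Ω ≤ S := by
    refine Submodule.topologicalClosure_minimal _ (Submodule.span_le.2 ?_) hS
    rintro w ⟨φ, h1, h2⟩ i
    exact hasWeakPartial_testFunction i φ h1 (h2 i)
  exact hle u.2 i

theorem eq_zero_of_inner_testFunction {u : L2 Ω} (h : ∀ φ : 𝓓(Ω, ℝ),
    ∫ x in (Ω : Set (EuclideanSpace ℝ (Fin d))), u x * φ x = 0) : u = 0 := by
  refine Lp.ext ?_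
  have hloc : LocallyIntegrable u (volume.restrict (Ω : Set (EuclideanSpace ℝ (Fin d)))) :=
    (Lp.memLp u).locallyIntegrable (by norm_num)
  have key := Ω.isOpen.ae_eq_zero_of_integral_contDiff_smul_eq_zero
    (hloc.locallyIntegrableOn (Ω : Set (EuclideanSpace ℝ (Fin d)))) (fun g hg hc hs => by
      rw [← h ⟨g, hg, hc, hs⟩]
      refine integral_congr_ae (Filter.Eventually.of_forall fun x => ?_)
      exact mul_comm _ _)
  filter_upwards [key, ae_restrict_mem Ω.isOpen.measurableSet,
    Lp.coeFn_zero ℝ 2 (volume.restrict (Ω : Set (EuclideanSpace ℝ (Fin d))))] with x h1 h2 h3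
  rw [h1 h2, h3]
  rfl

/-- Elements of H¹₀ are stored as pairs, so injectivity says that the gradient component is
determined by the function: a weak gradient of 0 vanishes. -/
theorem toL2_injective : Function.Injective (toL2 : H10 Ω → L2 Ω) := by
  refine (injective_iff_map_eq_zero _).2 fun u hu => ?_
  have hg : grad u = 0 := by
    ext1 i
    refine eq_zero_of_inner_testFunction fun φ => ?_
    have h1 := (hasWeakPartial_iff i _ _).1 (hasWeakPartial_grad u i) φ
    rw [hu, inner_zero_left, zero_eq_neg, inner_compactToL2] at h1
    exact h1
  have h2 : ⟪u, u⟫_ℝ = 0 := by rw [inner_H10, hu, hg]; simp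
  exact inner_self_eq_zero.1 h2

/-- A test function as an element of `H¹₀(Ω)`. -/
theorem exists_H10_testFunction (φ : 𝓓(Ω, ℝ)) :
    ∃ u : H10 Ω, toL2 u = compactToL2 Ω φ.continuous φ.hasCompactSupport := by
  refine ⟨⟨WithLp.toLp 2 (compactToL2 Ω φ.continuous φ.hasCompactSupport, WithLp.toLp 2 fun i =>
    compactToL2 Ω (continuous_testPartial i φ) (hasCompactSupport_testPartial i φ)), ?_⟩, rfl⟩
  exact Submodule.le_topologicalClosure _ (Submodule.subset_span
    ⟨φ, coeFn_compactToL2 φ.continuous φ.hasCompactSupport, fun i =>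
      coeFn_compactToL2 (continuous_testPartial i φ) (hasCompactSupport_testPartial i φ)⟩)

theorem denseRange_toL2 : DenseRange (toL2 : H10 Ω → L2 Ω) := by
  have h : (LinearMap.range (toL2 : H10 Ω →L[ℝ] L2 Ω).toLinearMap)ᗮ = ⊥ := by
    rw [Submodule.eq_bot_iff]
    intro z hz
    refine eq_zero_of_inner_testFunction fun φ => ?_
    obtain ⟨u, hu⟩ := exists_H10_testFunction φ
    have := hz (toL2 u) ⟨u, rfl⟩
    rwa [real_inner_comm, hu, inner_compactToL2] at this
  exact Submodule.dense_iff_topologicalClosure_eq_top.2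
    ((Submodule.topologicalClosure_eq_top_iff).2 h)

/-- V is cut out by closed weak-derivative conditions. Completeness is needed for Banach–Steinhaus.
-/
instance : CompleteSpace (V Ω) := by
  refine IsClosed.completeSpace_coe (hs := ?_)
  have : (V Ω : Set (WithLp 2 (H10 Ω × PiLp 2 (fun _ : Fin d × Fin d => L2 Ω)))) =
      ⋂ i, ⋂ j, (fun w : WithLp 2 (H10 Ω × PiLp 2 (fun _ : Fin d × Fin d => L2 Ω)) =>
        (grad w.fst i, w.snd (i, j))) ⁻¹' {z : L2 Ω × L2 Ω | HasWeakPartial j z.1 z.2} := by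
    ext w
    simp only [mem_iInter, mem_preimage, mem_ofPred_eq]
    rfl
  rw [this]
  refine isClosed_iInter fun i => isClosed_iInter fun j =>
    (isClosed_hasWeakPartial j).preimage ?_
  have h1 : Continuous fun w : WithLp 2 (H10 Ω × PiLp 2 (fun _ : Fin d × Fin d => L2 Ω)) =>
    grad w.fst := grad.continuous.comp (WithLp.fstL 2 ℝ _ _).continuous
  have h2 : Continuous fun w : WithLp 2 (H10 Ω × PiLp 2 (fun _ : Fin d × Fin d => L2 Ω)) =>
    w.snd := (WithLp.sndL 2 ℝ _ _).continuous
  fun_prop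

end Sobolev

/-! ### Control region: traces of solutions and forcing terms -/

section Region

variable {d : ℕ} {Ω : Opens (EuclideanSpace ℝ (Fin d))} {T : ℝ}
  {O : ℝ → Set (EuclideanSpace ℝ (Fin d))}

/-- Interval integrals run over `Ioc 0 T`, while the sets O(t) are controlled only on `Ioo 0 T`; the
endpoint T is null. -/
theorem ae_mem_Ioo_of_Ioc : ∀ᵐ s ∂(volume.restrict (Ioc 0 T)), s ∈ Ioo 0 T := by
  filter_upwards [ae_restrict_mem measurableSet_Ioc,
    ae_restrict_of_ae (Measure.ae_ne volume T)] with s h1 h2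
  exact ⟨h1.1, lt_of_le_of_ne h1.2 h2⟩

theorem ae_ae_of_ae_controlRegion (hO : ∀ t ∈ Ioo 0 T, IsOpen (O t))
    (hR : MeasurableSet (controlRegion T O)) {Q : ℝ × EuclideanSpace ℝ (Fin d) → Prop}
    (h : ∀ᵐ z ∂(volume.restrict (controlRegion T O)), Q z) :
    ∀ᵐ s ∂(volume.restrict (Ioc 0 T)), ∀ᵐ x ∂(volume.restrict (O s)), Q (s, x) := by
  rw [ae_restrict_iff' hR, Measure.volume_eq_prod] at h
  filter_upwards [ae_mem_Ioo_of_Ioc, ae_restrict_of_ae (Measure.ae_ae_of_ae_prod h)] with s hs h1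
  rw [ae_restrict_iff' (hO s hs).measurableSet]
  filter_upwards [h1] with x hx hxO
  exact hx ⟨hs, hxO⟩

theorem integral_controlRegion (hT : 0 ≤ T) (hO : ∀ t ∈ Ioo 0 T, IsOpen (O t))
    (hR : MeasurableSet (controlRegion T O)) {h : ℝ × EuclideanSpace ℝ (Fin d) → ℝ}
    (hi : IntegrableOn h (controlRegion T O)) :
    ∫ z in controlRegion T O, h z = ∫ s in 0..T, ∫ x in O s, h (s, x) := by
  rw [← integral_indicator hR, Measure.volume_eq_prod, integral_prod, intervalIntegral.integral_of_le hT,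
    integral_Ioc_eq_integral_Ioo, ← integral_indicator measurableSet_Ioo]
  · congr 1
    ext s
    by_cases hs : s ∈ Ioo 0 T
    · rw [indicator_of_mem hs, ← integral_indicator (hO s hs).measurableSet]
      congr 1
      ext x
      by_cases hx : x ∈ O s
      · rw [indicator_of_mem hx, indicator_of_mem (show (s, x) ∈ controlRegion T O from ⟨hs, hx⟩)]
      · rw [indicator_of_notMem hx, indicator_of_notMem (fun h => hx h.2)]
    · rw [indicator_of_notMem hs]
      refine integral_eq_zero_of_ae (Filter.Eventually.of_forall fun x => ?_)
      exact indicator_of_notMem (fun h => hs h.1) _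
  · rw [← Measure.volume_eq_prod]
    exact hi.integrable_indicator hR

theorem controlRegion_subset (hO : ∀ t ∈ Ioo 0 T, O t ⊆ (Ω : Set (EuclideanSpace ℝ (Fin d)))) :
    controlRegion T O ⊆ Ioc 0 T ×ˢ (Ω : Set (EuclideanSpace ℝ (Fin d))) :=
  fun _ hz => ⟨Ioo_subset_Ioc_self hz.1, hO _ hz.1 hz.2⟩

theorem prod_restrict_eq : (volume.restrict (Ioc 0 T)).prod
    (volume.restrict (Ω : Set (EuclideanSpace ℝ (Fin d)))) =
    volume.restrict (Ioc 0 T ×ˢ (Ω : Set (EuclideanSpace ℝ (Fin d)))) := by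
  rw [Measure.prod_restrict, Measure.volume_eq_prod]

/-- `P` is the restriction of `p` to the control region. -/
def IsTrace (T : ℝ) (O : ℝ → Set (EuclideanSpace ℝ (Fin d))) (p : ℝ → L2 Ω)
    (P : ℝ × EuclideanSpace ℝ (Fin d) → ℝ) : Prop :=
  ∀ᵐ s ∂(volume.restrict (Ioc 0 T)), ∀ᵐ x ∂(volume.restrict (O s)), p s x = P (s, x)

/-- A continuous curve in L²(Ω) is bounded on [0, T], so it has a jointly measurable representative,
which is then restricted to the region. -/
theorem exists_isTrace
    (hO : ∀ t ∈ Ioo 0 T, IsOpen (O t) ∧ O t ⊆ (Ω : Set (EuclideanSpace ℝ (Fin d))))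
    (hR : MeasurableSet (controlRegion T O)) {p : ℝ → L2 Ω} (hp : ContinuousOn p (Icc 0 T)) :
    ∃ P : Lp ℝ 2 (volume.restrict (controlRegion T O)), IsTrace T O p P := by
  obtain ⟨C, hC⟩ := isCompact_Icc.exists_bound_of_continuousOn hp
  have hpm : MemLp p 2 (volume.restrict (Ioc 0 T)) := by
    refine MemLp.of_bound ?_ C ?_
    · exact (hp.mono Ioc_subset_Icc_self).aestronglyMeasurable measurableSet_Ioc
    · filter_upwards [ae_restrict_mem measurableSet_Ioc] with s hs
      exact hC s (Ioc_subset_Icc_self hs)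
  obtain ⟨u, hu, hs⟩ := exists_memLp_isSection hpm
  rw [prod_restrict_eq] at hu
  have hu' : MemLp u 2 (volume.restrict (controlRegion T O)) :=
    hu.mono_measure (Measure.restrict_mono
      (controlRegion_subset fun t ht => (hO t ht).2) le_rfl)
  refine ⟨hu'.toLp, ?_⟩
  filter_upwards [hs, ae_mem_Ioo_of_Ioc,
    ae_ae_of_ae_controlRegion (fun t ht => (hO t ht).1) hR hu'.coeFn_toLp] with s h1 h2 h3
  filter_upwards [h3, ae_mono (Measure.restrict_mono (hO s h2).2 le_rfl) h1] with x h4 h5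
  rw [h4, h5]

/-- The curve consists of the slices of u extended by zero off the region. It turns the control into
a Bochner integrable forcing for the abstract equation. -/
theorem exists_forcing (hO : ∀ t ∈ Ioo 0 T, IsOpen (O t) ∧
      O t ⊆ (Ω : Set (EuclideanSpace ℝ (Fin d))))
    (hR : MeasurableSet (controlRegion T O)) {u : ℝ × EuclideanSpace ℝ (Fin d) → ℝ}
    (hu : MemLp u 2 (volume.restrict (controlRegion T O))) :
    ∃ f : ℝ → L2 Ω, IntegrableOn f (Ioc 0 T) ∧ ∀ᵐ s ∂(volume.restrict (Ioc 0 T)),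
      ∀ g : L2 Ω, ⟪f s, g⟫_ℝ = ∫ x in O s, u (s, x) * g x := by
  have hu' : MemLp ((controlRegion T O).indicator u) 2 ((volume.restrict (Ioc 0 T)).prod
      (volume.restrict (Ω : Set (EuclideanSpace ℝ (Fin d))))) := by
    rw [prod_restrict_eq]
    exact ((memLp_indicator_iff_restrict hR).2 hu).restrict _
  obtain ⟨f, hf, hs⟩ := exists_isSection_of_memLp hu'
  refine ⟨f, hf.integrable one_le_two, ?_⟩
  filter_upwards [hs, ae_mem_Ioo_of_Ioc] with s h1 h2 g
  have hOm := (hO s h2).1.measurableSet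
  have e : ∫ x in (Ω : Set (EuclideanSpace ℝ (Fin d))), f s x * g x =
      ∫ x in (Ω : Set (EuclideanSpace ℝ (Fin d))),
        (O s).indicator (fun x => u (s, x) * g x) x := by
    refine integral_congr_ae ?_
    filter_upwards [h1] with x hx
    rw [hx]
    by_cases hxO : x ∈ O s
    · rw [indicator_of_mem hxO,
        indicator_of_mem (show (s, x) ∈ controlRegion T O from ⟨h2, hxO⟩)]
    · rw [indicator_of_notMem hxO, indicator_of_notMem (fun h => hxO h.2), zero_mul]
  rw [inner_L2, e, integral_indicator hOm, Measure.restrict_restrict hOm,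
    inter_eq_left.2 (hO s h2).2]

theorem inner_isTrace (hT : 0 ≤ T) (hO : ∀ t ∈ Ioo 0 T, IsOpen (O t))
    (hR : MeasurableSet (controlRegion T O)) (U : Lp ℝ 2 (volume.restrict (controlRegion T O)))
    {p : ℝ → L2 Ω} {P : Lp ℝ 2 (volume.restrict (controlRegion T O))} (h : IsTrace T O p P) :
    ⟪U, P⟫_ℝ = ∫ s in 0..T, ∫ x in O s, U (s, x) * p s x := by
  have hi : IntegrableOn (fun z => U z * P z) (controlRegion T O) :=
    MemLp.integrable_mul (p := 2) (q := 2) (Lp.memLp U) (Lp.memLp P)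
  have e : ⟪U, P⟫_ℝ = ∫ z in controlRegion T O, U z * P z := by
    rw [L2.inner_def]
    simp only [RCLike.inner_apply, conj_trivial]
    simp [mul_comm]
  rw [e, integral_controlRegion hT hO hR hi, intervalIntegral.integral_of_le hT,
    intervalIntegral.integral_of_le hT]
  refine integral_congr_ae ?_
  filter_upwards [h] with s hs
  refine integral_congr_ae ?_
  filter_upwards [hs] with x hx
  rw [hx]

theorem sqNormL2O_eq (hT : 0 ≤ T) (hO : ∀ t ∈ Ioo 0 T, IsOpen (O t))
    (hR : MeasurableSet (controlRegion T O))
    {p : ℝ → L2 Ω} {P : Lp ℝ 2 (volume.restrict (controlRegion T O))} (h : IsTrace T O p P) :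
    sqNormL2O T O p = ‖P‖ ^ 2 := by
  rw [← real_inner_self_eq_norm_sq, inner_isTrace hT hO hR P h, sqNormL2O,
    intervalIntegral.integral_of_le hT, intervalIntegral.integral_of_le hT]
  refine integral_congr_ae ?_
  filter_upwards [h] with s hs
  refine integral_congr_ae ?_
  filter_upwards [hs] with x hx
  rw [← hx, sq]

theorem IsTrace.add (hO : ∀ t ∈ Ioo 0 T, IsOpen (O t)) (hR : MeasurableSet (controlRegion T O))
    (hsub : ∀ t ∈ Ioo 0 T, O t ⊆ (Ω : Set (EuclideanSpace ℝ (Fin d))))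
    {p q : ℝ → L2 Ω} {P Q : Lp ℝ 2 (volume.restrict (controlRegion T O))}
    (hp : IsTrace T O p P) (hq : IsTrace T O q Q) : IsTrace T O (p + q) (P + Q : Lp ℝ 2 _) := by
  filter_upwards [hp, hq, ae_mem_Ioo_of_Ioc,
    ae_ae_of_ae_controlRegion hO hR (Lp.coeFn_add P Q)] with s h1 h2 h3 h4
  filter_upwards [h1, h2, h4, ae_mono (Measure.restrict_mono (hsub s h3) le_rfl)
    (Lp.coeFn_add (p s) (q s))] with x h5 h6 h7 h8
  rw [h7, Pi.add_apply, Pi.add_apply, h8, Pi.add_apply, h5, h6]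

theorem IsTrace.smul (hO : ∀ t ∈ Ioo 0 T, IsOpen (O t)) (hR : MeasurableSet (controlRegion T O))
    (hsub : ∀ t ∈ Ioo 0 T, O t ⊆ (Ω : Set (EuclideanSpace ℝ (Fin d)))) (c : ℝ)
    {p : ℝ → L2 Ω} {P : Lp ℝ 2 (volume.restrict (controlRegion T O))}
    (hp : IsTrace T O p P) : IsTrace T O (c • p) (c • P : Lp ℝ 2 _) := by
  filter_upwards [hp, ae_mem_Ioo_of_Ioc,
    ae_ae_of_ae_controlRegion hO hR (Lp.coeFn_smul c P)] with s h1 h3 h4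
  filter_upwards [h1, h4, ae_mono (Measure.restrict_mono (hsub s h3) le_rfl)
    (Lp.coeFn_smul c (p s))] with x h5 h7 h8
  rw [h7, Pi.smul_apply, Pi.smul_apply, h8, Pi.smul_apply, h5]

end Region

/-! ### The fundamental theorem of calculus on a closed interval -/

section Calculus

variable {E : Type*} [NormedAddCommGroup E] [NormedSpace ℝ E] [CompleteSpace E] {T : ℝ}

theorem hasDerivWithinAt_of_eq_integral (hT : 0 ≤ T) {g z : ℝ → E} (hz : ContinuousOn z (Icc 0 T))
    (hg : ∀ t ∈ Icc 0 T, g t = g 0 + ∫ s in 0..t, z s) {t : ℝ} (ht : t ∈ Icc 0 T) :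
    HasDerivWithinAt g (z t) (Icc 0 T) t := by
  set ζ : ℝ → E := IccExtend hT (fun s : Icc 0 T => z s) with hζ
  have hζc : Continuous ζ := (continuousOn_iff_continuous_domRestrict.1 hz).Icc_extend'
  have hζe : ∀ s ∈ Icc 0 T, ζ s = z s := fun s hs => IccExtend_of_mem hT _ hs
  have h1 : HasDerivAt (fun t => g 0 + ∫ s in 0..t, ζ s) (ζ t) t :=
    (intervalIntegral.integral_hasDerivAt_right (hζc.intervalIntegrable _ _)
      (hζc.stronglyMeasurableAtFilter _ _) hζc.continuousAt).const_add _
  rw [← hζe t ht]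
  refine h1.hasDerivWithinAt.congr_of_mem (fun r hr => ?_) ht
  rw [hg r hr]
  congr 1
  refine intervalIntegral.integral_congr fun s hs => ?_
  rw [uIcc_of_le hr.1] at hs
  exact (hζe s ⟨hs.1, hs.2.trans hr.2⟩).symm

theorem eq_integral_of_hasDerivWithinAt {g z : ℝ → E} (hz : ContinuousOn z (Icc 0 T))
    (hg : ∀ t ∈ Icc 0 T, HasDerivWithinAt g (z t) (Icc 0 T) t) {t : ℝ} (ht : t ∈ Icc 0 T) :
    g t = g 0 + ∫ s in 0..t, z s := by
  have hsub : Icc 0 t ⊆ Icc 0 T := Icc_subset_Icc_right ht.2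
  rw [intervalIntegral.integral_eq_sub_of_hasDerivAt_of_le ht.1
    (fun s hs => (hg s (hsub hs)).continuousWithinAt.mono hsub)
    (fun s hs => (hg s (hsub (Ioo_subset_Icc_self hs))).hasDerivAt
      (Icc_mem_nhds hs.1 (hs.2.trans_le ht.2)))
    (ContinuousOn.intervalIntegrable (hz.mono (by rwa [uIcc_of_le ht.1])))]
  abel

end Calculus

/-! ### Solutions by transposition of the abstract backward equation -/

section Transposition

variable {W H : Type*} [NormedAddCommGroup W] [InnerProductSpace ℝ W] [NormedAddCommGroup H]
  [InnerProductSpace ℝ H] {T : ℝ} {M : ℝ → ℝ → ℝ}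

/-- The map `H → W'` dual to `ι : W → H`, with `H` as pivot space. -/
def pivot (ι : W →L[ℝ] H) : H →L[ℝ] StrongDual ℝ W :=
  LinearMap.mkContinuous
    { toFun := fun f => (innerSL ℝ f).comp ι
      map_add' := fun f g => by ext v; simp
      map_smul' := fun c f => by ext v; simp } ‖ι‖
    fun f => by
      refine ((innerSL ℝ f).opNorm_comp_le ι).trans_eq ?_
      rw [innerSL_apply_norm, mul_comm]

theorem pivot_apply (ι : W →L[ℝ] H) (f : H) (v : W) : pivot ι f v = ⟪f, ι v⟫_ℝ := rfl

/-- Solutions by transposition of the backward equation with memory, for the operator `A` on `H`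
given by the form `⟪v, w⟫ - ⟪ι v, ι w⟫` on `W`. -/
structure IsTransposedSolution (ι : W →L[ℝ] H) (T : ℝ) (M : ℝ → ℝ → ℝ) (p₀ : H)
    (p₁ : StrongDual ℝ W) (q₀ : H) (p : ℝ → H) (p' : ℝ → StrongDual ℝ W) : Prop where
  continuousOn : ContinuousOn p (Icc 0 T)
  continuousOn_deriv : ContinuousOn p' (Icc 0 T)
  hasDeriv : ∀ t ∈ Icc 0 T, HasDerivWithinAt (fun s => pivot ι (p s)) (p' t) (Icc 0 T) t
  final : p T = p₀
  final_deriv : p' T = p₁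
  weak_eq : ∀ (v : W) (g : H), (∀ w, ⟪v, w⟫_ℝ - ⟪ι v, ι w⟫_ℝ = -⟪g, ι w⟫_ℝ) → ∀ t ∈ Icc 0 T,
    p₁ v - p' t v + ∫ s in t..T, (-⟪p s, g⟫_ℝ + ⟪∫ r in s..T, M r s • p r, ι v⟫_ℝ
        + M T s * ⟪q₀, ι v⟫_ℝ) = 0

namespace IsTransposedSolution

variable {ι : W →L[ℝ] H}

theorem intervalIntegrable_kernel (hM : ContinuousOn (Function.uncurry M) (Icc 0 T ×ˢ Icc 0 T))
    {p : ℝ → H} (hp : ContinuousOn p (Icc 0 T)) {s : ℝ} (hs : s ∈ Icc 0 T) :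
    IntervalIntegrable (fun r => M r s • p r) volume s T := by
  have hsub : uIcc s T ⊆ Icc 0 T := uIcc_subset_Icc hs ⟨hs.1.trans hs.2, le_rfl⟩
  refine ContinuousOn.intervalIntegrable (ContinuousOn.mono ?_ hsub)
  exact (hM.comp (f := fun r => (r, s)) (by fun_prop) fun r hr => ⟨hr, hs⟩).smul hp

theorem smul {p₀ : H} {p₁ : StrongDual ℝ W} {q₀ : H} {p : ℝ → H} {p' : ℝ → StrongDual ℝ W} (c : ℝ)
    (hp : IsTransposedSolution ι T M p₀ p₁ q₀ p p') :
    IsTransposedSolution ι T M (c • p₀) (c • p₁) (c • q₀) (c • p) (c • p') where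
  continuousOn := hp.continuousOn.const_smul c
  continuousOn_deriv := hp.continuousOn_deriv.const_smul c
  hasDeriv t ht := by
    simpa only [Pi.smul_apply, map_smul] using (hp.hasDeriv t ht).fun_const_smul c
  final := by rw [Pi.smul_apply, hp.final]
  final_deriv := by rw [Pi.smul_apply, hp.final_deriv]
  weak_eq v g hg t ht := by
    have h1 := hp.weak_eq v g hg t ht
    have e2 : ∫ s in t..T, (-⟪(c • p) s, g⟫_ℝ + ⟪∫ a in s..T, M a s • (c • p) a, ι v⟫_ℝ
        + M T s * ⟪c • q₀, ι v⟫_ℝ) = c * ∫ s in t..T,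
        (-⟪p s, g⟫_ℝ + ⟪∫ a in s..T, M a s • p a, ι v⟫_ℝ + M T s * ⟪q₀, ι v⟫_ℝ) := by
      rw [← intervalIntegral.integral_const_mul]
      refine intervalIntegral.integral_congr fun s _ => ?_
      simp only [Pi.smul_apply, smul_comm _ c, intervalIntegral.integral_smul,
        real_inner_smul_left]
      ring
    rw [e2]
    simp only [Pi.smul_apply, smul_apply, smul_eq_mul]
    linear_combination c * h1

theorem intervalIntegrable_weak (hT : 0 ≤ T)
    (hM : ContinuousOn (Function.uncurry M) (Icc 0 T ×ˢ Icc 0 T))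
    {p : ℝ → H} (hp : ContinuousOn p (Icc 0 T)) (g w q₀ : H) {t : ℝ} (ht : t ∈ Icc 0 T) :
    IntervalIntegrable (fun s => -⟪p s, g⟫_ℝ + ⟪∫ r in s..T, M r s • p r, w⟫_ℝ
        + M T s * ⟪q₀, w⟫_ℝ) volume t T := by
  have hsub : uIcc t T ⊆ Icc 0 T := uIcc_subset_Icc ht ⟨hT, le_rfl⟩
  have hMT : ContinuousOn (fun s => M T s) (Icc 0 T) :=
    hM.comp (f := fun s => (T, s)) (by fun_prop) fun s hs => ⟨⟨hT, le_rfl⟩, hs⟩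
  exact ContinuousOn.intervalIntegrable (ContinuousOn.mono
    (((hp.inner continuousOn_const).neg.add
      ((continuousOn_integral_kernel_right hT hM hp).inner continuousOn_const)).add
        (hMT.mul continuousOn_const)) hsub)

theorem add (hT : 0 ≤ T) (hM : ContinuousOn (Function.uncurry M) (Icc 0 T ×ˢ Icc 0 T))
    {p₀ r₀ : H} {p₁ r₁ : StrongDual ℝ W} {q₀ w₀ : H} {p r : ℝ → H} {p' r' : ℝ → StrongDual ℝ W}
    (hp : IsTransposedSolution ι T M p₀ p₁ q₀ p p')
    (hr : IsTransposedSolution ι T M r₀ r₁ w₀ r r') :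
    IsTransposedSolution ι T M (p₀ + r₀) (p₁ + r₁) (q₀ + w₀) (p + r) (p' + r') where
  continuousOn := hp.continuousOn.add hr.continuousOn
  continuousOn_deriv := hp.continuousOn_deriv.add hr.continuousOn_deriv
  hasDeriv t ht := by
    simpa only [Pi.add_apply, map_add] using (hp.hasDeriv t ht).fun_add (hr.hasDeriv t ht)
  final := by rw [Pi.add_apply, hp.final, hr.final]
  final_deriv := by rw [Pi.add_apply, hp.final_deriv, hr.final_deriv]
  weak_eq v g hg t ht := by
    have h1 := hp.weak_eq v g hg t ht
    have h2 := hr.weak_eq v g hg t ht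
    have e := intervalIntegral.integral_add
      (intervalIntegrable_weak hT hM hp.continuousOn g (ι v) q₀ ht)
      (intervalIntegrable_weak hT hM hr.continuousOn g (ι v) w₀ ht)
    have e2 : ∫ s in t..T, (-⟪(p + r) s, g⟫_ℝ + ⟪∫ a in s..T, M a s • (p + r) a, ι v⟫_ℝ
        + M T s * ⟪q₀ + w₀, ι v⟫_ℝ) = ∫ s in t..T,
        ((-⟪p s, g⟫_ℝ + ⟪∫ a in s..T, M a s • p a, ι v⟫_ℝ + M T s * ⟪q₀, ι v⟫_ℝ) +
        (-⟪r s, g⟫_ℝ + ⟪∫ a in s..T, M a s • r a, ι v⟫_ℝ + M T s * ⟪w₀, ι v⟫_ℝ)) := by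
      refine intervalIntegral.integral_congr fun s hs => ?_
      have hs' : s ∈ Icc 0 T := uIcc_subset_Icc ht ⟨hT, le_rfl⟩ hs
      simp only [Pi.add_apply, smul_add, inner_add_left]
      rw [intervalIntegral.integral_add (intervalIntegrable_kernel hM hp.continuousOn hs')
        (intervalIntegrable_kernel hM hr.continuousOn hs'), inner_add_left]
      ring
    rw [e2, e]
    simp only [Pi.add_apply, add_apply]
    linarith

variable [CompleteSpace W] [CompleteSpace H]

theorem duality (hι : IsDenseEmbedding ι) (hT : 0 ≤ T)
    (hM : ContinuousOn (Function.uncurry M) (Icc 0 T ×ˢ Icc 0 T)) {f z : ℝ → H} {y : ℝ → W}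
    (hf : IntervalIntegrable f volume 0 T) (hy : ContinuousOn y (Icc 0 T))
    (hz : ContinuousOn z (Icc 0 T))
    (hyz : ∀ t ∈ Icc 0 T, HasDerivWithinAt (fun s => ι (y s)) (z t) (Icc 0 T) t)
    (hyw : ∀ v, ∀ t ∈ Icc 0 T, ⟪z t, ι v⟫_ℝ - ⟪z 0, ι v⟫_ℝ +
        ∫ s in 0..t, (⟪y s, v⟫_ℝ - ⟪ι (y s), ι v⟫_ℝ + ⟪∫ r in 0..s, M s r • ι (y r), ι v⟫_ℝ) =
        ∫ s in 0..t, ⟪f s, ι v⟫_ℝ)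
    {p₀ : H} {p₁ : StrongDual ℝ W} {q₀ : H} {p : ℝ → H} {p' : ℝ → StrongDual ℝ W}
    (hp : IsTransposedSolution ι T M p₀ p₁ q₀ p p') :
    ⟪z T, p₀⟫_ℝ - p₁ (y T) - ⟪∫ s in 0..T, M T s • ι (y s), q₀⟫_ℝ =
      ⟪z 0, p 0⟫_ℝ - p' 0 (y 0) + ∫ s in 0..T, ⟪f s, p s⟫_ℝ := by
  set J := (InnerProductSpace.toDual ℝ W).symm with hJ
  have hJi : ∀ (q : StrongDual ℝ W) v, ⟪J q, v⟫_ℝ = q v := fun q v =>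
    InnerProductSpace.toDual_symm_apply
  have key := wave_duality hι hT hM (f := f) (z := z) (p := p)
    (y := y) (π := fun t => J (p' t)) (q₀ := q₀) hf hy hz
    (fun t ht => eq_integral_of_hasDerivWithinAt (g := fun t => ι (y t)) hz hyz ht) hyw
    hp.continuousOn (J.continuous.comp_continuousOn hp.continuousOn_deriv)
    (fun v t ht => by
      simp only [hJi]
      refine eq_integral_of_hasDerivWithinAt (g := fun t => ⟪p t, ι v⟫_ℝ)
        (z := fun t => p' t v) (hp.continuousOn_deriv.clm_apply continuousOn_const) ?_ ht
      intro s hs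
      have := (hp.hasDeriv s hs).clm_apply (hasDerivWithinAt_const s (Icc 0 T) v)
      simpa [pivot_apply] using this)
    (fun k t ht => by
      simp only [hJi]
      -- The vectors ι†k solve the elliptic problem for 1 − Δ with right-hand side k, so they are
      -- admissible test functions with Laplacian ιι†k − k, without any regularity theory.
      have h := hp.weak_eq (ContinuousLinearMap.adjoint ι k)
        (ι (ContinuousLinearMap.adjoint ι k) - k) (fun w => by
          rw [inner_sub_left, ContinuousLinearMap.adjoint_inner_left]
          ring) t ht
      rwa [hp.final_deriv])
  simpa only [hJi, hp.final, hp.final_deriv] using key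

/-- The backward equation is solvable for final data of finite energy. -/
theorem exists_of_mem (hι : IsDenseEmbedding ι) (hT : 0 ≤ T)
    (hM : ContinuousOn (Function.uncurry M) (Icc 0 T ×ˢ Icc 0 T)) (p₀ : W) (p₁ q₀ : H) :
    ∃ p p', IsTransposedSolution ι T M (ι p₀) (pivot ι p₁) q₀ p p' := by
  have hrev : ∀ t ∈ Icc 0 T, T - t ∈ Icc 0 T := fun t ht => ⟨by linarith [ht.2], by linarith [ht.1]⟩
  have hTm : T ∈ Icc 0 T := ⟨hT, le_rfl⟩
  have hMT : ContinuousOn (fun s => M T s) (Icc 0 T) :=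
    hM.comp (f := fun s => (T, s)) (by fun_prop) fun s hs => ⟨hTm, hs⟩
  have hf : IntervalIntegrable (fun s => -(M T (T - s) • q₀)) volume 0 T := by
    refine ContinuousOn.intervalIntegrable ?_
    rw [uIcc_of_le hT]
    exact ((hMT.comp (f := fun s => T - s) (by fun_prop) hrev).smul continuousOn_const).neg
  have hMr : ContinuousOn (Function.uncurry fun s r => M (T - r) (T - s)) (Icc 0 T ×ˢ Icc 0 T) :=
    hM.comp (f := fun w : ℝ × ℝ => (T - w.2, T - w.1)) (by fun_prop)
      fun w hw => ⟨hrev _ hw.2, hrev _ hw.1⟩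
  -- Reversing time t ↦ T − t turns the backward problem into the forward one with kernel M(T − r, T
  -- − s), velocity of opposite sign, and the q₀ term as forcing.
  obtain ⟨y, z, hy, hz, hy0, hz0, hyz, hw⟩ := exists_wave_solution hι hT hMr p₀ (-p₁) hf
  have hyr : ContinuousOn (fun t => y (T - t)) (Icc 0 T) := hy.comp (by fun_prop) hrev
  have hzr : ContinuousOn (fun t => z (T - t)) (Icc 0 T) := hz.comp (by fun_prop) hrev
  refine ⟨fun t => ι (y (T - t)), fun t => -pivot ι (z (T - t)), ?_, ?_, ?_, ?_, ?_, ?_⟩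
  · exact ι.continuous.comp_continuousOn hyr
  · exact ((pivot ι).continuous.comp_continuousOn hzr).neg
  · intro t ht
    have h1 := hasDerivWithinAt_of_eq_integral (g := fun t => ι (y t)) hT hz hyz (hrev t ht)
    have h2 : HasDerivWithinAt (fun s => T - s) (-1) (Icc 0 T) t :=
      ((hasDerivAt_id t).const_sub T).hasDerivWithinAt
    have h3 := (pivot ι).hasFDerivAt.comp_hasDerivWithinAt t (h1.scomp t h2 hrev)
    simpa [Function.comp_def] using h3
  · simp [hy0]
  · simp [hz0]
  · intro v g hg t ht
    have h := hw v (T - t) (hrev t ht)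
    have hLap : ∀ s, ⟪y s, v⟫_ℝ - ⟪ι (y s), ι v⟫_ℝ = -⟪ι (y s), g⟫_ℝ := by
      intro s
      rw [real_inner_comm, real_inner_comm (ι v), hg, real_inner_comm]
    have hmem : ∀ s, ∫ r in s..T, M r s • ι (y (T - r)) =
        ∫ r in 0..(T - s), M (T - r) s • ι (y r) := by
      intro s
      have := intervalIntegral.integral_comp_sub_left
        (fun r => M (T - r) s • ι (y r)) (a := s) (b := T) T
      simpa using this
    have hwint : ∫ s in t..T, (-⟪ι (y (T - s)), g⟫_ℝ +
        ⟪∫ r in s..T, M r s • ι (y (T - r)), ι v⟫_ℝ + M T s * ⟪q₀, ι v⟫_ℝ) =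
        ∫ s in 0..(T - t), ((-⟪ι (y s), g⟫_ℝ +
          ⟪∫ r in 0..s, M (T - r) (T - s) • ι (y r), ι v⟫_ℝ) +
            M T (T - s) * ⟪q₀, ι v⟫_ℝ) := by
      have := intervalIntegral.integral_comp_sub_left (fun s => ((-⟪ι (y s), g⟫_ℝ +
          ⟪∫ r in 0..s, M (T - r) (T - s) • ι (y r), ι v⟫_ℝ) +
            M T (T - s) * ⟪q₀, ι v⟫_ℝ)) (a := t) (b := T) T
      simp only [sub_sub_cancel, sub_self] at this
      rw [← this]
      simp only [hmem]
    have hsub : uIcc 0 (T - t) ⊆ Icc 0 T := uIcc_subset_Icc ⟨le_rfl, hT⟩ (hrev t ht)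
    have hιy : ContinuousOn (fun s => ι (y s)) (Icc 0 T) :=
      ι.continuous.comp_continuousOn hy
    have hmc : ContinuousOn (fun s => ∫ r in 0..s, M (T - r) (T - s) • ι (y r)) (Icc 0 T) :=
      continuousOn_integral_kernel hT hMr hιy ⟨le_rfl, hT⟩
    simp only [hLap, inner_neg_left, real_inner_smul_left, intervalIntegral.integral_neg] at h
    rw [hwint, intervalIntegral.integral_add]
    · simp only [neg_apply, pivot_apply]
      linarith
    · exact ContinuousOn.intervalIntegrable (ContinuousOn.mono
        ((hιy.inner continuousOn_const).neg.add (hmc.inner continuousOn_const)) hsub)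
    · exact ContinuousOn.intervalIntegrable (ContinuousOn.mono
        ((hMT.comp (f := fun s => T - s) (by fun_prop) hrev).mul continuousOn_const) hsub)

end IsTransposedSolution

end Transposition

/-! ### Functional analysis of the equivalence -/

section Duality

/-- A linear functional dominated by `‖a x‖` is represented by a vector through `a`. -/
theorem exists_inner_eq_of_abs_le {E R : Type*} [AddCommGroup E] [Module ℝ E]
    [NormedAddCommGroup R] [InnerProductSpace ℝ R] [CompleteSpace R] (a : E →ₗ[ℝ] R)
    (l : E →ₗ[ℝ] ℝ) {B : ℝ} (h : ∀ x, |l x| ≤ B * ‖a x‖) : ∃ U : R, ∀ x, l x = ⟪U, a x⟫_ℝ := by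
  -- The bound makes l vanish where a does, so l descends to a bounded functional on the range of a,
  -- even though E carries no topology; Hahn–Banach and Riesz finish.
  have hker : LinearMap.ker a.rangeRestrict ≤ LinearMap.ker l := by
    intro x hx
    rw [LinearMap.ker_rangeRestrict, LinearMap.mem_ker] at hx
    have := h x
    rw [hx, norm_zero, mul_zero] at this
    exact abs_nonpos_iff.1 this
  obtain ⟨s, hs⟩ := a.rangeRestrict.exists_rightInverse_of_surjective a.range_rangeRestrict
  have hls : ∀ x, l (s (a.rangeRestrict x)) = l x := by
    intro x
    rw [← sub_eq_zero, ← map_sub]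
    refine hker ?_
    have := LinearMap.congr_fun hs (a.rangeRestrict x)
    rw [LinearMap.mem_ker, map_sub, sub_eq_zero]
    exact this
  let φ : StrongDual ℝ (LinearMap.range a) := (l ∘ₗ s).mkContinuous B (by
    rintro ⟨_, x, rfl⟩
    exact (congrArg abs (hls x)).trans_le (h x))
  obtain ⟨ψ, hψ, -⟩ := exists_extension_norm_eq (LinearMap.range a) φ
  refine ⟨(InnerProductSpace.toDual ℝ R).symm ψ, fun x => ?_⟩
  rw [InnerProductSpace.toDual_symm_apply]
  exact ((hψ (a.rangeRestrict x)).trans (hls x)).symm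

/-- A family of functionals on a product that is pointwise dominated by a nonnegative,
homogeneous quantity is uniformly dominated by it. -/
theorem exists_uniform_bound {V W S : Type*} [SeminormedAddCommGroup V]
    [NormedSpace ℝ V] [CompleteSpace V] [SeminormedAddCommGroup W] [NormedSpace ℝ W]
    [CompleteSpace W]
    (α : S → StrongDual ℝ W) (β : S → StrongDual ℝ V) (n : S → ℝ) (hn : ∀ i, 0 ≤ n i)
    (h : ∀ v w, ∃ B, ∀ i, |α i w - β i v| ≤ B * n i) :
    ∃ C : ℝ, 0 < C ∧ ∀ i, ‖α i‖ ^ 2 + ‖β i‖ ^ 2 ≤ C * n i ^ 2 := by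
  let ℓ : S → StrongDual ℝ (V × W) := fun i =>
    (α i).comp (ContinuousLinearMap.snd ℝ V W) - (β i).comp (ContinuousLinearMap.fst ℝ V W)
  have hℓ : ∀ i x, ℓ i x = α i x.2 - β i x.1 := fun i x => rfl
  -- The index also ranges over scalars c ≥ 0 with c·n(i) ≤ 1. This normalises the functionals by
  -- n(i) and, when n(i) = 0, admits arbitrarily large multiples.
  obtain ⟨C, hC⟩ := banach_steinhaus
    (g := fun j : {j : S × ℝ // 0 ≤ j.2 ∧ j.2 * n j.1 ≤ 1} => j.1.2 • ℓ j.1.1) (by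
      rintro ⟨v, w⟩
      obtain ⟨B, hB⟩ := h v w
      refine ⟨|B|, fun ⟨⟨i, c⟩, hc, hc1⟩ => ?_⟩
      simp only at hc hc1
      rw [smul_apply, hℓ, smul_eq_mul, Real.norm_eq_abs, abs_mul, abs_of_nonneg hc]
      calc c * |α i w - β i v| ≤ c * (|B| * n i) :=
            mul_le_mul_of_nonneg_left ((hB i).trans
              (mul_le_mul_of_nonneg_right (le_abs_self B) (hn i))) hc
        _ = |B| * (c * n i) := by ring
        _ ≤ |B| := mul_le_of_le_one_right (abs_nonneg B) hc1)
  have key : ∀ i, ‖ℓ i‖ ≤ |C| * n i := by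
    intro i
    rcases (hn i).eq_or_lt with h0 | hpos
    · by_contra! hlt
      rw [← h0, mul_zero] at hlt
      -- If n(i) = 0 and ℓᵢ ≠ 0, this multiple of ℓᵢ has norm |C| + 1, above the uniform bound.
      have := hC ⟨(i, (|C| + 1) / ‖ℓ i‖), by positivity, by rw [← h0]; simp⟩
      simp only [norm_smul, Real.norm_eq_abs] at this
      rw [abs_of_nonneg (by positivity), div_mul_cancel₀ _ hlt.ne'] at this
      linarith [le_abs_self C]
    · have := hC ⟨(i, (n i)⁻¹), by positivity, by simp [inv_mul_cancel₀ hpos.ne']⟩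
      simp only [norm_smul, Real.norm_eq_abs] at this
      rw [abs_of_nonneg (by positivity), inv_mul_le_iff₀ hpos] at this
      rw [mul_comm]
      exact this.trans (mul_le_mul_of_nonneg_left (le_abs_self C) hpos.le)
  have hα : ∀ i, ‖α i‖ ≤ |C| * n i := fun i =>
    (α i).opNorm_le_bound (mul_nonneg (abs_nonneg C) (hn i)) fun w => by
      have := (ℓ i).le_of_opNorm_le (key i) (0, w)
      simpa [hℓ, Prod.norm_def] using this
  have hβ : ∀ i, ‖β i‖ ≤ |C| * n i := fun i =>
    (β i).opNorm_le_bound (mul_nonneg (abs_nonneg C) (hn i)) fun v => by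
      have := (ℓ i).le_of_opNorm_le (key i) (v, 0)
      simpa [hℓ, Prod.norm_def] using this
  refine ⟨2 * |C| ^ 2 + 1, by positivity, fun i => ?_⟩
  have h1 := pow_le_pow_left₀ (norm_nonneg _) (hα i) 2
  have h2 := pow_le_pow_left₀ (norm_nonneg _) (hβ i) 2
  rw [mul_pow] at h1 h2
  nlinarith [sq_nonneg (n i)]

theorem le_of_sq_add_sq_le {a b c : ℝ} (hc : 0 ≤ c) (h : a ^ 2 + b ^ 2 ≤ c ^ 2) : a ≤ c :=
  le_of_abs_le (abs_le_of_sq_le_sq (by linarith [sq_nonneg b]) hc)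

theorem abs_apply_sub_apply_le {V W : Type*} [SeminormedAddCommGroup V] [NormedSpace ℝ V]
    [SeminormedAddCommGroup W] [NormedSpace ℝ W] (α : StrongDual ℝ W) (β : StrongDual ℝ V)
    {C : ℝ} (n : ℝ) (hC : 0 ≤ C) (hn : 0 ≤ n) (h : ‖α‖ ^ 2 + ‖β‖ ^ 2 ≤ C * n ^ 2) (w : W) (v : V) :
    |α w - β v| ≤ √C * (‖w‖ + ‖v‖) * n := by
  rw [← Real.sq_sqrt hC, ← mul_pow] at h
  have hCn : 0 ≤ √C * n := by positivity
  have h1 := α.le_of_opNorm_le (le_of_sq_add_sq_le hCn h) w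
  have h2 := β.le_of_opNorm_le (le_of_sq_add_sq_le hCn ((add_comm _ _).trans_le h)) v
  rw [Real.norm_eq_abs] at h1 h2
  refine (abs_sub _ _).trans ?_
  linear_combination h1 + h2

variable {W H R : Type*} [NormedAddCommGroup W] [InnerProductSpace ℝ W] [NormedAddCommGroup H]
  [InnerProductSpace ℝ H] [NormedAddCommGroup R] [InnerProductSpace ℝ R]
  [CompleteSpace R] {T : ℝ} {M : ℝ → ℝ → ℝ} {ι : W →L[ℝ] H}

/-- If an observation `Tr` bounds `⟪y₁, p 0⟫ - p' 0 y₀` for all backward solutions, then it is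
minus the pairing of the observation with a fixed control. -/
theorem exists_control (hT : 0 ≤ T) (hM : ContinuousOn (Function.uncurry M) (Icc 0 T ×ˢ Icc 0 T))
    {Tr : (ℝ → H) → R → Prop} (h0 : Tr 0 0) (hadd : ∀ p q P Q, Tr p P → Tr q Q → Tr (p + q) (P + Q))
    (hsmul : ∀ (c : ℝ) p P, Tr p P → Tr (c • p) (c • P)) (y₀ : W) (y₁ : H) {B : ℝ}
    (hB : ∀ p₀ p₁ q₀ p p' P, IsTransposedSolution ι T M p₀ p₁ q₀ p p' → Tr p P →
      |⟪y₁, p 0⟫_ℝ - p' 0 y₀| ≤ B * ‖P‖) :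
    ∃ U : R, ∀ p₀ p₁ q₀ p p' P, IsTransposedSolution ι T M p₀ p₁ q₀ p p' → Tr p P →
      ⟪y₁, p 0⟫_ℝ - p' 0 y₀ + ⟪U, P⟫_ℝ = 0 := by
  -- Backward solutions together with an observation form a vector space, with the final data left
  -- existential. No solution operator has to be chosen.
  let S : Submodule ℝ ((ℝ → H) × (ℝ → StrongDual ℝ W) × R) :=
    { carrier := {x | (∃ p₀ p₁ q₀, IsTransposedSolution ι T M p₀ p₁ q₀ x.1 x.2.1) ∧ Tr x.1 x.2.2}
      add_mem' := by
        rintro _ _ ⟨⟨_, _, _, hx⟩, hx'⟩ ⟨⟨_, _, _, hy⟩, hy'⟩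
        exact ⟨⟨_, _, _, hx.add hT hM hy⟩, hadd _ _ _ _ hx' hy'⟩
      zero_mem' := by
        refine ⟨⟨0, 0, 0, continuousOn_const, continuousOn_const, fun t _ => ?_, rfl, rfl,
          fun v g _ t _ => ?_⟩, h0⟩
        · simpa using hasDerivWithinAt_const t (Icc 0 T) (0 : StrongDual ℝ W)
        · simp
      smul_mem' := by
        rintro c x ⟨⟨_, _, _, hx⟩, hx'⟩
        exact ⟨⟨_, _, _, hx.smul c⟩, hsmul _ _ _ hx'⟩ }
  let a : S →ₗ[ℝ] R := LinearMap.snd ℝ _ _ ∘ₗ LinearMap.snd ℝ _ _ ∘ₗ S.subtype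
  let l : S →ₗ[ℝ] ℝ :=
    { toFun := fun x => -(⟪y₁, x.1.1 0⟫_ℝ - x.1.2.1 0 y₀)
      map_add' := fun x y => by
        simp only [Submodule.coe_add, Prod.fst_add, Prod.snd_add, Pi.add_apply, inner_add_right,
          add_apply]
        ring
      map_smul' := fun c x => by
        simp only [Submodule.coe_smul, Prod.smul_fst, Prod.smul_snd, Pi.smul_apply,
          real_inner_smul_right, smul_apply, smul_eq_mul, RingHom.id_apply]
        ring }
  have hle : ∀ x, |l x| ≤ B * ‖a x‖ := by
    rintro ⟨x, ⟨_, _, _, hx⟩, hx'⟩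
    refine (abs_neg _).trans_le ?_
    exact hB _ _ _ _ _ _ hx hx'
  obtain ⟨U, hU⟩ := exists_inner_eq_of_abs_le (E := S) (R := R) a l hle
  refine ⟨U, fun p₀ p₁ q₀ p p' P hp hP => ?_⟩
  have := hU ⟨(p, p', P), ⟨_, _, _, hp⟩, hP⟩
  change -(⟪y₁, p 0⟫_ℝ - p' 0 y₀) = ⟪U, P⟫_ℝ at this
  linarith

theorem pairing_eq_zero {w : W} {z m : H} (hw : w = 0) (hz : z = 0) (hm : m = 0) (p₀ : H)
    (p₁ : StrongDual ℝ W) (q₀ : H) : ⟪z, p₀⟫_ℝ - p₁ w - ⟪m, q₀⟫_ℝ = 0 := by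
  simp [hw, hz, hm]

variable [CompleteSpace W] [CompleteSpace H]

/-- Vanishing of the duality pairing against all backward solutions of finite energy. -/
theorem eq_zero_of_duality (hι : IsDenseEmbedding ι) (hT : 0 ≤ T)
    (hM : ContinuousOn (Function.uncurry M) (Icc 0 T ×ˢ Icc 0 T)) {w : W} {z m : H}
    (h : ∀ p₀ p₁ q₀ p p', IsTransposedSolution ι T M p₀ p₁ q₀ p p' →
      ⟪z, p₀⟫_ℝ - p₁ w - ⟪m, q₀⟫_ℝ = 0) : w = 0 ∧ z = 0 ∧ m = 0 := by
  -- Only finite-energy data are used, where the backward equation is known to be solvable. The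
  -- choices (v, 0, 0), (0, ιw, 0) and (0, 0, m) isolate the three quantities.
  have h' : ∀ (p₀ : W) (p₁ q₀ : H), ⟪z, ι p₀⟫_ℝ - ⟪p₁, ι w⟫_ℝ - ⟪m, q₀⟫_ℝ = 0 := by
    intro p₀ p₁ q₀
    obtain ⟨p, p', hp⟩ := IsTransposedSolution.exists_of_mem hι hT hM p₀ p₁ q₀
    exact h _ _ _ _ _ hp
  refine ⟨?_, hι.denseRange.eq_zero_of_inner_left ℝ fun v => by simpa using h' v 0 0, ?_⟩
  · have := h' 0 (ι w) 0
    simp only [map_zero, inner_zero_right, zero_sub, sub_zero, neg_eq_zero] at this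
    exact (map_eq_zero_iff ι hι.injective).1 (inner_self_eq_zero.1 this)
  · simpa using h' 0 0 m

end Duality

/-! ### Application to H¹₀(Ω) and L²(Ω), and the two implications -/

section Concrete

variable {d : ℕ} {Ω : Opens (EuclideanSpace ℝ (Fin d))} {T : ℝ} {M : ℝ → ℝ → ℝ}
  {O : ℝ → Set (EuclideanSpace ℝ (Fin d))}

theorem isDenseEmbedding_toL2 : IsDenseEmbedding (W := H10 Ω) (H := L2 Ω) toL2 :=
  ⟨toL2_injective, denseRange_toL2⟩

theorem grad_inner_eq (u v : H10 Ω) :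
    ⟪grad u, grad v⟫_ℝ = ⟪u, v⟫_ℝ - ⟪toL2 u, toL2 v⟫_ℝ := by
  rw [inner_H10]; ring

theorem hasDirichletLaplacian_iff (v : H10 Ω) (g : L2 Ω) : HasDirichletLaplacian v g ↔
    ∀ w, ⟪v, w⟫_ℝ - ⟪toL2 v, toL2 w⟫_ℝ = -⟪g, toL2 w⟫_ℝ := by
  simp only [HasDirichletLaplacian, grad_inner_eq]

theorem isAdjointSolution_iff {p₀ : L2 Ω} {p₁ : Hneg1 Ω} {q₀ : L2 Ω} {p : ℝ → L2 Ω}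
    {p' : ℝ → Hneg1 Ω} : IsAdjointSolution Ω T M p₀ p₁ q₀ p p' ↔
      IsTransposedSolution (W := H10 Ω) (H := L2 Ω) toL2 T M p₀ p₁ q₀ p p' :=
  ⟨fun h => ⟨h.continuousOn, h.continuousOn_deriv, h.hasDeriv, h.final, h.final_deriv,
    fun v g hg => h.weak_eq v g ((hasDirichletLaplacian_iff v g).2 hg)⟩,
  fun h => ⟨h.continuousOn, h.continuousOn_deriv, h.hasDeriv, h.final, h.final_deriv,
    fun v g hg => h.weak_eq v g ((hasDirichletLaplacian_iff v g).1 hg)⟩⟩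

/-- A forcing term `f` that represents the control `u` can be replaced by it under the time integral. -/
theorem integral_forcing {f : ℝ → L2 Ω} {u : ℝ × EuclideanSpace ℝ (Fin d) → ℝ}
    (hfu : ∀ᵐ s ∂(volume.restrict (Ioc 0 T)),
      ∀ g : L2 Ω, ⟪f s, g⟫_ℝ = ∫ x in O s, u (s, x) * g x) (g : ℝ → L2 Ω) {t : ℝ}
    (ht : t ∈ Icc 0 T) :
    ∫ s in 0..t, ⟪f s, g s⟫_ℝ = ∫ s in 0..t, ∫ x in O s, u (s, x) * g s x := by
  rw [intervalIntegral.integral_of_le ht.1, intervalIntegral.integral_of_le ht.1]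
  refine integral_congr_ae ?_
  filter_upwards [ae_mono (Measure.restrict_mono (Ioc_subset_Ioc_right ht.2) le_rfl) hfu]
    with s hs
  exact hs _

/-- The duality between the controlled system and the adjoint system. -/
theorem IsMemoryWaveSolution.duality (hT : 0 ≤ T)
    (hM : ContinuousOn (Function.uncurry M) (Icc 0 T ×ˢ Icc 0 T)) {y₀ : H10 Ω} {y₁ : L2 Ω}
    {f : ℝ → L2 Ω} {u : ℝ × EuclideanSpace ℝ (Fin d) → ℝ} (hf : IntegrableOn f (Ioc 0 T))
    (hfu : ∀ᵐ s ∂(volume.restrict (Ioc 0 T)),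
      ∀ g : L2 Ω, ⟪f s, g⟫_ℝ = ∫ x in O s, u (s, x) * g x)
    {y : ℝ → H10 Ω} {z : ℝ → L2 Ω} (hy : IsMemoryWaveSolution Ω T M O y₀ y₁ u y z)
    {p₀ : L2 Ω} {p₁ : Hneg1 Ω} {q₀ : L2 Ω} {p : ℝ → L2 Ω} {p' : ℝ → Hneg1 Ω}
    (hp : IsTransposedSolution (W := H10 Ω) (H := L2 Ω) toL2 T M p₀ p₁ q₀ p p') :
    ⟪z T, p₀⟫_ℝ - p₁ (y T) - ⟪∫ s in 0..T, M T s • toL2 (y s), q₀⟫_ℝ =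
      ⟪y₁, p 0⟫_ℝ - p' 0 y₀ + ∫ s in 0..T, ∫ x in O s, u (s, x) * p s x := by
  have hι := isDenseEmbedding_toL2 (Ω := Ω)
  have hyw : ∀ v, ∀ t ∈ Icc 0 T, ⟪z t, toL2 v⟫_ℝ - ⟪z 0, toL2 v⟫_ℝ +
      ∫ s in 0..t, (⟪y s, v⟫_ℝ - ⟪toL2 (y s), toL2 v⟫_ℝ +
        ⟪∫ r in 0..s, M s r • toL2 (y r), toL2 v⟫_ℝ) = ∫ s in 0..t, ⟪f s, toL2 v⟫_ℝ := by
    intro v t ht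
    simp only [← grad_inner_eq]
    rw [hy.init_deriv, hy.weak_eq v t ht, integral_forcing hfu _ ht]
  rw [hp.duality hι hT hM
    ((intervalIntegrable_iff_integrableOn_Ioc_of_le hT).2 hf) hy.continuousOn
    hy.continuousOn_deriv hy.hasDeriv hyw, hy.init, hy.init_deriv,
    integral_forcing hfu _ ⟨hT, le_rfl⟩]

/-- The controlled system is solvable. -/
theorem exists_isMemoryWaveSolution (hT : 0 ≤ T)
    (hM : ContinuousOn (Function.uncurry M) (Icc 0 T ×ˢ Icc 0 T)) {f : ℝ → L2 Ω}
    {u : ℝ × EuclideanSpace ℝ (Fin d) → ℝ} (hf : IntegrableOn f (Ioc 0 T))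
    (hfu : ∀ᵐ s ∂(volume.restrict (Ioc 0 T)),
      ∀ g : L2 Ω, ⟪f s, g⟫_ℝ = ∫ x in O s, u (s, x) * g x) (y₀ : H10 Ω) (y₁ : L2 Ω) :
    ∃ y z, IsMemoryWaveSolution Ω T M O y₀ y₁ u y z := by
  have hι := isDenseEmbedding_toL2 (Ω := Ω)
  obtain ⟨y, z, hy, hz, hy0, hz0, hyz, hw⟩ := exists_wave_solution
    (W := H10 Ω) (H := L2 Ω) hι hT hM y₀ y₁
    ((intervalIntegrable_iff_integrableOn_Ioc_of_le hT).2 hf)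
  refine ⟨y, z, hy, hz, fun t ht => hasDerivWithinAt_of_eq_integral hT hz hyz ht, hy0, hz0,
    fun v t ht => ?_⟩
  simp only [grad_inner_eq]
  rw [hw v t ht, integral_forcing hfu _ ht]

theorem inner_isTrace_of_ae_eq (hT : 0 ≤ T) (hO : ∀ t ∈ Ioo 0 T, IsOpen (O t))
    (hR : MeasurableSet (controlRegion T O)) {u : ℝ × EuclideanSpace ℝ (Fin d) → ℝ}
    {U : Lp ℝ 2 (volume.restrict (controlRegion T O))}
    (hU : U =ᵐ[volume.restrict (controlRegion T O)] u)
    {p : ℝ → L2 Ω} {P : Lp ℝ 2 (volume.restrict (controlRegion T O))} (h : IsTrace T O p P) :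
    ⟪U, P⟫_ℝ = ∫ s in 0..T, ∫ x in O s, u (s, x) * p s x := by
  rw [inner_isTrace hT hO hR U h, intervalIntegral.integral_of_le hT,
    intervalIntegral.integral_of_le hT]
  refine integral_congr_ae ?_
  filter_upwards [ae_ae_of_ae_controlRegion hO hR hU] with s hs
  refine integral_congr_ae ?_
  filter_upwards [hs] with x hx
  rw [hx]

/-- For a control reaching the target the terminal side of the duality identity vanishes, so the
initial pairing is −⟪U, P⟫, and Cauchy–Schwarz gives the constant ‖U‖, which depends only on the
initial data. -/
theorem MemoryNullControllable.exists_bound (hT : 0 ≤ T)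
    (hM : ContinuousOn (Function.uncurry M) (Icc 0 T ×ˢ Icc 0 T))
    (hO : ∀ t ∈ Ioo 0 T, IsOpen (O t) ∧ O t ⊆ (Ω : Set (EuclideanSpace ℝ (Fin d))))
    (hR : MeasurableSet (controlRegion T O)) (h : MemoryNullControllable Ω T M O) (y₀ : V Ω)
    (y₁ : H10 Ω) :
    ∃ B, ∀ p₀ p₁ q₀ p p' (P : Lp ℝ 2 (volume.restrict (controlRegion T O))),
      IsAdjointSolution Ω T M p₀ p₁ q₀ p p' → IsTrace T O p P →
        |toHneg1 (p 0) y₁ - toVdual (p' 0) y₀| ≤ B * ‖P‖ := by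
  have hO' : ∀ t ∈ Ioo 0 T, IsOpen (O t) := fun t ht => (hO t ht).1
  obtain ⟨u, hu, y, z, hy, hyT, hzT, hmT⟩ := h y₀ y₁
  obtain ⟨f, hf, hfu⟩ := exists_forcing hO hR hu
  obtain ⟨U, hU⟩ : ∃ U : Lp ℝ 2 (volume.restrict (controlRegion T O)),
      U =ᵐ[volume.restrict (controlRegion T O)] u := ⟨hu.toLp u, hu.coeFn_toLp⟩
  refine ⟨‖U‖, fun p₀ p₁ q₀ p p' P hp hP => ?_⟩
  have key := hy.duality hT hM hf hfu (isAdjointSolution_iff.1 hp)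
  have hzero := pairing_eq_zero (W := H10 Ω) (H := L2 Ω) hyT hzT hmT p₀ p₁ q₀
  have e : toHneg1 (p 0) y₁ - toVdual (p' 0) y₀ = -⟪U, P⟫_ℝ := by
    rw [inner_isTrace_of_ae_eq hT hO' hR hU hP]
    refine eq_neg_of_add_eq_zero_left (Eq.trans ?_ (key.symm.trans hzero))
    rw [real_inner_comm]
    rfl
  rw [e, abs_neg]
  exact abs_real_inner_le_norm _ _

theorem MemoryNullControllable.adjointObservable (hT : 0 ≤ T)
    (hM : ContinuousOn (Function.uncurry M) (Icc 0 T ×ˢ Icc 0 T))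
    (hO : ∀ t ∈ Ioo 0 T, IsOpen (O t) ∧ O t ⊆ (Ω : Set (EuclideanSpace ℝ (Fin d))))
    (hR : MeasurableSet (controlRegion T O)) (h : MemoryNullControllable Ω T M O) :
    AdjointObservable Ω T M O := by
  -- The uniform boundedness argument is indexed by all adjoint solutions with their traces, so the
  -- resulting constant serves every solution.
  let S := {x : (ℝ → L2 Ω) × (ℝ → Hneg1 Ω) × Lp ℝ 2 (volume.restrict (controlRegion T O)) //
    (∃ p₀ p₁ q₀, IsAdjointSolution Ω T M p₀ p₁ q₀ x.1 x.2.1) ∧ IsTrace T O x.1 x.2.2}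
  have key := exists_uniform_bound (V := V Ω) (W := H10 Ω) (S := S)
  obtain ⟨C, hC, hbound⟩ := key (fun x => toHneg1 (x.1.1 0))
    (fun x => toVdual (x.1.2.1 0)) (fun x => ‖x.1.2.2‖) (fun x => norm_nonneg _)
    fun y₀ y₁ => (h.exists_bound hT hM hO hR y₀ y₁).imp fun B hB => by
      rintro ⟨⟨p, p', P⟩, ⟨p₀, p₁, q₀, hp⟩, hP⟩
      exact hB _ _ _ _ _ _ hp hP
  refine ⟨C, hC, fun p₀ p₁ q₀ p p' hp => ?_⟩
  obtain ⟨P, hP⟩ := exists_isTrace hO hR hp.continuousOn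
  rw [sqNormL2O_eq hT (fun t ht => (hO t ht).1) hR hP]
  exact hbound ⟨(p, p', P), ⟨p₀, p₁, q₀, hp⟩, hP⟩

theorem AdjointObservable.memoryNullControllable (hT : 0 ≤ T)
    (hM : ContinuousOn (Function.uncurry M) (Icc 0 T ×ˢ Icc 0 T))
    (hO : ∀ t ∈ Ioo 0 T, IsOpen (O t) ∧ O t ⊆ (Ω : Set (EuclideanSpace ℝ (Fin d))))
    (hR : MeasurableSet (controlRegion T O)) (h : AdjointObservable Ω T M O) :
    MemoryNullControllable Ω T M O := by
  intro y₀ y₁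
  obtain ⟨C, hC, hobs⟩ := h
  have hO' : ∀ t ∈ Ioo 0 T, IsOpen (O t) := fun t ht => (hO t ht).1
  have hsub : ∀ t ∈ Ioo 0 T, O t ⊆ (Ω : Set (EuclideanSpace ℝ (Fin d))) := fun t ht => (hO t ht).2
  have h0 : IsTrace T O (0 : ℝ → L2 Ω) (0 : Lp ℝ 2 (volume.restrict (controlRegion T O))) := by
    obtain ⟨P, hP⟩ := exists_isTrace hO hR (p := (0 : ℝ → L2 Ω)) continuousOn_const
    simpa using hP.smul hO' hR hsub 0
  have hle := abs_apply_sub_apply_le (V := V Ω) (W := H10 Ω)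
  obtain ⟨U, hU⟩ := exists_control (W := H10 Ω) (H := L2 Ω) (ι := toL2)
    (R := Lp ℝ 2 (volume.restrict (controlRegion T O))) hT hM
    (Tr := fun p P => IsTrace T O p (P : Lp ℝ 2 (volume.restrict (controlRegion T O)))) h0
    (fun p q P Q hp hq => hp.add hO' hR hsub hq) (fun c p P hp => hp.smul hO' hR hsub c)
    (VtoH10 y₀) (toL2 y₁) (B := √C * (‖y₁‖ + ‖y₀‖)) (by
      intro p₀ p₁ q₀ p p' P hp hP
      have h1 := hobs _ _ _ _ _ (isAdjointSolution_iff.2 hp)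
      rw [sqNormL2O_eq hT hO' hR hP] at h1
      have e : ⟪toL2 y₁, p 0⟫_ℝ - p' 0 (VtoH10 y₀) =
          toHneg1 (p 0) y₁ - toVdual (p' 0) y₀ := by
        rw [real_inner_comm]
        rfl
      rw [e]
      exact hle _ _ _ hC.le (norm_nonneg P) h1 y₁ y₀)
  obtain ⟨f, hf, hfu⟩ := exists_forcing hO hR (Lp.memLp U)
  obtain ⟨y, z, hy⟩ := exists_isMemoryWaveSolution hT hM hf hfu (VtoH10 y₀) (toL2 y₁)
  have hι := isDenseEmbedding_toL2 (Ω := Ω)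
  -- The choice of U makes the initial side of the duality identity vanish for every adjoint
  -- solution; hence so does the terminal side.
  obtain ⟨h1, h2, h3⟩ := eq_zero_of_duality (W := H10 Ω) (H := L2 Ω) hι hT hM
    (w := y T) (z := z T) (m := ∫ s in 0..T, M T s • toL2 (y s)) (by
      intro p₀ p₁ q₀ p p' hp
      obtain ⟨P, hP⟩ := exists_isTrace hO hR hp.continuousOn
      rw [hy.duality hT hM hf hfu hp, ← inner_isTrace hT hO' hR U hP]
      exact hU _ _ _ _ _ _ hp hP)
  exact ⟨U, Lp.memLp U, y, z, hy, h1, h2, h3⟩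

end Concrete

end MemoryWave

end

theorem proposition3p1 {d : ℕ} (hd : 0 < d) (Ω : TopologicalSpace.Opens (EuclideanSpace ℝ (Fin d)))
    (hconn : IsConnected (Ω : Set (EuclideanSpace ℝ (Fin d))))
    (hbdd : Bornology.IsBounded (Ω : Set (EuclideanSpace ℝ (Fin d))))
    (hsmooth : MemoryWave.HasSmoothBoundary (Ω : Set (EuclideanSpace ℝ (Fin d))))
    (T : ℝ) (hT : 0 < T)
    (M : ℝ → ℝ → ℝ) (hM : ContinuousOn (Function.uncurry M) (Set.Icc 0 T ×ˢ Set.Icc 0 T))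
    (O : ℝ → Set (EuclideanSpace ℝ (Fin d)))
    (hO : ∀ t ∈ Set.Ioo 0 T, IsOpen (O t) ∧ O t ⊆ (Ω : Set (EuclideanSpace ℝ (Fin d))))
    (hOmeas : MeasurableSet (MemoryWave.controlRegion T O)) :
    MemoryWave.MemoryNullControllable Ω T M O ↔ MemoryWave.AdjointObservable Ω T M O :=
  ⟨fun h => h.adjointObservable hT.le hM hO hOmeas,
    fun h => h.memoryNullControllable hT.le hM hO hOmeas⟩
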